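/- Let $a>0$ and $p_0\in[1/2,1)$, and let $y_1,y_2,\dots$ be iid from $p_{\mathrm{true}}=p_0\,\mathrm{Cauchy}(a,1)+(1-p_0)\,\mathrm{Cauchy}(-a,1)$. Fit the model $y_i\sim\mathrm{Cauchy}(\mu,1)$, with density $p(y\mid\mu)=\frac{1}{\pi(1+(y-\mu)^2)}$, with a prior on $\mu$ of full support on $\mathbb R$; the prior may be improper if the posterior $p(\mu\mid y_{1:n})$ is proper for large $n$, that is, if $(1+\mu^2)^{-m}$ is prior-integrable for some $m\in\mathbb N$. Let $h(\mu)=\int p_{\mathrm{true}}(\tilde y)\log p(\tilde y\mid\mu)\,d\tilde y$ (the limit of $\frac1n\log p(\mu\mid y_{1:n})$ up to a constant). For $a\ge 2$ let $\xi(a)$ be the unique root in $[1/2,1)$ of $$x^4(a^6+4a^4)-x^3(2a^6+8a^4)+x^2(a^6-8a^4-44a^2)+x(12a^4+44a^2)-4a^4-8a^2-4=0.$$ The (limiting) posterior modes $\gamma^-<\gamma^+$ are the local maximizers of $h$, separated by the local minimizer $\gamma^0$. Let $c_n$ (possibly data-dependent) satisfy $c_n\to\gamma^0$, and let $p_-(\cdot\mid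 y_{1:n})$ and $p_+(\cdot\mid y_{1:n})$ be the posterior conditioned on $\mu<c_n$ and on $\mu\ge c_n$ (the two clusters). The leave-one-out predictive densities are $p_k(y_i\mid y_{-i})=\int p(y_i\mid\mu)p_k(\mu\mid y_{-i})\,d\mu$ with $p_k(\mu\mid y_{-i})\propto p_k(\mu\mid y_{1:n})/p(y_i\mid\mu)$. Stacking weights are any maximizer $(w_n^-,w_n^+)$ over the simplex $\{w^\pm\ge0,\ w^-+w^+=1\}$ of $$\sum_{i=1}^n\log\bigl(w^-p_-(y_i\mid y_{-i})+w^+p_+(y_i\mid y_{-i})\bigr)+\log\rho(w),$$ where $\rho\ge0$ (for example $\rho=1$) is a fixed prior density on the weights, continuous on the simplex and positive on its relative interior. Put $p_{\mathrm{stacking}}(\mu\mid y_{1:n})=w_n^-p_-(\mu\mid y_{1:n})+w_n^+p_+(\mu\mid y_{1:n})$, and for an inference $q$ on $\mu$ put $\mathrm{elpd}(q)=\int p_{\mathrm{true}}(\tilde y)\log\int p(\tilde y\mid\mu)\,q(d\mu)\,d\tilde y$. In each of the following cases, almost surely, stacking weights exist for all large $n$, and: (a) If $a>2$ and $1/2<p_0<\xi(a)$,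 then $h$ has exactly two local maximizers $\gamma^-<\gamma^+$ and exactly one local minimizer $\gamma^0\in(\gamma^-,\gamma^+)$, and there are $w^-,w^+>0$ with $w^-+w^+=1$ and $\delta>0$, all depending only on $(a,p_0)$, such that, almost surely, $(w_n^-,w_n^+)\to(w^-,w^+)$, and for all large $n$ the two elpd integrals converge and $\mathrm{elpd}(p_{\mathrm{stacking}}(\cdot\mid y_{1:n}))\ge\mathrm{elpd}(p(\cdot\mid y_{1:n}))+\delta$. In particular the stacked elpd is strictly larger than the Bayesian elpd. (b) For every $p_0\in[1/2,1)$ and $\varepsilon>0$ there is $A$ such that for every $a>A$: $a>2$, $p_0<\xi(a)$, and, almost surely, for all large $n$, $$|w_n^--(1-p_0)|<\varepsilon,\qquad |w_n^+-p_0|<\varepsilon,\qquad \mathrm{KL}\Bigl(p_{\mathrm{true}}\,\Big\|\,\int p(\cdot\mid\mu)\,p_{\mathrm{stacking}}(\mu\mid y_{1:n})\,d\mu\Bigr)<\varepsilon.$$ (c) If $a>2$ and $p_0=1/2$, then the modes are $\gamma^\pm=\pm\sqrt{a^2-4}$, separated by $\gamma^0=0$, and, almost surely, $(w_n^-,w_n^+)\to(1/2,1/2)$.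 -/

import Mathlib

open MeasureTheory ProbabilityTheory Filter Topology

noncomputable section

namespace CauchyStacking

/-! ### Data generating process -/

/-- The data generating process `p · Cauchy(a, 1) + (1 - p) · Cauchy(-a, 1)`. -/
def trueMeasure (a p : ℝ) : Measure ℝ :=
  ENNReal.ofReal p • cauchyMeasure a 1 + ENNReal.ofReal (1 - p) • cauchyMeasure (-a) 1

/-- The law of an iid sequence `y 0, y 1, …` of observations from the data generating process. -/
def dataLaw (a p : ℝ) : Measure (ℕ → ℝ) :=
  Measure.infinitePi fun _ : ℕ => trueMeasure a p

/-! ### The model `Cauchy(μ, 1)` and its posterior -/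

/-- Rescale a measure to total mass one. -/
def normalize (κ : Measure ℝ) : Measure ℝ := (κ Set.univ)⁻¹ • κ

/-- A prior on the location `μ`: it has full support on `ℝ`, and it may be improper, but then the
posterior must be proper as soon as there are enough observations. Probability measures
(`m = 0`) and the flat prior (`m = 1`) qualify. -/
def IsPrior (ν : Measure ℝ) : Prop :=
  ν.IsOpenPosMeasure ∧ ∃ m : ℕ, Integrable (fun μ : ℝ => ((1 + μ ^ 2) ^ m)⁻¹) ν

/-- The likelihood of `μ` given the first `n` observations. -/
def likelihood (y : ℕ → ℝ) (n : ℕ) (μ : ℝ) : ℝ :=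
  ∏ i ∈ Finset.range n, cauchyPDFReal μ 1 (y i)

/-- The exact posterior given the first `n` observations. -/
def exactPosterior (ν : Measure ℝ) (y : ℕ → ℝ) (n : ℕ) : Measure ℝ :=
  normalize (ν.withDensity fun μ => ENNReal.ofReal (likelihood y n μ))

/-- The predictive density `∫ p(ỹ | μ) κ(dμ)` of an inference `κ` on `μ`. -/
def predDensity (κ : Measure ℝ) (ytilde : ℝ) : ℝ :=
  ∫ μ, cauchyPDFReal μ 1 ytilde ∂κ

/-- The predictive distribution of an inference `κ` on `μ`. -/
def predMeasure (κ : Measure ℝ) : Measure ℝ :=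
  volume.withDensity fun ytilde => ENNReal.ofReal (predDensity κ ytilde)

/-- The expected log predictive density of an inference `κ` under the data generating process. -/
def elpd (a p : ℝ) (κ : Measure ℝ) : ℝ :=
  ∫ ytilde, Real.log (predDensity κ ytilde) ∂(trueMeasure a p)

/-! ### The limiting log posterior and its modes -/

/-- The almost sure limit (up to a constant that does not depend on `μ`) of `1 / n` times the log
posterior density at `μ`: the expected log density of the model. -/
def limitLogPosterior (a p μ : ℝ) : ℝ :=
  ∫ ytilde, Real.log (cauchyPDFReal μ 1 ytilde) ∂(trueMeasure a p)

/-- The set of posterior modes in the limit of many observations. -/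
def modes (a p : ℝ) : Set ℝ := {μ | IsLocalMax (limitLogPosterior a p) μ}

/-- The set of local minima that separate the modes. -/
def antimodes (a p : ℝ) : Set ℝ := {μ | IsLocalMin (limitLogPosterior a p) μ}

/-- The left mode. -/
def gammaMinus (a p : ℝ) : ℝ := sInf (modes a p)

/-- The right mode. -/
def gammaPlus (a p : ℝ) : ℝ := sSup (modes a p)

/-- The antimode, which is the boundary between the attraction regions of the two modes (where
there are two modes, `antimodes a p` has one element). -/
def antimode (a p : ℝ) : ℝ := sSup (antimodes a p)

/-- The quartic polynomial that determines the number of modes; it is `1 / 64` times the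
discriminant, as a function of `x = p`, of the numerator of the derivative of the limiting log
posterior. -/
def xiPoly (a x : ℝ) : ℝ :=
  x ^ 4 * (a ^ 6 + 4 * a ^ 4) + x ^ 3 * (-2 * a ^ 6 - 8 * a ^ 4)
    + x ^ 2 * (a ^ 6 - 8 * a ^ 4 - 44 * a ^ 2) + x * (12 * a ^ 4 + 44 * a ^ 2)
    - 4 * a ^ 4 - 8 * a ^ 2 - 4

/-- The threshold `ξ(a)` for `a ≥ 2`: the (only) root of the quartic in `[1/2, 1)`. -/
def xi (a : ℝ) : ℝ := sSup {x | 1 / 2 ≤ x ∧ x < 1 ∧ xiPoly a x = 0}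

/-! ### Clusters and stacking -/

/-- The local posteriors of the two clusters: the exact posterior, conditioned on the region left
of the cut point `c` (index `0`) and on the region right of it (index `1`). -/
def clusters (ν : Measure ℝ) (y : ℕ → ℝ) (n : ℕ) (c : ℝ) : Fin 2 → Measure ℝ :=
  ![normalize ((exactPosterior ν y n).restrict (Set.Iio c)),
    normalize ((exactPosterior ν y n).restrict (Set.Ici c))]

/-- The leave-one-out version of a local posterior `κ`: divide its density by the likelihood of
the observation `yi` that is left out, and normalize. -/
def leaveOut (κ : Measure ℝ) (yi : ℝ) : Measure ℝ :=
  normalize (κ.withDensity fun μ => ENNReal.ofReal (cauchyPDFReal μ 1 yi)⁻¹)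

/-- The stacking objective for the weights `w`: the leave-one-out log score of the weighted mixture
of the local posteriors `q k`, plus the log density of the prior `ρ` on the weights. -/
def stackingObjective {K : ℕ} (ρ : (Fin K → ℝ) → ℝ) (q : Fin K → Measure ℝ)
    (y : ℕ → ℝ) (n : ℕ) (w : Fin K → ℝ) : ℝ :=
  ∑ i ∈ Finset.range n, Real.log (∑ k, w k * predDensity (leaveOut (q k) (y i)) (y i))
    + Real.log (ρ w)

/-- `w` are stacking weights: they maximize the objective over the simplex. Points with `ρ w = 0`
have objective `-∞` and are no candidates. -/
def IsStackingWeights {K : ℕ} (ρ : (Fin K → ℝ) → ℝ) (q : Fin K → Measure ℝ)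
    (y : ℕ → ℝ) (n : ℕ) (w : Fin K → ℝ) : Prop :=
  w ∈ stdSimplex ℝ (Fin K) ∧ 0 < ρ w ∧
    ∀ w' ∈ stdSimplex ℝ (Fin K), 0 < ρ w' →
      stackingObjective ρ q y n w' ≤ stackingObjective ρ q y n w

/-- A prior density for the weights: continuous on the simplex, and positive on its relative
interior. The constant `1` (no regularization) and the Dirichlet densities with all parameters at
least `1` qualify. -/
def IsWeightPrior {K : ℕ} (ρ : (Fin K → ℝ) → ℝ) : Prop :=
  ContinuousOn ρ (stdSimplex ℝ (Fin K)) ∧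
    ∀ w ∈ stdSimplex ℝ (Fin K), 0 ≤ ρ w ∧ ((∀ k, 0 < w k) → 0 < ρ w)

/-- The stacked inference `∑ k, w k · q k`. -/
def stacked {K : ℕ} (q : Fin K → Measure ℝ) (w : Fin K → ℝ) : Measure ℝ :=
  ∑ k, ENNReal.ofReal (w k) • q k

end CauchyStacking

end

open CauchyStacking

namespace CauchyStacking

/-! ### The Cauchy density -/

/-! In the location, the log density of the Cauchy model is 1-Lipschitz uniformly in the
observation, and the density ratio of two locations differs from 1 by at most `shiftBound`. So a
posterior concentrated at `γ` has a predictive density, and a leave-one-out predictive density at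
every observation, within a factor `exp (2 * r)` of Cauchy(γ, 1). Stacking the clusters then
amounts, up to a small multiple of `n`, to choosing the weight of a mixture of two fixed Cauchy
densities.

Concentration: the law of large numbers at rational locations and the Lipschitz bound give uniform
convergence on compacts, and a factor `(1 + μ ^ 2)⁻¹` per observation controls the tails, also for
improper priors (`IsTypical.eventually_isNear`). The derivative of the limiting log posterior is a
negative function times a cubic with discriminant `64 * xiPoly a p`. Below the threshold it has
three real roots: two modes and the antimode between them.

Weights: the limiting score is strictly concave in the weight (`limitScore_midpoint_lt`), and its
maximizer is interior. When weight moves from location `g₁` to `g₂`, the initial slope is the mean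
of the density ratio minus 1. Its linear part is a multiple of the expected score at `g₂`, which
vanishes at a critical point, and the rest is a positive multiple of `(g₂ - g₁) ^ 2`
(`exists_limitScore_zero_lt`). Concavity carries this over to the random maximizers
(`tendsto_stackingWeights`).

(a) For `p > 1/2` the right mode is the global one, so the exact posterior concentrates there. Its
elpd tends to the score of the mixture at the endpoint 1, strictly below the interior maximum. (b)
For large `a` the modes are close to `±a`, so the mixture with weight `p` has small divergence from
the truth, and the optimal mixture is at least as good. A Pinsker type inequality on the positive
half-line then recovers the weights. (c) Reflection fixes the unique maximizer.

The exceptional null sets concern only average log densities, not the cut points, so the cut may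
depend on the data. -/

lemma cauchyPDFReal_one (μ y : ℝ) :
    cauchyPDFReal μ 1 y = Real.pi⁻¹ * (1 + (y - μ) ^ 2)⁻¹ := by
  simp [cauchyPDFReal_def, add_comm]

lemma cauchyPDFReal_one_pos (μ y : ℝ) : 0 < cauchyPDFReal μ 1 y :=
  cauchyPDF_pos μ one_ne_zero y

lemma cauchyPDFReal_one_le (μ y : ℝ) : cauchyPDFReal μ 1 y ≤ 1 := by
  rw [cauchyPDFReal_one]
  have h1 : Real.pi⁻¹ ≤ 1 := inv_le_one_of_one_le₀ (by linarith [Real.pi_gt_three])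
  have h2 : (1 + (y - μ) ^ 2)⁻¹ ≤ 1 := inv_le_one_of_one_le₀ (by nlinarith [sq_nonneg (y - μ)])
  exact mul_le_one₀ h1 (by positivity) h2

lemma measurable_cauchyPDFReal_left (y : ℝ) : Measurable fun μ => cauchyPDFReal μ 1 y := by
  simp only [cauchyPDFReal_one]
  fun_prop

lemma log_cauchyPDFReal (μ y : ℝ) :
    Real.log (cauchyPDFReal μ 1 y) = -Real.log Real.pi - Real.log (1 + (y - μ) ^ 2) := by
  rw [cauchyPDFReal_one, Real.log_mul (by positivity) (by positivity), Real.log_inv, Real.log_inv]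
  ring

/-- The bound on the relative change of the density when the location moves by `|μ - γ|`. -/
def shiftBound (γ μ : ℝ) : ℝ := |μ - γ| + (μ - γ) ^ 2

lemma shiftBound_nonneg (γ μ : ℝ) : 0 ≤ shiftBound γ μ := by unfold shiftBound; positivity

lemma measurable_shiftBound (γ : ℝ) : Measurable (shiftBound γ) := by
  unfold shiftBound; fun_prop

lemma shiftBound_comm (γ μ : ℝ) : shiftBound γ μ = shiftBound μ γ := by
  unfold shiftBound; rw [abs_sub_comm]; ring

/-- The numerator of the ratio minus 1 is only linear in `y - μ`, and `2|x| ≤ 1 + x²` absorbs it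
into the denominator. Uniformity in `y` is what later avoids any control of extreme observations. -/
lemma abs_ratio_sub_one_le (μ γ y : ℝ) :
    |cauchyPDFReal μ 1 y / cauchyPDFReal γ 1 y - 1| ≤ shiftBound γ μ := by
  have e : cauchyPDFReal μ 1 y / cauchyPDFReal γ 1 y - 1
      = ((μ - γ) * (2 * (y - μ)) + (μ - γ) ^ 2) / (1 + (y - μ) ^ 2) := by
    rw [cauchyPDFReal_one, cauchyPDFReal_one]
    have := Real.pi_pos
    field_simp
    ring
  rw [e, abs_div, abs_of_pos (a := 1 + (y - μ) ^ 2) (by positivity), div_le_iff₀ (by positivity)]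
  have h1 : |2 * (y - μ)| ≤ 1 + (y - μ) ^ 2 := by
    rw [abs_le]; constructor <;> nlinarith [sq_nonneg (y - μ - 1), sq_nonneg (y - μ + 1)]
  calc _ ≤ |(μ - γ) * (2 * (y - μ))| + |(μ - γ) ^ 2| := abs_add_le _ _
    _ ≤ |μ - γ| * (1 + (y - μ) ^ 2) + (μ - γ) ^ 2 * (1 + (y - μ) ^ 2) := by
        rw [abs_mul, abs_of_nonneg (sq_nonneg (μ - γ))]
        have := mul_le_mul_of_nonneg_left h1 (abs_nonneg (μ - γ))
        nlinarith [mul_nonneg (sq_nonneg (μ - γ)) (sq_nonneg (y - μ))]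
    _ = _ := by unfold shiftBound; ring

lemma abs_log_one_add_sq_sub_le (x z : ℝ) :
    |Real.log (1 + x ^ 2) - Real.log (1 + z ^ 2)| ≤ |x - z| := by
  have hd : ∀ x : ℝ, HasDerivAt (fun x : ℝ => Real.log (1 + x ^ 2)) (2 * x / (1 + x ^ 2)) x := by
    intro x
    have h := ((hasDerivAt_pow 2 x).const_add 1).log (by positivity)
    simpa using h
  have h := Convex.norm_image_sub_le_of_norm_hasDerivWithin_le (C := 1) (s := Set.univ)
    (f := fun x : ℝ => Real.log (1 + x ^ 2)) (fun x _ => (hd x).hasDerivWithinAt)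
    (fun x _ => by
      rw [Real.norm_eq_abs, abs_div, abs_of_pos (a := 1 + x ^ 2) (by positivity),
        div_le_one (by positivity), abs_le]
      constructor <;> nlinarith [sq_nonneg (x - 1), sq_nonneg (x + 1)]) convex_univ
    (Set.mem_univ z) (Set.mem_univ x)
  simpa using h

lemma abs_log_cauchyPDFReal_sub_le (μ γ y : ℝ) :
    |Real.log (cauchyPDFReal μ 1 y) - Real.log (cauchyPDFReal γ 1 y)| ≤ |μ - γ| := by
  rw [log_cauchyPDFReal, log_cauchyPDFReal]
  have h := abs_log_one_add_sq_sub_le (y - γ) (y - μ)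
  have e : y - γ - (y - μ) = μ - γ := by ring
  rw [e] at h
  convert! h using 2
  ring

/-- From `1 + μ² ≤ 2(1 + y²)(1 + (y - μ)²)`: each observation contributes a factor `(1 + μ²)⁻¹` at a
cost that depends on `y` only. This is the source of all tail control in the location. -/
lemma log_cauchyPDFReal_le (μ y : ℝ) :
    Real.log (cauchyPDFReal μ 1 y) ≤ Real.log 2 - 2 * Real.log Real.pi
      - Real.log (cauchyPDFReal 0 1 y) - Real.log (1 + μ ^ 2) := by
  rw [log_cauchyPDFReal, log_cauchyPDFReal]
  have h : Real.log (1 + μ ^ 2) ≤ Real.log (2 * (1 + y ^ 2) * (1 + (y - μ) ^ 2)) := by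
    apply Real.log_le_log (by positivity)
    nlinarith [sq_nonneg (2 * y - μ), mul_nonneg (sq_nonneg y) (sq_nonneg (y - μ))]
  rw [Real.log_mul (by positivity) (by positivity), Real.log_mul (by positivity) (by positivity)] at h
  simp only [sub_zero]
  linarith

/-! ### The data generating process -/

lemma cauchyMeasure_one (m : ℝ) : cauchyMeasure m 1
    = volume.withDensity fun y => ENNReal.ofReal (cauchyPDFReal m 1 y) :=
  cauchyMeasure_of_scale_ne_zero m one_ne_zero

/-- The density of the data generating process. -/
noncomputable def trueDensity (a p y : ℝ) : ℝ := p * cauchyPDFReal a 1 y + (1 - p) * cauchyPDFReal (-a) 1 y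

lemma trueDensity_pos {p : ℝ} (h0 : 0 ≤ p) (h1 : p ≤ 1) (a y : ℝ) : 0 < trueDensity a p y := by
  have u := cauchyPDFReal_one_pos a y
  have v := cauchyPDFReal_one_pos (-a) y
  unfold trueDensity
  rcases h0.eq_or_lt with h | h
  · subst h; simpa using v
  · have := mul_nonneg (sub_nonneg.2 h1) v.le
    positivity

lemma measurable_trueDensity (a p : ℝ) : Measurable (trueDensity a p) := by
  unfold trueDensity
  fun_prop

lemma trueMeasure_eq_withDensity {p : ℝ} (h0 : 0 ≤ p) (h1 : p ≤ 1) (a : ℝ) :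
    trueMeasure a p = volume.withDensity fun y => ENNReal.ofReal (trueDensity a p y) := by
  unfold trueMeasure
  rw [cauchyMeasure_one, cauchyMeasure_one, ← withDensity_smul _ (by fun_prop),
    ← withDensity_smul _ (by fun_prop), ← withDensity_add_left (by fun_prop)]
  congr 1
  ext y
  simp only [Pi.add_apply, Pi.smul_apply, smul_eq_mul, trueDensity]
  rw [ENNReal.ofReal_add (mul_nonneg h0 (cauchyPDFReal_one_pos _ _).le)
    (mul_nonneg (sub_nonneg.2 h1) (cauchyPDFReal_one_pos _ _).le), ENNReal.ofReal_mul h0,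
    ENNReal.ofReal_mul (sub_nonneg.2 h1)]

lemma isProbabilityMeasure_trueMeasure {p : ℝ} (h0 : 0 ≤ p) (h1 : p ≤ 1) (a : ℝ) :
    IsProbabilityMeasure (trueMeasure a p) := by
  constructor
  simp only [trueMeasure, Measure.add_apply, Measure.smul_apply, measure_univ, smul_eq_mul, mul_one]
  rw [← ENNReal.ofReal_add h0 (sub_nonneg.2 h1)]
  simp

lemma integrable_trueMeasure {a p : ℝ} {f : ℝ → ℝ} (hf : ∀ m, Integrable f (cauchyMeasure m 1)) :
    Integrable f (trueMeasure a p) :=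
  ((hf a).smul_measure ENNReal.ofReal_ne_top).add_measure
    ((hf (-a)).smul_measure ENNReal.ofReal_ne_top)

lemma integral_trueMeasure {a p : ℝ} (h0 : 0 ≤ p) (h1 : p ≤ 1) {f : ℝ → ℝ}
    (hf : ∀ m, Integrable f (cauchyMeasure m 1)) :
    ∫ y, f y ∂(trueMeasure a p)
      = p * ∫ y, f y ∂(cauchyMeasure a 1) + (1 - p) * ∫ y, f y ∂(cauchyMeasure (-a) 1) := by
  unfold trueMeasure
  rw [integral_add_measure ((hf a).smul_measure ENNReal.ofReal_ne_top)
    ((hf (-a)).smul_measure ENNReal.ofReal_ne_top), integral_smul_measure, integral_smul_measure,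
    ENNReal.toReal_ofReal h0, ENNReal.toReal_ofReal (sub_nonneg.2 h1)]
  simp

lemma integral_cauchyMeasure (m : ℝ) (f : ℝ → ℝ) :
    ∫ y, f y ∂(cauchyMeasure m 1) = ∫ y, cauchyPDFReal m 1 y * f y := by
  rw [cauchyMeasure_one, integral_withDensity_eq_integral_toReal_smul (by fun_prop) (by simp)]
  simp [ENNReal.toReal_ofReal (cauchyPDFReal_one_pos _ _).le]

lemma integrable_cauchyMeasure_iff (m : ℝ) (f : ℝ → ℝ) :
    Integrable f (cauchyMeasure m 1) ↔ Integrable fun y => cauchyPDFReal m 1 y * f y := by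
  rw [cauchyMeasure_one, integrable_withDensity_iff_integrable_smul' (by fun_prop) (by simp)]
  simp [ENNReal.toReal_ofReal (cauchyPDFReal_one_pos _ _).le]

/-- The logarithm is dominated by a power 1/4, which leaves the integrable decay `(1 + (y -
m)²)^(-3/4)`; changing the location from `m` to `μ` is a bounded perturbation. -/
lemma integrable_log_cauchyPDFReal (m μ : ℝ) :
    Integrable (fun y => Real.log (cauchyPDFReal μ 1 y)) (cauchyMeasure m 1) := by
  have base : Integrable (fun y => Real.log (1 + (y - m) ^ 2)) (cauchyMeasure m 1) := by
    rw [integrable_cauchyMeasure_iff]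
    have h := ((integrable_rpow_neg_one_add_norm_sq (E := ℝ) (μ := volume) (r := 3 / 2)
      (by simp; norm_num)).comp_sub_right m).const_mul 4
    refine h.mono' (by fun_prop) (ae_of_all _ fun y => ?_)
    have hpos : 0 < 1 + (y - m) ^ 2 := by positivity
    have hone : 1 ≤ 1 + (y - m) ^ 2 := by nlinarith [sq_nonneg (y - m)]
    have hl := Real.log_le_rpow_div hpos.le (ε := 1 / 4) (by norm_num)
    rw [Real.norm_of_nonneg (mul_nonneg (cauchyPDFReal_one_pos _ _).le (Real.log_nonneg hone)),
      cauchyPDFReal_one, Real.norm_eq_abs, sq_abs]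
    have e : (1 + (y - m) ^ 2) ^ (-(3 / 2 : ℝ) / 2)
        = (1 + (y - m) ^ 2)⁻¹ * (1 + (y - m) ^ 2) ^ (1 / 4 : ℝ) := by
      rw [← Real.rpow_neg_one, ← Real.rpow_add hpos]; norm_num
    rw [e]
    have hpi : Real.pi⁻¹ ≤ 1 := inv_le_one_of_one_le₀ (by linarith [Real.pi_gt_three])
    calc Real.pi⁻¹ * (1 + (y - m) ^ 2)⁻¹ * Real.log (1 + (y - m) ^ 2)
        ≤ 1 * (1 + (y - m) ^ 2)⁻¹ * ((1 + (y - m) ^ 2) ^ (1 / 4 : ℝ) / (1 / 4)) := by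
          gcongr
          exact Real.log_nonneg hone
      _ = _ := by ring
  have h2 : Integrable (fun y => Real.log (cauchyPDFReal m 1 y)) (cauchyMeasure m 1) := by
    simp only [log_cauchyPDFReal]
    exact (integrable_const _).sub base
  have h3 : Integrable (fun y => Real.log (cauchyPDFReal μ 1 y) - Real.log (cauchyPDFReal m 1 y))
      (cauchyMeasure m 1) :=
    (integrable_const |μ - m|).mono' (by fun_prop)
      (ae_of_all _ fun y => abs_log_cauchyPDFReal_sub_le μ m y)
  exact (h3.add h2).congr (ae_of_all _ fun y => by simp)

lemma integrable_log_cauchyPDFReal_trueMeasure (a p μ : ℝ) :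
    Integrable (fun y => Real.log (cauchyPDFReal μ 1 y)) (trueMeasure a p) :=
  integrable_trueMeasure fun m => integrable_log_cauchyPDFReal m μ

/-! ### The expected score -/

lemma abs_div_one_add_sq_le (x : ℝ) : |x / (1 + x ^ 2)| ≤ 1 := by
  rw [abs_div, abs_of_pos (a := 1 + x ^ 2) (by positivity), div_le_one (by positivity), abs_le]
  constructor <;> nlinarith [sq_nonneg (x - 1), sq_nonneg (x + 1)]

lemma integrable_score (P : Measure ℝ) [IsFiniteMeasure P] (b : ℝ) :
    Integrable (fun y => (y - b) / (1 + (y - b) ^ 2)) P :=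
  (integrable_const (1 : ℝ)).mono'
    (Measurable.aestronglyMeasurable (by fun_prop)) (ae_of_all _ fun _ => abs_div_one_add_sq_le _)

lemma tendsto_div_one_add_sq {l : Filter ℝ} (hl : Tendsto (fun x : ℝ => |x|) l atTop) :
    Tendsto (fun x : ℝ => x / (1 + x ^ 2)) l (𝓝 0) := by
  refine squeeze_zero_norm' ?_ (tendsto_inv_atTop_zero.comp hl)
  filter_upwards [hl.eventually_gt_atTop 0] with x hx
  simp only [Function.comp]
  rw [Real.norm_eq_abs, abs_div, abs_of_pos (a := 1 + x ^ 2) (by positivity),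
    div_le_iff₀ (by positivity), inv_mul_eq_div, le_div_iff₀ hx, ← sq, sq_abs]
  linarith

lemma tendsto_inv_one_add_sq {l : Filter ℝ} (hl : Tendsto (fun x : ℝ => |x|) l atTop) :
    Tendsto (fun x : ℝ => (1 + x ^ 2)⁻¹) l (𝓝 0) := by
  refine tendsto_inv_atTop_zero.comp (tendsto_atTop_mono' l ?_ hl)
  filter_upwards with x
  rw [← sq_abs]
  nlinarith [sq_nonneg (|x| - 1)]

lemma tendsto_log_one_add_sq_sub {l : Filter ℝ} (d : ℝ)
    (hl : Tendsto (fun x : ℝ => |x - d|) l atTop) :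
    Tendsto (fun x : ℝ => Real.log (1 + x ^ 2) - Real.log (1 + (x - d) ^ 2)) l (𝓝 0) := by
  have hl' : Tendsto (fun x : ℝ => |x|) (l.map (· - d)) atTop := by
    rw [tendsto_map'_iff]; exact hl
  have h1 : Tendsto (fun x : ℝ => (x - d) / (1 + (x - d) ^ 2)) l (𝓝 0) :=
    tendsto_map'_iff.1 (tendsto_div_one_add_sq hl')
  have h2 : Tendsto (fun x : ℝ => (1 + (x - d) ^ 2)⁻¹) l (𝓝 0) :=
    tendsto_map'_iff.1 (tendsto_inv_one_add_sq hl')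
  have h3 := ((h1.const_mul (2 * d)).add (h2.const_mul (d ^ 2))).const_add 1
  simp only [mul_zero, add_zero] at h3
  have h4 := (Real.continuousAt_log one_ne_zero).tendsto.comp h3
  rw [Real.log_one] at h4
  refine h4.congr fun x => ?_
  simp only [Function.comp]
  rw [← Real.log_div (by positivity) (by positivity)]
  congr 1
  field_simp
  ring

/-- Partial fractions give an explicit primitive. Its coefficients have `d` in the denominator, so
`d = 0` is treated apart, by oddness. -/
lemma integral_score_cauchyMeasure (m b : ℝ) :
    ∫ y, (y - b) / (1 + (y - b) ^ 2) ∂(cauchyMeasure m 1) = (m - b) / (4 + (m - b) ^ 2) := by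
  obtain ⟨d, rfl⟩ : ∃ d, m = b + d := ⟨m - b, by ring⟩
  have hint := (integrable_cauchyMeasure_iff _ _).1 (integrable_score (cauchyMeasure (b + d) 1) b)
  rw [integral_cauchyMeasure]
  have hint' := hint.comp_add_right b
  rw [← integral_add_right_eq_self _ b]
  simp only [cauchyPDFReal_one, add_sub_cancel_right, add_sub_cancel_left,
    show ∀ y : ℝ, y + b - (b + d) = y - d by intro y; ring] at hint' ⊢
  rcases eq_or_ne d 0 with rfl | hd
  · have h := integral_neg_eq_self
      (fun y : ℝ => Real.pi⁻¹ * (1 + (y - 0) ^ 2)⁻¹ * (y / (1 + y ^ 2))) volume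
    simp only [sub_zero, neg_sq, neg_div, mul_neg, integral_neg] at h ⊢
    simp; linarith
  · have hd4 : d * (4 + d ^ 2) ≠ 0 := mul_ne_zero hd (by positivity)
    -- The two logarithms must stay together: their difference vanishes at both ends, and the
    -- arctangents give the value.
    have key := integral_of_hasDerivAt_of_tendsto (E := ℝ)
      (f := fun x => Real.pi⁻¹ * (1 / (2 * (4 + d ^ 2)) * (Real.log (1 + x ^ 2)
        - Real.log (1 + (x - d) ^ 2)) - 2 / (d * (4 + d ^ 2)) * Real.arctan x
        + (2 + d ^ 2) / (d * (4 + d ^ 2)) * Real.arctan (x - d)))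
      (f' := fun y : ℝ => Real.pi⁻¹ * (1 + (y - d) ^ 2)⁻¹ * (y / (1 + y ^ 2)))
      (m := Real.pi⁻¹ * (1 / (2 * (4 + d ^ 2)) * 0 - 2 / (d * (4 + d ^ 2)) * (-(Real.pi / 2))
        + (2 + d ^ 2) / (d * (4 + d ^ 2)) * (-(Real.pi / 2))))
      (n := Real.pi⁻¹ * (1 / (2 * (4 + d ^ 2)) * 0 - 2 / (d * (4 + d ^ 2)) * (Real.pi / 2)
        + (2 + d ^ 2) / (d * (4 + d ^ 2)) * (Real.pi / 2))) ?_ hint' ?_ ?_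
    · rw [key]
      have := Real.pi_pos
      field_simp
      ring
    · intro x
      have e1 : HasDerivAt (fun x : ℝ => Real.log (1 + x ^ 2)) (2 * x / (1 + x ^ 2)) x := by
        simpa using ((hasDerivAt_pow 2 x).const_add 1).log (by positivity)
      have e2 : HasDerivAt (fun x : ℝ => Real.log (1 + (x - d) ^ 2))
          (2 * (x - d) / (1 + (x - d) ^ 2)) x := by
        simpa using ((((hasDerivAt_id x).sub_const d).pow 2).const_add 1).log (by simp; positivity)
      have e3 := Real.hasDerivAt_arctan x
      have e4 : HasDerivAt (fun x : ℝ => Real.arctan (x - d)) (1 / (1 + (x - d) ^ 2)) x := by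
        simpa using ((hasDerivAt_id x).sub_const d).arctan
      have := ((((e1.sub e2).const_mul (1 / (2 * (4 + d ^ 2)))).sub
        (e3.const_mul (2 / (d * (4 + d ^ 2))))).add
        (e4.const_mul ((2 + d ^ 2) / (d * (4 + d ^ 2))))).const_mul Real.pi⁻¹
      refine this.congr_deriv ?_
      have := Real.pi_pos
      field_simp
      ring
    · refine (((tendsto_log_one_add_sq_sub d ?_).const_mul _).sub ?_ |>.add ?_).const_mul _
      · exact tendsto_abs_atBot_atTop.comp (tendsto_atBot_add_const_right _ _ tendsto_id)
      · exact (tendsto_nhds_of_tendsto_nhdsWithin Real.tendsto_arctan_atBot).const_mul _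
      · exact ((tendsto_nhds_of_tendsto_nhdsWithin Real.tendsto_arctan_atBot).comp
          (tendsto_atBot_add_const_right _ _ tendsto_id)).const_mul _
    · refine (((tendsto_log_one_add_sq_sub d ?_).const_mul _).sub ?_ |>.add ?_).const_mul _
      · exact tendsto_abs_atTop_atTop.comp (tendsto_atTop_add_const_right _ _ tendsto_id)
      · exact (tendsto_nhds_of_tendsto_nhdsWithin Real.tendsto_arctan_atTop).const_mul _
      · exact ((tendsto_nhds_of_tendsto_nhdsWithin Real.tendsto_arctan_atTop).comp
          (tendsto_atTop_add_const_right _ _ tendsto_id)).const_mul _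

lemma hasDerivAt_limitLogPosterior_integral {p : ℝ} (h0 : 0 ≤ p) (h1 : p ≤ 1) (a μ : ℝ) :
    HasDerivAt (limitLogPosterior a p)
      (∫ y, 2 * ((y - μ) / (1 + (y - μ) ^ 2)) ∂(trueMeasure a p)) μ := by
  have := isProbabilityMeasure_trueMeasure h0 h1 a
  refine (hasDerivAt_integral_of_dominated_loc_of_deriv_le (μ := trueMeasure a p) (x₀ := μ)
    (F := fun μ y => Real.log (cauchyPDFReal μ 1 y)) (bound := fun _ => 2)
    (F' := fun μ y => 2 * ((y - μ) / (1 + (y - μ) ^ 2))) univ_mem ?_ ?_ ?_ ?_ ?_ ?_).2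
  · exact Eventually.of_forall fun x =>
      (integrable_log_cauchyPDFReal_trueMeasure a p x).aestronglyMeasurable
  · exact integrable_log_cauchyPDFReal_trueMeasure a p μ
  · exact Measurable.aestronglyMeasurable (by fun_prop)
  · refine ae_of_all _ fun y x _ => ?_
    rw [norm_mul, Real.norm_eq_abs, Real.norm_eq_abs]
    have := abs_div_one_add_sq_le (y - x)
    simp; linarith
  · exact integrable_const _
  · refine ae_of_all _ fun y x _ => ?_
    simp only [log_cauchyPDFReal]
    have := (((((hasDerivAt_id x).const_sub y).pow 2).const_add 1).log
      (by simp; positivity)).const_sub (-Real.log Real.pi)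
    refine this.congr_deriv ?_
    simp; ring

lemma hasDerivAt_limitLogPosterior {p : ℝ} (h0 : 0 ≤ p) (h1 : p ≤ 1) (a μ : ℝ) :
    HasDerivAt (limitLogPosterior a p)
      (2 * (p * ((a - μ) / (4 + (a - μ) ^ 2)) + (1 - p) * ((-a - μ) / (4 + (-a - μ) ^ 2)))) μ := by
  have h := hasDerivAt_limitLogPosterior_integral h0 h1 a μ
  rwa [integral_const_mul, integral_trueMeasure h0 h1 fun m => integrable_score _ _,
    integral_score_cauchyMeasure, integral_score_cauchyMeasure] at h

lemma abs_limitLogPosterior_sub_le {p : ℝ} (h0 : 0 ≤ p) (h1 : p ≤ 1) (a μ γ : ℝ) :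
    |limitLogPosterior a p μ - limitLogPosterior a p γ| ≤ |μ - γ| := by
  have := isProbabilityMeasure_trueMeasure h0 h1 a
  unfold limitLogPosterior
  rw [← integral_sub (integrable_log_cauchyPDFReal_trueMeasure a p μ)
    (integrable_log_cauchyPDFReal_trueMeasure a p γ)]
  have h := norm_integral_le_of_norm_le_const (μ := trueMeasure a p) (C := |μ - γ|)
    (f := fun y => Real.log (cauchyPDFReal μ 1 y) - Real.log (cauchyPDFReal γ 1 y))
    (ae_of_all _ fun y => abs_log_cauchyPDFReal_sub_le μ γ y)
  simpa using h

/-! ### The cubic whose roots are the critical points -/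

/-- The numerator of the derivative of the limiting log posterior, up to a negative factor. -/
def scoreCubic (a p μ : ℝ) : ℝ :=
  μ ^ 3 + (2 * p - 1) * a * μ ^ 2 + (4 - a ^ 2) * μ - (2 * p - 1) * a * (a ^ 2 + 4)

lemma hasDerivAt_limitLogPosterior_scoreCubic {p : ℝ} (h0 : 0 ≤ p) (h1 : p ≤ 1) (a μ : ℝ) :
    HasDerivAt (limitLogPosterior a p)
      (-(2 / ((4 + (a - μ) ^ 2) * (4 + (a + μ) ^ 2))) * scoreCubic a p μ) μ := by
  refine (hasDerivAt_limitLogPosterior h0 h1 a μ).congr_deriv ?_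
  rw [show (-a - μ) ^ 2 = (a + μ) ^ 2 by ring]
  unfold scoreCubic
  have h1 : (4 + (a - μ) ^ 2) ≠ 0 := by positivity
  have h2 : (4 + (a + μ) ^ 2) ≠ 0 := by positivity
  field_simp
  ring

/-- In terms of `x(1 - x)` the quartic is a quadratic increasing on the nonnegative reals, and `x(1
- x)` decreases on `[1/2, 1]`. Hence its sign decides on which side of the root a point lies. -/
lemma xiPoly_eq (a x : ℝ) : xiPoly a x = a ^ 4 * (a ^ 2 + 4) * (x * (1 - x)) ^ 2
    + (12 * a ^ 4 + 44 * a ^ 2) * (x * (1 - x)) - 4 * (a ^ 2 + 1) ^ 2 := by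
  unfold xiPoly; ring

lemma xiPoly_lt {a x z : ℝ} (ha : 0 < a) (hx : 1 / 2 ≤ x) (hxz : x < z) (hz : z ≤ 1) :
    xiPoly a z < xiPoly a x := by
  have h1 : z * (1 - z) < x * (1 - x) := by nlinarith
  have h2 : 0 ≤ z * (1 - z) := mul_nonneg (by linarith) (by linarith)
  rw [xiPoly_eq, xiPoly_eq]
  have h3 : (z * (1 - z)) ^ 2 < (x * (1 - x)) ^ 2 := by gcongr
  have h4 := mul_lt_mul_of_pos_left h3 (show 0 < a ^ 4 * (a ^ 2 + 4) by positivity)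
  have h5 := mul_lt_mul_of_pos_left h1 (show 0 < 12 * a ^ 4 + 44 * a ^ 2 by positivity)
  linarith

lemma xiPoly_pos_of_lt_xi {a p : ℝ} (ha : 0 < a) (hp : 1 / 2 ≤ p) (h : p < xi a) :
    p < 1 ∧ 0 < xiPoly a p := by
  -- Were there no root, `xi a` would be the default supremum 0, contradicting `1/2 ≤ p < xi a`.
  have hne : {x | 1 / 2 ≤ x ∧ x < 1 ∧ xiPoly a x = 0}.Nonempty := by
    by_contra hc
    rw [Set.not_nonempty_iff_eq_empty] at hc
    rw [xi, hc, Real.sSup_empty] at h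
    linarith
  obtain ⟨x, ⟨hx1, hx2, hx3⟩, hpx⟩ := exists_lt_of_lt_csSup hne h
  exact ⟨hpx.trans hx2, by linarith [xiPoly_lt ha hp hpx hx2.le]⟩

lemma lt_xi_of_xiPoly_pos {a p : ℝ} (hp : 1 / 2 ≤ p) (hp1 : p < 1)
    (h : 0 < xiPoly a p) : p < xi a := by
  have h1 : xiPoly a 1 < 0 := by rw [xiPoly_eq]; nlinarith [sq_nonneg a]
  have hc : Continuous (xiPoly a) := by unfold xiPoly; fun_prop
  obtain ⟨x, hx, hx0⟩ := intermediate_value_Icc' hp1.le hc.continuousOn ⟨h1.le, h.le⟩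
  have hxp : x ≠ p := by rintro rfl; linarith
  have hx1 : x ≠ 1 := by rintro rfl; linarith
  have hlt : p < x := lt_of_le_of_ne hx.1 hxp.symm
  refine hlt.trans_le (le_csSup ⟨1, fun z hz => hz.2.1.le⟩ ⟨hp.trans hx.1, ?_, hx0⟩)
  exact lt_of_le_of_ne hx.2 hx1

/-- Split off one root `r` by the intermediate value theorem. The discriminant of the cubic is that
of the remaining quadratic times the square of the quadratic's value at `r`. Its positivity thus
gives two further real roots and shows that `r` is neither of them. -/
lemma exists_roots_scoreCubic {a p : ℝ} (ha : 2 < a) (hp : 1 / 2 ≤ p) (hp1 : p < 1)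
    (hxi : 0 < xiPoly a p) :
    ∃ g₁ g₂ g₃ : ℝ, g₁ < g₂ ∧ g₂ < g₃ ∧
      ∀ μ, scoreCubic a p μ = (μ - g₁) * (μ - g₂) * (μ - g₃) := by
  have hc : Continuous (scoreCubic a p) := by unfold scoreCubic; fun_prop
  obtain ⟨r, -, hr⟩ := intermediate_value_Icc (show (0 : ℝ) ≤ a by linarith) hc.continuousOn
    (show (0 : ℝ) ∈ Set.Icc (scoreCubic a p 0) (scoreCubic a p a) by
      have h1 : 0 ≤ (2 * p - 1) * a * (a ^ 2 + 4) := by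
        have := sub_nonneg.2 (show 1 ≤ 2 * p by linarith)
        positivity
      have h2 : 0 ≤ (1 - p) * a := mul_nonneg (by linarith) (by linarith)
      constructor <;> unfold scoreCubic
      · linarith
      · nlinarith)
  obtain ⟨b, hb⟩ : ∃ b, b = r + (2 * p - 1) * a := ⟨_, rfl⟩
  obtain ⟨c, hcc⟩ : ∃ c, c = r * b + (4 - a ^ 2) := ⟨_, rfl⟩
  have eB : (2 * p - 1) * a = b - r := by linarith
  have eC : 4 - a ^ 2 = c - r * b := by linarith
  have eD : (2 * p - 1) * a * (a ^ 2 + 4) = r * c := by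
    have : r ^ 3 + (2 * p - 1) * a * r ^ 2 + (4 - a ^ 2) * r = (2 * p - 1) * a * (a ^ 2 + 4) := by
      unfold scoreCubic at hr; linarith
    rw [← this, eB, eC]; ring
  have hfac : ∀ μ, scoreCubic a p μ = (μ - r) * (μ ^ 2 + b * μ + c) := by
    intro μ
    unfold scoreCubic
    rw [eD, eB, eC]; ring
  have hdisc : (b ^ 2 - 4 * c) * (r ^ 2 + b * r + c) ^ 2 = 64 * xiPoly a p := by
    have e1 : 64 * xiPoly a p = ((2 * p - 1) * a) ^ 2 * (4 - a ^ 2) ^ 2 - 4 * (4 - a ^ 2) ^ 3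
        + 4 * ((2 * p - 1) * a) ^ 3 * ((2 * p - 1) * a * (a ^ 2 + 4))
        - 27 * ((2 * p - 1) * a * (a ^ 2 + 4)) ^ 2
        - 18 * ((2 * p - 1) * a) * (4 - a ^ 2) * ((2 * p - 1) * a * (a ^ 2 + 4)) := by
      unfold xiPoly; ring
    rw [e1, eD, eB, eC]; ring
  have hpos : 0 < (b ^ 2 - 4 * c) * (r ^ 2 + b * r + c) ^ 2 := by rw [hdisc]; positivity
  have hq : r ^ 2 + b * r + c ≠ 0 := by intro h; simp [h] at hpos
  have hd : 0 < b ^ 2 - 4 * c := pos_of_mul_pos_left hpos (by positivity)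
  obtain ⟨w, hw, hw2⟩ : ∃ w, 0 < w ∧ w ^ 2 = b ^ 2 - 4 * c :=
    ⟨√(b ^ 2 - 4 * c), Real.sqrt_pos.2 hd, Real.sq_sqrt hd.le⟩
  obtain ⟨q₁, hq₁⟩ : ∃ q, q = (-b - w) / 2 := ⟨_, rfl⟩
  obtain ⟨q₂, hq₂⟩ : ∃ q, q = (-b + w) / 2 := ⟨_, rfl⟩
  have hquad : ∀ μ, μ ^ 2 + b * μ + c = (μ - q₁) * (μ - q₂) := by
    intro μ; rw [hq₁, hq₂]; linarith
  have h12 : q₁ < q₂ := by rw [hq₁, hq₂]; linarith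
  rw [hquad] at hq
  have hr1 : r ≠ q₁ := by rintro rfl; simp at hq
  have hr2 : r ≠ q₂ := by rintro rfl; simp at hq
  rcases lt_or_gt_of_ne hr1 with h1 | h1
  · exact ⟨r, q₁, q₂, h1, h12, fun μ => by rw [hfac, hquad]; ring⟩
  rcases lt_or_gt_of_ne hr2 with h2 | h2
  · exact ⟨q₁, r, q₂, h1, h2, fun μ => by rw [hfac, hquad]; ring⟩
  · exact ⟨q₁, q₂, r, h12, h2, fun μ => by rw [hfac, hquad]; ring⟩

/-! ### Functions with two peaks -/

/-- The derivative of `f` has the sign of a cubic with roots `g₁ < g₂ < g₃` and negative leading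
coefficient. -/
structure IsBimodal (f : ℝ → ℝ) (g₁ g₂ g₃ : ℝ) : Prop where
  lt₁ : g₁ < g₂
  lt₂ : g₂ < g₃
  deriv_eq : ∃ c : ℝ → ℝ, (∀ μ, 0 < c μ) ∧
    ∀ μ, HasDerivAt f (-c μ * ((μ - g₁) * (μ - g₂) * (μ - g₃))) μ

namespace IsBimodal

variable {f : ℝ → ℝ} {g₁ g₂ g₃ : ℝ}

lemma continuous (h : IsBimodal f g₁ g₂ g₃) : Continuous f := by
  obtain ⟨c, -, hd⟩ := h.deriv_eq
  exact continuous_iff_continuousAt.2 fun μ => (hd μ).continuousAt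

lemma strictMonoOn_Iic (h : IsBimodal f g₁ g₂ g₃) : StrictMonoOn f (Set.Iic g₁) := by
  obtain ⟨c, hc, hd⟩ := h.deriv_eq
  refine strictMonoOn_of_deriv_pos (convex_Iic _) h.continuous.continuousOn fun x hx => ?_
  rw [interior_Iic, Set.mem_Iio] at hx
  rw [(hd x).deriv, neg_mul, ← mul_neg]
  have := h.lt₁; have := h.lt₂
  refine mul_pos (hc x) ?_
  have := mul_pos (mul_pos (sub_pos.2 hx) (show 0 < g₂ - x by linarith))
    (show 0 < g₃ - x by linarith)
  linarith

lemma strictAntiOn_Icc (h : IsBimodal f g₁ g₂ g₃) : StrictAntiOn f (Set.Icc g₁ g₂) := by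
  obtain ⟨c, hc, hd⟩ := h.deriv_eq
  refine strictAntiOn_of_deriv_neg (convex_Icc _ _) h.continuous.continuousOn fun x hx => ?_
  rw [interior_Icc, Set.mem_Ioo] at hx
  rw [(hd x).deriv, neg_mul, ← mul_neg]
  have := h.lt₂
  refine mul_neg_of_pos_of_neg (hc x) ?_
  have := mul_pos (mul_pos (sub_pos.2 hx.1) (sub_pos.2 hx.2)) (show 0 < g₃ - x by linarith)
  linarith

lemma strictMonoOn_Icc (h : IsBimodal f g₁ g₂ g₃) : StrictMonoOn f (Set.Icc g₂ g₃) := by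
  obtain ⟨c, hc, hd⟩ := h.deriv_eq
  refine strictMonoOn_of_deriv_pos (convex_Icc _ _) h.continuous.continuousOn fun x hx => ?_
  rw [interior_Icc, Set.mem_Ioo] at hx
  rw [(hd x).deriv, neg_mul, ← mul_neg]
  have := h.lt₁
  refine mul_pos (hc x) ?_
  have := mul_pos (mul_pos (show 0 < x - g₁ by linarith) (sub_pos.2 hx.1)) (sub_pos.2 hx.2)
  linarith

lemma strictAntiOn_Ici (h : IsBimodal f g₁ g₂ g₃) : StrictAntiOn f (Set.Ici g₃) := by
  obtain ⟨c, hc, hd⟩ := h.deriv_eq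
  refine strictAntiOn_of_deriv_neg (convex_Ici _) h.continuous.continuousOn fun x hx => ?_
  rw [interior_Ici, Set.mem_Ioi] at hx
  rw [(hd x).deriv, neg_mul, ← mul_neg]
  have := h.lt₁; have := h.lt₂
  refine mul_neg_of_pos_of_neg (hc x) ?_
  have := mul_pos (mul_pos (show 0 < x - g₁ by linarith) (show 0 < x - g₂ by linarith))
    (sub_pos.2 hx)
  linarith

lemma lt_left (h : IsBimodal f g₁ g₂ g₃) {x : ℝ} (hx : x ≤ g₂) (hne : x ≠ g₁) : f x < f g₁ := by
  rcases lt_or_gt_of_ne hne with h1 | h1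
  · exact h.strictMonoOn_Iic (Set.mem_Iic.2 h1.le) (Set.mem_Iic.2 le_rfl) h1
  · exact h.strictAntiOn_Icc ⟨le_rfl, h.lt₁.le⟩ ⟨h1.le, hx⟩ h1

lemma lt_right (h : IsBimodal f g₁ g₂ g₃) {x : ℝ} (hx : g₂ ≤ x) (hne : x ≠ g₃) : f x < f g₃ := by
  rcases lt_or_gt_of_ne hne with h1 | h1
  · exact h.strictMonoOn_Icc ⟨hx, h1.le⟩ ⟨h.lt₂.le, le_rfl⟩ h1
  · exact h.strictAntiOn_Ici (Set.mem_Ici.2 le_rfl) (Set.mem_Ici.2 h1.le) h1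

lemma lt_middle (h : IsBimodal f g₁ g₂ g₃) {x : ℝ} (hx : x ∈ Set.Icc g₁ g₃) (hne : x ≠ g₂) :
    f g₂ < f x := by
  rcases lt_or_gt_of_ne hne with h1 | h1
  · exact h.strictAntiOn_Icc ⟨hx.1, h1.le⟩ ⟨h.lt₁.le, le_rfl⟩ h1
  · exact h.strictMonoOn_Icc ⟨le_rfl, h.lt₂.le⟩ ⟨h1.le, hx.2⟩ h1

lemma hasDerivAt_left (h : IsBimodal f g₁ g₂ g₃) : HasDerivAt f 0 g₁ := by
  obtain ⟨c, -, hd⟩ := h.deriv_eq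
  simpa using hd g₁

lemma hasDerivAt_right (h : IsBimodal f g₁ g₂ g₃) : HasDerivAt f 0 g₃ := by
  obtain ⟨c, -, hd⟩ := h.deriv_eq
  simpa using hd g₃

lemma eq_of_deriv_eq_zero (h : IsBimodal f g₁ g₂ g₃) {x : ℝ} (hx : deriv f x = 0) :
    x = g₁ ∨ x = g₂ ∨ x = g₃ := by
  obtain ⟨c, hc, hd⟩ := h.deriv_eq
  rw [(hd x).deriv] at hx
  simpa [(hc x).ne', sub_eq_zero, or_assoc] using hx

lemma isLocalMax_iff (h : IsBimodal f g₁ g₂ g₃) (x : ℝ) : IsLocalMax f x ↔ x = g₁ ∨ x = g₃ := by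
  constructor
  · intro hx
    rcases h.eq_of_deriv_eq_zero hx.deriv_eq_zero with h1 | rfl | h1
    · exact Or.inl h1
    · exfalso
      have h2 : ∀ᶠ z in 𝓝[>] x, z ∈ Set.Ioo x g₃ := Ioo_mem_nhdsGT h.lt₂
      obtain ⟨z, hz1, hz2⟩ := (h2.and (hx.filter_mono nhdsWithin_le_nhds)).exists
      have := h.lt_middle ⟨h.lt₁.le.trans hz1.1.le, hz1.2.le⟩ hz1.1.ne'
      linarith
    · exact Or.inr h1
  · rintro (rfl | rfl)
    · filter_upwards [Iio_mem_nhds h.lt₁] with z hz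
      rcases eq_or_ne z x with rfl | hne
      · rfl
      · exact (h.lt_left (le_of_lt hz) hne).le
    · filter_upwards [Ioi_mem_nhds h.lt₂] with z hz
      rcases eq_or_ne z x with rfl | hne
      · rfl
      · exact (h.lt_right (le_of_lt hz) hne).le

lemma isLocalMin_iff (h : IsBimodal f g₁ g₂ g₃) (x : ℝ) : IsLocalMin f x ↔ x = g₂ := by
  constructor
  · intro hx
    rcases h.eq_of_deriv_eq_zero hx.deriv_eq_zero with rfl | h1 | rfl
    · exfalso
      have h2 : ∀ᶠ z in 𝓝[>] x, z ∈ Set.Ioo x g₂ := Ioo_mem_nhdsGT h.lt₁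
      obtain ⟨z, hz1, hz2⟩ := (h2.and (hx.filter_mono nhdsWithin_le_nhds)).exists
      have := h.lt_left hz1.2.le hz1.1.ne'
      linarith
    · exact h1
    · exfalso
      have h2 : ∀ᶠ z in 𝓝[<] x, z ∈ Set.Ioo g₂ x := Ioo_mem_nhdsLT h.lt₂
      obtain ⟨z, hz1, hz2⟩ := (h2.and (hx.filter_mono nhdsWithin_le_nhds)).exists
      have := h.lt_right hz1.1.le hz1.2.ne
      linarith
  · rintro rfl
    filter_upwards [Ioo_mem_nhds h.lt₁ h.lt₂] with z hz
    rcases eq_or_ne z x with rfl | hne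
    · rfl
    · exact (h.lt_middle ⟨hz.1.le, hz.2.le⟩ hne).le

end IsBimodal

lemma isBimodal_limitLogPosterior {a p g₁ g₂ g₃ : ℝ} (h0 : 0 ≤ p) (h1 : p ≤ 1)
    (h12 : g₁ < g₂) (h23 : g₂ < g₃)
    (hroots : ∀ μ, scoreCubic a p μ = (μ - g₁) * (μ - g₂) * (μ - g₃)) :
    IsBimodal (limitLogPosterior a p) g₁ g₂ g₃ where
  lt₁ := h12
  lt₂ := h23
  deriv_eq := ⟨fun μ => 2 / ((4 + (a - μ) ^ 2) * (4 + (a + μ) ^ 2)), fun μ => by positivity,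
    fun μ => by rw [← hroots]; exact hasDerivAt_limitLogPosterior_scoreCubic h0 h1 a μ⟩

section Modes

variable {a p g₁ g₂ g₃ : ℝ}

lemma modes_eq (h : IsBimodal (limitLogPosterior a p) g₁ g₂ g₃) : modes a p = {g₁, g₃} := by
  ext x; simp [modes, h.isLocalMax_iff]

lemma antimodes_eq (h : IsBimodal (limitLogPosterior a p) g₁ g₂ g₃) : antimodes a p = {g₂} := by
  ext x; simp [antimodes, h.isLocalMin_iff]

lemma gammaMinus_eq (h : IsBimodal (limitLogPosterior a p) g₁ g₂ g₃) : gammaMinus a p = g₁ := by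
  rw [gammaMinus, modes_eq h, csInf_pair]
  exact inf_eq_left.2 (h.lt₁.trans h.lt₂).le

lemma gammaPlus_eq (h : IsBimodal (limitLogPosterior a p) g₁ g₂ g₃) : gammaPlus a p = g₃ := by
  rw [gammaPlus, modes_eq h, csSup_pair]
  exact sup_eq_right.2 (h.lt₁.trans h.lt₂).le

lemma antimode_eq (h : IsBimodal (limitLogPosterior a p) g₁ g₂ g₃) : antimode a p = g₂ := by
  rw [antimode, antimodes_eq h, csSup_singleton]

end Modes

/-- The heavier component carries the global mode. -/
lemma limitLogPosterior_neg_lt {a p μ : ℝ} (ha : 0 < a) (hp : 1 / 2 < p) (hp1 : p ≤ 1)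
    (hμ : 0 < μ) : limitLogPosterior a p (-μ) < limitLogPosterior a p μ := by
  have h0 : 0 ≤ p := by linarith
  have hd : ∀ x, HasDerivAt (fun x => limitLogPosterior a p x - limitLogPosterior a p (-x))
      (-(2 / ((4 + (a - x) ^ 2) * (4 + (a + x) ^ 2))) * scoreCubic a p x
        + -(2 / ((4 + (a - -x) ^ 2) * (4 + (a + -x) ^ 2))) * scoreCubic a p (-x)) x := by
    intro x
    have h2 := (hasDerivAt_limitLogPosterior_scoreCubic h0 hp1 a (-x)).comp x (hasDerivAt_neg x)
    refine ((hasDerivAt_limitLogPosterior_scoreCubic h0 hp1 a x).sub h2).congr_deriv ?_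
    ring
  -- The odd difference `h x - h (-x)` of the limiting log posterior `h` has this closed form: both
  -- sides have the same derivative and vanish at 0.
  have hD : ∀ x, HasDerivAt (fun x => (2 * p - 1) * (Real.log (4 + (a + x) ^ 2)
      - Real.log (4 + (a - x) ^ 2)))
      ((2 * p - 1) * (2 * (a + x) / (4 + (a + x) ^ 2) - -(2 * (a - x)) / (4 + (a - x) ^ 2))) x := by
    intro x
    have e1 := ((((hasDerivAt_id x).const_add a).pow 2).const_add 4).log (by simp; positivity)
    have e2 := ((((hasDerivAt_id x).const_sub a).pow 2).const_add 4).log (by simp; positivity)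
    refine ((e1.sub e2).const_mul (2 * p - 1)).congr_deriv ?_
    simp
  have hconst : ∀ x z, (fun x => (limitLogPosterior a p x - limitLogPosterior a p (-x))
      - (2 * p - 1) * (Real.log (4 + (a + x) ^ 2) - Real.log (4 + (a - x) ^ 2))) x
      = (fun x => (limitLogPosterior a p x - limitLogPosterior a p (-x))
      - (2 * p - 1) * (Real.log (4 + (a + x) ^ 2) - Real.log (4 + (a - x) ^ 2))) z := by
    refine is_const_of_deriv_eq_zero (fun x => ((hd x).sub (hD x)).differentiableAt) fun x => ?_
    refine ((hd x).sub (hD x)).deriv.trans ?_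
    unfold scoreCubic
    rw [sub_neg_eq_add, ← sub_eq_add_neg]
    have h1 : (4 + (a - x) ^ 2) ≠ 0 := by positivity
    have h2 : (4 + (a + x) ^ 2) ≠ 0 := by positivity
    field_simp
    ring
  have := hconst μ 0
  simp only [neg_zero, add_zero, sub_zero, sub_self, mul_zero] at this
  have hlog : Real.log (4 + (a - μ) ^ 2) < Real.log (4 + (a + μ) ^ 2) :=
    Real.log_lt_log (by positivity) (by nlinarith)
  nlinarith

/-- By Vieta the roots have negative sum and positive product, so `g₁` and `g₂` are negative.
Reflecting `g₁` raises the value and lands in the region right of `g₂`, where `g₃` is the maximum.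
-/
lemma limitLogPosterior_left_lt_right {a p g₁ g₂ g₃ : ℝ} (ha : 0 < a) (hp : 1 / 2 < p) (hp1 : p < 1)
    (h12 : g₁ < g₂) (h23 : g₂ < g₃)
    (hroots : ∀ μ, scoreCubic a p μ = (μ - g₁) * (μ - g₂) * (μ - g₃)) :
    limitLogPosterior a p g₁ < limitLogPosterior a p g₃ := by
  have h := isBimodal_limitLogPosterior (by linarith) hp1.le h12 h23 hroots
  -- Evaluation at 0, 1 and -1 yields the Vieta relations as linear combinations.
  have e0 := hroots 0
  have e1 := hroots 1
  have e2 := hroots (-1)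
  unfold scoreCubic at e0 e1 e2
  have hs : 0 < (2 * p - 1) * a := mul_pos (by linarith) ha
  have hsum : g₁ + g₂ + g₃ = -((2 * p - 1) * a) := by linarith
  have hprod : 0 < g₁ * (g₂ * g₃) := by
    have : g₁ * (g₂ * g₃) = (2 * p - 1) * a * (a ^ 2 + 4) := by linarith
    rw [this]; positivity
  have hg1 : g₁ < 0 := by linarith
  have h23' : g₂ * g₃ < 0 := by
    by_contra hc
    nlinarith [mul_nonneg (neg_nonneg.2 hg1.le) (not_lt.1 hc)]
  have hg2 : g₂ < 0 := by
    by_contra hc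
    nlinarith [mul_nonneg (not_lt.1 hc) ((not_lt.1 hc).trans h23.le)]
  have hn := limitLogPosterior_neg_lt ha hp hp1.le (neg_pos.2 hg1)
  rw [neg_neg] at hn
  rcases eq_or_ne (-g₁) g₃ with he | hne
  · rwa [he] at hn
  · exact hn.trans (h.lt_right (by linarith) hne)

/-! ### The law of large numbers -/

lemma ae_tendsto_average {a p : ℝ} (h0 : 0 ≤ p) (h1 : p ≤ 1) {f : ℝ → ℝ} (hf : Measurable f)
    (hint : Integrable f (trueMeasure a p)) :
    ∀ᵐ y ∂(dataLaw a p), Tendsto (fun n : ℕ => (∑ i ∈ Finset.range n, f (y i)) / n) atTop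
      (𝓝 (∫ t, f t ∂(trueMeasure a p))) := by
  have := isProbabilityMeasure_trueMeasure h0 h1 a
  have hmp : ∀ i : ℕ, MeasurePreserving (fun y : ℕ → ℝ => y i) (dataLaw a p) (trueMeasure a p) :=
    fun i => measurePreserving_eval_infinitePi (fun _ : ℕ => trueMeasure a p) i
  have h := strong_law_ae_real (μ := dataLaw a p) (fun i (y : ℕ → ℝ) => f (y i))
    ((hmp 0).integrable_comp_of_integrable hint)
    (fun i j hij => (iIndepFun_infinitePi (P := fun _ : ℕ => trueMeasure a p)
      (X := fun _ => f) (fun _ => hf)).indepFun hij)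
    (fun i => ⟨(hf.comp (measurable_pi_apply i)).aemeasurable,
      (hf.comp (measurable_pi_apply 0)).aemeasurable, by
        have e : ∀ j : ℕ, Measure.map (fun y : ℕ → ℝ => f (y j)) (dataLaw a p)
            = Measure.map f (trueMeasure a p) := fun j => by
          rw [← (hmp j).map_eq, Measure.map_map hf (hmp j).measurable]; rfl
        rw [e, e]⟩)
  have e : ∫ y, f (y 0) ∂(dataLaw a p) = ∫ t, f t ∂(trueMeasure a p) := by
    rw [← (hmp 0).map_eq, integral_map (hmp 0).measurable.aemeasurable
      hf.aestronglyMeasurable]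
  rwa [e] at h

/-- `1 / n` times the log likelihood. -/
noncomputable def avgLogLik (y : ℕ → ℝ) (n : ℕ) (μ : ℝ) : ℝ :=
  (∑ i ∈ Finset.range n, Real.log (cauchyPDFReal μ 1 (y i))) / n

lemma likelihood_eq_exp_sum (y : ℕ → ℝ) (n : ℕ) (μ : ℝ) : likelihood y n μ
    = Real.exp (∑ i ∈ Finset.range n, Real.log (cauchyPDFReal μ 1 (y i))) := by
  rw [Real.exp_sum, likelihood]
  exact Finset.prod_congr rfl fun i _ => (Real.exp_log (cauchyPDFReal_one_pos _ _)).symm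

lemma likelihood_eq_exp (y : ℕ → ℝ) (n : ℕ) (μ : ℝ) :
    likelihood y n μ = Real.exp (n * avgLogLik y n μ) := by
  rw [likelihood_eq_exp_sum, avgLogLik]
  rcases n.eq_zero_or_pos with rfl | hn
  · simp
  · rw [mul_div_cancel₀ _ (by positivity)]

lemma measurable_likelihood (y : ℕ → ℝ) (n : ℕ) : Measurable (likelihood y n) := by
  unfold likelihood
  exact Finset.measurable_prod _ fun i _ => measurable_cauchyPDFReal_left _

lemma likelihood_pos (y : ℕ → ℝ) (n : ℕ) (μ : ℝ) : 0 < likelihood y n μ := by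
  rw [likelihood_eq_exp]; positivity

lemma abs_avgLogLik_sub_le (y : ℕ → ℝ) (n : ℕ) (μ γ : ℝ) :
    |avgLogLik y n μ - avgLogLik y n γ| ≤ |μ - γ| := by
  rcases n.eq_zero_or_pos with rfl | hn
  · simp [avgLogLik]
  have hn' : (0 : ℝ) < n := by positivity
  unfold avgLogLik
  rw [← sub_div, ← Finset.sum_sub_distrib, abs_div, abs_of_pos hn', div_le_iff₀ hn']
  refine (Finset.abs_sum_le_sum_abs _ _).trans ?_
  refine (Finset.sum_le_sum fun i _ => abs_log_cauchyPDFReal_sub_le μ γ (y i)).trans ?_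
  simp [mul_comm]

lemma avgLogLik_le (y : ℕ → ℝ) {n : ℕ} (hn : 0 < n) (μ : ℝ) :
    avgLogLik y n μ ≤ Real.log 2 - 2 * Real.log Real.pi - avgLogLik y n 0
      - Real.log (1 + μ ^ 2) := by
  have hn' : (0 : ℝ) < n := by positivity
  unfold avgLogLik
  rw [div_le_iff₀ hn']
  refine (Finset.sum_le_sum fun i _ => log_cauchyPDFReal_le μ (y i)).trans_eq ?_
  simp only [Finset.sum_sub_distrib, Finset.sum_const, Finset.card_range, nsmul_eq_mul]
  field_simp

/-- The average log likelihood converges at every rational location. -/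
def IsTypical (a p : ℝ) (y : ℕ → ℝ) : Prop :=
  ∀ q : ℚ, Tendsto (fun n => avgLogLik y n q) atTop (𝓝 (limitLogPosterior a p q))

lemma ae_isTypical {p : ℝ} (h0 : 0 ≤ p) (h1 : p ≤ 1) (a : ℝ) :
    ∀ᵐ y ∂(dataLaw a p), IsTypical a p y :=
  ae_all_iff.2 fun q => ae_tendsto_average h0 h1
    (Real.measurable_log.comp (measurable_cauchyPDFReal _ _))
    (integrable_log_cauchyPDFReal_trueMeasure a p q)

/-- Pointwise convergence on a finite rational grid, plus the common Lipschitz constant 1 of the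
averages and of their limit. -/
lemma IsTypical.eventually_abs_sub_le {a p : ℝ} (h0 : 0 ≤ p) (h1 : p ≤ 1) {y : ℕ → ℝ}
    (hy : IsTypical a p y) (R : ℝ) {ε : ℝ} (hε : 0 < ε) :
    ∀ᶠ n in atTop, ∀ μ, |μ| ≤ R → |avgLogLik y n μ - limitLogPosterior a p μ| ≤ ε := by
  -- The mesh is rational so that the multiples of `η` are; three errors of size `η` add up: two
  -- moves to the grid and the convergence there.
  obtain ⟨η, hη0, hη⟩ : ∃ η : ℚ, (0 : ℝ) < η ∧ (η : ℝ) < ε / 3 := exists_rat_btwn (by positivity)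
  obtain ⟨K, hK⟩ := exists_nat_gt (R / η + 1)
  have hfin : ∀ᶠ n in atTop, ∀ k ∈ Finset.Icc (-(K : ℤ)) K,
      |avgLogLik y n ((k * η : ℚ) : ℝ) - limitLogPosterior a p ((k * η : ℚ) : ℝ)| < η := by
    rw [Filter.eventually_all_finset]
    intro k _
    have := (hy (k * η)).eventually (Metric.ball_mem_nhds _ hη0)
    simpa [Real.dist_eq] using this
  filter_upwards [hfin] with n hn μ hμ
  have hr : |μ / η - round (μ / η)| ≤ 1 / 2 := abs_sub_round _
  have hμη : |μ / η| ≤ R / η := by rw [abs_div, abs_of_pos hη0]; gcongr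
  have hk : round (μ / η) ∈ Finset.Icc (-(K : ℤ)) K := by
    rw [Finset.mem_Icc]
    rw [abs_le] at hr hμη
    constructor
    · have : (-(K : ℝ)) ≤ round (μ / η) := by linarith
      exact_mod_cast this
    · have : (round (μ / η) : ℝ) ≤ K := by linarith
      exact_mod_cast this
  have h2 := hn _ hk
  push_cast at h2
  set z : ℝ := round (μ / η) * η with hz
  have hμz : |μ - z| ≤ η := by
    have e : μ - z = (μ / η - round (μ / η)) * η := by rw [hz]; field_simp
    rw [e, abs_mul, abs_of_pos hη0]
    nlinarith
  have h3 := (abs_avgLogLik_sub_le y n μ z).trans hμz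
  have h4 := (abs_limitLogPosterior_sub_le h0 h1 a μ z).trans hμz
  rw [abs_le] at *
  rw [abs_lt] at h2
  constructor <;> linarith

/-! ### Concentration of the posterior -/

/-- On a compact set, the strict maximum leaves a gap; far out, the logarithmic tail bound takes
over. The term `δ * log (1 + μ²)` is kept in reserve: multiplied by `n` it beats any power of `1 +
μ²`. -/
lemma IsTypical.exists_eventually_avgLogLik_le {a p : ℝ} (h0 : 0 ≤ p) (h1 : p ≤ 1) {y : ℕ → ℝ}
    (hy : IsTypical a p y) {T : Set ℝ} (hT : IsClosed T) {γ : ℝ}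
    (hmax : ∀ μ ∈ T, μ ≠ γ → limitLogPosterior a p μ < limitLogPosterior a p γ)
    {ε : ℝ} (hε : 0 < ε) :
    ∃ δ : ℝ, 0 < δ ∧ ∀ᶠ n in atTop, ∀ μ ∈ T, ε ≤ |μ - γ| →
      avgLogLik y n μ ≤ limitLogPosterior a p γ - 2 * δ - δ * Real.log (1 + μ ^ 2) := by
  set h := limitLogPosterior a p with hh
  have hcont : Continuous h := by
    refine continuous_iff_continuousAt.2 fun μ =>
      (hasDerivAt_limitLogPosterior h0 h1 a μ).continuousAt
  set C : ℝ := Real.log 2 - 2 * Real.log Real.pi - h 0 + 1 with hC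
  have hCev : ∀ᶠ n in atTop, Real.log 2 - 2 * Real.log Real.pi - avgLogLik y n 0 ≤ C := by
    have := (hy 0).eventually (lt_mem_nhds (show h ((0 : ℚ) : ℝ) - 1 < h ((0 : ℚ) : ℝ) by linarith))
    simp only [Rat.cast_zero] at this
    filter_upwards [this] with n hn
    rw [hC]; linarith
  -- Beyond `R`, half of the logarithm already pays for the gap; as `δ ≤ 1/2`, the other half
  -- supplies the reserve.
  obtain ⟨R, hR⟩ : ∃ R : ℝ, ∀ μ : ℝ, R < |μ| →
      2 * (C - h γ + 1) ≤ Real.log (1 + μ ^ 2) := by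
    refine ⟨1 + Real.exp (2 * (C - h γ + 1)), fun μ hμ => ?_⟩
    rw [Real.le_log_iff_exp_le (by positivity), ← sq_abs]
    have := Real.exp_pos (2 * (C - h γ + 1))
    nlinarith
  obtain ⟨δ₀, hδ₀, hcomp⟩ : ∃ δ₀ : ℝ, 0 < δ₀ ∧ ∀ μ ∈ T, |μ| ≤ R → ε ≤ |μ - γ| →
      h μ ≤ h γ - 4 * δ₀ := by
    have hQc : IsCompact (T ∩ Metric.closedBall 0 R ∩ {μ | ε ≤ |μ - γ|}) := by
      refine ((isCompact_closedBall (0 : ℝ) R).inter_left hT).inter_right ?_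
      exact isClosed_le continuous_const (by fun_prop)
    rcases (T ∩ Metric.closedBall 0 R ∩ {μ | ε ≤ |μ - γ|}).eq_empty_or_nonempty with he | hne
    · refine ⟨1, one_pos, fun μ h1 h2 h3 => ?_⟩
      have : μ ∈ T ∩ Metric.closedBall 0 R ∩ {μ | ε ≤ |μ - γ|} := ⟨⟨h1, by simpa using h2⟩, h3⟩
      rw [he] at this
      exact this.elim
    · obtain ⟨x, ⟨⟨hx1, -⟩, hx3⟩, hx⟩ := hQc.exists_isMaxOn hne hcont.continuousOn
      have hxγ : x ≠ γ := by
        rintro rfl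
        simp only [Set.mem_ofPred_eq, sub_self, abs_zero] at hx3
        linarith
      have hlt := hmax x hx1 hxγ
      refine ⟨(h γ - h x) / 4, by linarith, fun μ h1 h2 h3 => ?_⟩
      have : h μ ≤ h x := hx ⟨⟨h1, by simpa using h2⟩, h3⟩
      linarith
  have hden : 0 < 1 + Real.log (1 + R ^ 2) := by
    have : 0 ≤ Real.log (1 + R ^ 2) := Real.log_nonneg (by nlinarith [sq_nonneg R])
    linarith
  refine ⟨min (1 / 2) (min δ₀ (δ₀ / (1 + Real.log (1 + R ^ 2)))), by positivity, ?_⟩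
  set δ := min (1 / 2) (min δ₀ (δ₀ / (1 + Real.log (1 + R ^ 2)))) with hδ
  have hδpos : 0 < δ := by positivity
  have hδ1 : δ ≤ 1 / 2 := min_le_left _ _
  have hδ2 : δ ≤ δ₀ := (min_le_right _ _).trans (min_le_left _ _)
  have hδ3 : δ * (1 + Real.log (1 + R ^ 2)) ≤ δ₀ := by
    rw [← le_div_iff₀ hden]
    exact (min_le_right _ _).trans (min_le_right _ _)
  filter_upwards [hCev, hy.eventually_abs_sub_le h0 h1 R hδ₀, eventually_gt_atTop 0]
    with n hn1 hn2 hn3 μ hμT hμε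
  have hlog0 : 0 ≤ Real.log (1 + μ ^ 2) := Real.log_nonneg (by nlinarith [sq_nonneg μ])
  rcases le_or_gt |μ| R with hμR | hμR
  · have b1 := hcomp μ hμT hμR hμε
    have b2 := (abs_le.1 (hn2 μ hμR)).2
    have b3 : Real.log (1 + μ ^ 2) ≤ Real.log (1 + R ^ 2) := by
      apply Real.log_le_log (by positivity)
      have := sq_le_sq' (by linarith [abs_nonneg μ] : -R ≤ |μ|) hμR
      rw [sq_abs] at this
      linarith
    have b4 := mul_le_mul_of_nonneg_left b3 hδpos.le
    nlinarith
  · have b1 := avgLogLik_le y hn3 μ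
    have b2 := hR μ hμR
    nlinarith

/-- `κ` is a probability measure that is concentrated near `γ`. -/
structure IsNear (γ r : ℝ) (κ : Measure ℝ) : Prop where
  isProbabilityMeasure : IsProbabilityMeasure κ
  lintegral_le : ∫⁻ μ, ENNReal.ofReal (shiftBound γ μ) ∂κ ≤ ENNReal.ofReal r

lemma isProbabilityMeasure_normalize {κ : Measure ℝ} (h0 : κ Set.univ ≠ 0)
    (h1 : κ Set.univ ≠ ⊤) : IsProbabilityMeasure (normalize κ) :=
  ⟨by simp [normalize, ENNReal.inv_mul_cancel h0 h1]⟩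

lemma normalize_smul {κ : Measure ℝ} {c : ENNReal} (h0 : c ≠ 0) (h1 : c ≠ ⊤) :
    normalize (c • κ) = normalize κ := by
  unfold normalize
  rw [smul_smul, Measure.smul_apply, smul_eq_mul, ENNReal.mul_inv (Or.inl h0) (Or.inl h1),
    mul_assoc, mul_comm _ c, ← mul_assoc, ENNReal.inv_mul_cancel h0 h1, one_mul]

/-- The product of the prior and the likelihood. -/
noncomputable def unnormalized (ν : Measure ℝ) (y : ℕ → ℝ) (n : ℕ) : Measure ℝ :=
  ν.withDensity fun μ => ENNReal.ofReal (likelihood y n μ)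

lemma exp_neg_mul_log_le (x : ℝ) {t : ℝ} {m : ℕ} (h : m ≤ t) :
    Real.exp (-(t * Real.log (1 + x ^ 2))) ≤ ((1 + x ^ 2) ^ m)⁻¹ := by
  have hlog0 : 0 ≤ Real.log (1 + x ^ 2) := Real.log_nonneg (by nlinarith [sq_nonneg x])
  have e : ((1 + x ^ 2) ^ m)⁻¹ = Real.exp (-(m * Real.log (1 + x ^ 2))) := by
    rw [Real.exp_neg, mul_comm, Real.exp_mul, Real.exp_log (by positivity), Real.rpow_natCast]
  rw [e]
  gcongr

/-- Every observation contributes one factor `(1 + μ²)⁻¹`, so `m` observations already make the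
posterior proper. -/
lemma unnormalized_univ_ne_top {ν : Measure ℝ} {m : ℕ}
    (hν : Integrable (fun μ : ℝ => ((1 + μ ^ 2) ^ m)⁻¹) ν) (y : ℕ → ℝ) {n : ℕ} (hn : m ≤ n) :
    unnormalized ν y n Set.univ ≠ ⊤ := by
  rw [unnormalized, withDensity_apply _ MeasurableSet.univ, Measure.restrict_univ]
  set K := Real.exp (∑ i ∈ Finset.range n,
    (Real.log 2 - 2 * Real.log Real.pi - Real.log (cauchyPDFReal 0 1 (y i)))) with hK
  refine ne_top_of_le_ne_top (hν.const_mul K).lintegral_lt_top.ne (lintegral_mono fun μ => ?_)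
  apply ENNReal.ofReal_le_ofReal
  rw [likelihood_eq_exp_sum]
  calc _ ≤ Real.exp (∑ i ∈ Finset.range n, (Real.log 2 - 2 * Real.log Real.pi
        - Real.log (cauchyPDFReal 0 1 (y i)) - Real.log (1 + μ ^ 2))) := by
        gcongr; exact log_cauchyPDFReal_le _ _
    _ = K * Real.exp (-(n * Real.log (1 + μ ^ 2))) := by
        rw [Finset.sum_sub_distrib, hK, ← Real.exp_add]; simp [sub_eq_add_neg]
    _ ≤ _ := by gcongr; exact exp_neg_mul_log_le μ (by exact_mod_cast hn)

lemma shiftBound_le (γ μ : ℝ) : shiftBound γ μ ≤ (4 + 4 * γ ^ 2) * (1 + μ ^ 2) := by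
  unfold shiftBound
  have : |μ - γ| ≤ 1 + (μ - γ) ^ 2 := by rw [← sq_abs]; nlinarith [sq_nonneg (|μ - γ| - 1)]
  nlinarith [sq_nonneg (μ + γ), mul_nonneg (sq_nonneg γ) (sq_nonneg μ)]

/-- A Laplace type estimate. The total mass is at least `exp (n (h γ - δ))` times the prior mass of
a neighbourhood of `γ`, positive by full support. The integral of `shiftBound` away from `γ` is at
most a constant times `exp (n (h γ - 2δ))`. The moving regions `S n` matter only through the fixed
sets `V` and `T` around them. -/
theorem IsTypical.eventually_isNear {a p : ℝ} (h0 : 0 ≤ p) (h1 : p ≤ 1) {y : ℕ → ℝ}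
    (hy : IsTypical a p y) {ν : Measure ℝ} (hν : IsPrior ν) {T : Set ℝ} (hT : IsClosed T) {γ : ℝ}
    (hmax : ∀ μ ∈ T, μ ≠ γ → limitLogPosterior a p μ < limitLogPosterior a p γ)
    {S : ℕ → Set ℝ} (hS : ∀ n, MeasurableSet (S n)) (hST : ∀ᶠ n in atTop, S n ⊆ T)
    {V : Set ℝ} (hV : V ∈ 𝓝 γ) (hVS : ∀ᶠ n in atTop, V ⊆ S n) {r : ℝ} (hr : 0 < r) :
    ∀ᶠ n in atTop, IsNear γ r (normalize ((unnormalized ν y n).restrict (S n))) := by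
  obtain ⟨hopen, m, hm⟩ := hν
  set h := limitLogPosterior a p with hh
  obtain ⟨ε, hε, hεr⟩ : ∃ ε : ℝ, 0 < ε ∧ ε + ε ^ 2 ≤ r / 2 := by
    refine ⟨min 1 (r / 4), by positivity, ?_⟩
    have a1 := min_le_left 1 (r / 4)
    have a2 := min_le_right 1 (r / 4)
    have a3 : 0 < min 1 (r / 4) := by positivity
    nlinarith
  obtain ⟨δ, hδ, hup⟩ := hy.exists_eventually_avgLogLik_le h0 h1 hT hmax hε
  set W : Set ℝ := Metric.ball γ (min 1 (δ / 2)) ∩ interior V with hW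
  have hWo : IsOpen W := Metric.isOpen_ball.inter isOpen_interior
  have hWγ : γ ∈ W := ⟨Metric.mem_ball_self (by positivity), mem_interior_iff_mem_nhds.2 hV⟩
  have hνW : 0 < ν W := hWo.measure_pos ν ⟨γ, hWγ⟩
  set D : ℝ := 4 + 4 * γ ^ 2 with hD
  set K : ENNReal := ∫⁻ μ, ENNReal.ofReal (D * ((1 + μ ^ 2) ^ m)⁻¹) ∂ν with hK
  have hKtop : K ≠ ⊤ := (hm.const_mul D).lintegral_lt_top.ne
  have hsmall : ∀ᶠ n : ℕ in atTop, ENNReal.ofReal (Real.exp (-(n * δ))) * K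
      ≤ ENNReal.ofReal (r / 2) * ν W := by
    have t1 : Tendsto (fun n : ℕ => Real.exp (-(n * δ))) atTop (𝓝 0) :=
      Real.tendsto_exp_neg_atTop_nhds_zero.comp
        (tendsto_natCast_atTop_atTop.atTop_mul_const hδ)
    have t2 := ENNReal.Tendsto.mul_const (ENNReal.tendsto_ofReal t1) (Or.inr hKtop)
    rw [ENNReal.ofReal_zero, zero_mul] at t2
    have : 0 < ENNReal.ofReal (r / 2) * ν W :=
      ENNReal.mul_pos (by simpa using hr) hνW.ne'
    filter_upwards [t2.eventually (gt_mem_nhds this)] with n hn using hn.le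
  -- One power beyond `m` absorbs the quadratic growth of `shiftBound`.
  have hbig : ∀ᶠ n : ℕ in atTop, (m : ℝ) + 1 ≤ n * δ :=
    (tendsto_natCast_atTop_atTop.atTop_mul_const hδ).eventually_ge_atTop _
  filter_upwards [hup, hST, hVS, hsmall, hbig, hy.eventually_abs_sub_le h0 h1 (|γ| + 1)
    (half_pos hδ), eventually_ge_atTop m] with n hup hST hVS hsmall hbig hunif hnm
  set L : ℝ → ENNReal := fun μ => ENNReal.ofReal (likelihood y n μ) with hL
  have hLm : Measurable L := (measurable_likelihood y n).ennreal_ofReal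
  set κ := (unnormalized ν y n).restrict (S n) with hκ
  have hκ' : κ = (ν.restrict (S n)).withDensity L := restrict_withDensity (hS n) _
  have hκtop : κ Set.univ ≠ ⊤ :=
    ne_top_of_le_ne_top (unnormalized_univ_ne_top hm y hnm) (Measure.restrict_le_self _)
  have hκuniv : κ Set.univ = ∫⁻ μ in S n, L μ ∂ν := by
    rw [hκ', withDensity_apply _ MeasurableSet.univ, Measure.restrict_univ]
  have hlow : ENNReal.ofReal (Real.exp (n * (h γ - δ))) * ν W ≤ κ Set.univ := by
    rw [hκuniv, ← setLIntegral_const]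
    refine (setLIntegral_mono' hWo.measurableSet fun μ hμ => ?_).trans
      (lintegral_mono_set ((Set.inter_subset_right.trans interior_subset).trans hVS))
    apply ENNReal.ofReal_le_ofReal
    rw [likelihood_eq_exp]
    have hμγ : |μ - γ| < min 1 (δ / 2) := hμ.1
    have c1 : |μ - γ| < 1 := hμγ.trans_le (min_le_left _ _)
    have c2 : |μ - γ| < δ / 2 := hμγ.trans_le (min_le_right _ _)
    have c3 := (abs_le.1 (hunif μ (by
      have := abs_add_le (μ - γ) γ
      rw [sub_add_cancel] at this
      linarith))).1
    have c4 := (abs_le.1 (abs_limitLogPosterior_sub_le h0 h1 a μ γ)).1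
    gcongr
    linarith
  have hκ0 : κ Set.univ ≠ 0 := by
    refine (lt_of_lt_of_le ?_ hlow).ne'
    exact ENNReal.mul_pos (by simpa using Real.exp_pos _) hνW.ne'
  refine ⟨isProbabilityMeasure_normalize hκ0 hκtop, ?_⟩
  have hΦm : Measurable fun μ => ENNReal.ofReal (shiftBound γ μ) :=
    (measurable_shiftBound γ).ennreal_ofReal
  have hmain : ∫⁻ μ, ENNReal.ofReal (shiftBound γ μ) ∂κ ≤ ENNReal.ofReal r * κ Set.univ := by
    have s1 : ∫⁻ μ, ENNReal.ofReal (shiftBound γ μ) ∂κ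
        ≤ ∫⁻ μ in S n, (ENNReal.ofReal (r / 2) * L μ + ENNReal.ofReal (Real.exp (n * (h γ - 2 * δ)))
          * ENNReal.ofReal (D * ((1 + μ ^ 2) ^ m)⁻¹)) ∂ν := by
      rw [hκ', lintegral_withDensity_eq_lintegral_mul _ hLm hΦm]
      refine setLIntegral_mono' (hS n) fun μ hμ => ?_
      simp only [Pi.mul_apply]
      rcases lt_or_ge |μ - γ| ε with hlt | hge
      · rw [mul_comm]
        refine le_add_right ?_
        gcongr
        refine le_trans ?_ hεr
        unfold shiftBound
        rw [← sq_abs (μ - γ)]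
        gcongr
      · refine le_add_left ?_
        rw [hL, ← ENNReal.ofReal_mul (likelihood_pos y n μ).le,
          ← ENNReal.ofReal_mul (Real.exp_pos _).le]
        apply ENNReal.ofReal_le_ofReal
        rw [likelihood_eq_exp]
        have u1 := hup μ (hST hμ) hge
        have u2 : (n : ℝ) * avgLogLik y n μ
            ≤ n * (h γ - 2 * δ) + -(n * δ * Real.log (1 + μ ^ 2)) := by
          have := mul_le_mul_of_nonneg_left u1 (Nat.cast_nonneg n)
          linarith
        have u3 : Real.exp (-(n * δ * Real.log (1 + μ ^ 2))) * (1 + μ ^ 2)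
            ≤ ((1 + μ ^ 2) ^ m)⁻¹ := by
          have := exp_neg_mul_log_le μ (t := n * δ) (m := m + 1) (by push_cast; linarith)
          calc _ ≤ ((1 + μ ^ 2) ^ (m + 1))⁻¹ * (1 + μ ^ 2) := by gcongr
            _ = _ := by rw [pow_succ]; field_simp
        calc Real.exp (n * avgLogLik y n μ) * shiftBound γ μ
            ≤ Real.exp (n * (h γ - 2 * δ) + -(n * δ * Real.log (1 + μ ^ 2)))
              * (D * (1 + μ ^ 2)) := by
              exact mul_le_mul (Real.exp_le_exp.2 u2) (shiftBound_le γ μ)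
                (shiftBound_nonneg γ μ) (Real.exp_pos _).le
          _ = Real.exp (n * (h γ - 2 * δ)) * (D * (Real.exp (-(n * δ * Real.log (1 + μ ^ 2)))
              * (1 + μ ^ 2))) := by rw [Real.exp_add]; ring
          _ ≤ _ := by gcongr
    refine s1.trans ?_
    rw [lintegral_add_left (by fun_prop), lintegral_const_mul _ hLm,
      lintegral_const_mul _ (by fun_prop), ← hκuniv]
    have s2 : ENNReal.ofReal (Real.exp (n * (h γ - 2 * δ)))
        * ∫⁻ μ in S n, ENNReal.ofReal (D * ((1 + μ ^ 2) ^ m)⁻¹) ∂ν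
        ≤ ENNReal.ofReal (r / 2) * κ Set.univ := by
      calc _ ≤ ENNReal.ofReal (Real.exp (n * (h γ - 2 * δ))) * K := by
            gcongr; exact setLIntegral_le_lintegral _ _
        _ = ENNReal.ofReal (Real.exp (n * (h γ - δ)))
            * (ENNReal.ofReal (Real.exp (-(n * δ))) * K) := by
            rw [← mul_assoc, ← ENNReal.ofReal_mul (Real.exp_pos _).le, ← Real.exp_add]
            congr 3; ring
        _ ≤ ENNReal.ofReal (Real.exp (n * (h γ - δ))) * (ENNReal.ofReal (r / 2) * ν W) := by
            gcongr
        _ = ENNReal.ofReal (r / 2) * (ENNReal.ofReal (Real.exp (n * (h γ - δ))) * ν W) := by ring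
        _ ≤ _ := by gcongr
    calc _ ≤ ENNReal.ofReal (r / 2) * κ Set.univ + ENNReal.ofReal (r / 2) * κ Set.univ := by
          gcongr
      _ = _ := by
          rw [← add_mul, ← ENNReal.ofReal_add (by positivity) (by positivity), add_halves]
  rw [normalize, lintegral_smul_measure, smul_eq_mul]
  calc _ ≤ (κ Set.univ)⁻¹ * (ENNReal.ofReal r * κ Set.univ) := by gcongr
    _ = _ := by
      rw [mul_comm, mul_assoc, ENNReal.mul_inv_cancel hκ0 hκtop, mul_one]

lemma unnormalized_univ_ne_zero {ν : Measure ℝ} (hν : ν.IsOpenPosMeasure) (y : ℕ → ℝ) (n : ℕ) :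
    unnormalized ν y n Set.univ ≠ 0 := by
  have hne : ν Set.univ ≠ 0 := (isOpen_univ.measure_pos ν Set.univ_nonempty).ne'
  rw [unnormalized, withDensity_apply _ MeasurableSet.univ, Measure.restrict_univ]
  intro h
  rw [lintegral_eq_zero_iff (measurable_likelihood y n).ennreal_ofReal] at h
  apply hne
  rw [← nonpos_iff_eq_zero, ← ae_iff.1 h]
  refine measure_mono fun μ _ => ?_
  simpa using likelihood_pos y n μ

lemma exactPosterior_eq (ν : Measure ℝ) (y : ℕ → ℝ) (n : ℕ) :
    exactPosterior ν y n = normalize ((unnormalized ν y n).restrict Set.univ) := by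
  rw [Measure.restrict_univ]; rfl

/-- The normalizing constant of the exact posterior cancels once it is finite and nonzero, that is,
from `n = m` on. -/
lemma eventually_clusters_eq {ν : Measure ℝ} (hν : IsPrior ν) (y : ℕ → ℝ) (c : ℕ → ℝ) :
    ∀ᶠ n in atTop, clusters ν y n (c n)
      = ![normalize ((unnormalized ν y n).restrict (Set.Iio (c n))),
        normalize ((unnormalized ν y n).restrict (Set.Ici (c n)))] := by
  obtain ⟨hopen, m, hm⟩ := hν
  filter_upwards [eventually_ge_atTop m] with n hn
  have e : ∀ s, normalize ((exactPosterior ν y n).restrict s)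
      = normalize ((unnormalized ν y n).restrict s) := by
    intro s
    change normalize ((((unnormalized ν y n) Set.univ)⁻¹ • (unnormalized ν y n)).restrict s) = _
    rw [Measure.restrict_smul, normalize_smul
      (ENNReal.inv_ne_zero.2 (unnormalized_univ_ne_top hm y hn))
      (ENNReal.inv_ne_top.2 (unnormalized_univ_ne_zero hopen y n))]
  rw [clusters, e, e]

/-- The two clusters concentrate at the two modes. -/
theorem IsTypical.eventually_isNear_clusters {a p g₁ g₂ g₃ : ℝ} (h0 : 0 ≤ p) (h1 : p ≤ 1)
    (hb : IsBimodal (limitLogPosterior a p) g₁ g₂ g₃) {y : ℕ → ℝ}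
    (hy : IsTypical a p y) {ν : Measure ℝ} (hν : IsPrior ν) {c : ℕ → ℝ}
    (hc : Tendsto c atTop (𝓝 g₂)) {r : ℝ} (hr : 0 < r) :
    ∀ᶠ n in atTop, ∀ k, IsNear (![g₁, g₃] k) r (clusters ν y n (c n) k) := by
  have hcont := hb.continuous
  have hlt₁ : limitLogPosterior a p g₂ < limitLogPosterior a p g₁ := hb.lt_left le_rfl hb.lt₁.ne'
  have hlt₃ : limitLogPosterior a p g₂ < limitLogPosterior a p g₃ := hb.lt_right le_rfl hb.lt₂.ne
  -- The cut may lie on the wrong side of `g₂`. The left cluster is therefore enclosed in a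
  -- half-line reaching slightly past the antimode, on which `g₁` is still the strict maximum; `v`
  -- does the same on the right.
  obtain ⟨u, ⟨hu2, hu3⟩, huh⟩ : ∃ u ∈ Set.Ioo g₂ g₃,
      limitLogPosterior a p u < limitLogPosterior a p g₁ := by
    have e1 : ∀ᶠ z in 𝓝[>] g₂, z ∈ Set.Ioo g₂ g₃ := Ioo_mem_nhdsGT hb.lt₂
    have e2 := (hcont.tendsto g₂).eventually (gt_mem_nhds hlt₁)
    obtain ⟨z, hz1, hz2⟩ := (e1.and (e2.filter_mono nhdsWithin_le_nhds)).exists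
    exact ⟨z, hz1, hz2⟩
  obtain ⟨v, ⟨hv1, hv2⟩, hvh⟩ : ∃ v ∈ Set.Ioo g₁ g₂,
      limitLogPosterior a p v < limitLogPosterior a p g₃ := by
    have e1 : ∀ᶠ z in 𝓝[<] g₂, z ∈ Set.Ioo g₁ g₂ := Ioo_mem_nhdsLT hb.lt₁
    have e2 := (hcont.tendsto g₂).eventually (gt_mem_nhds hlt₃)
    obtain ⟨z, hz1, hz2⟩ := (e1.and (e2.filter_mono nhdsWithin_le_nhds)).exists
    exact ⟨z, hz1, hz2⟩
  have hcu : ∀ᶠ n in atTop, c n < u := hc.eventually (gt_mem_nhds hu2)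
  have hcv : ∀ᶠ n in atTop, v < c n := hc.eventually (lt_mem_nhds hv2)
  have n1 := hy.eventually_isNear h0 h1 hν (isClosed_Iic (a := u)) (γ := g₁) (fun μ hμ hne => by
      rcases le_or_gt μ g₂ with h | h
      · exact hb.lt_left h hne
      · exact lt_of_le_of_lt (hb.strictMonoOn_Icc.monotoneOn ⟨h.le, hμ.trans hu3.le⟩
          ⟨hu2.le, hu3.le⟩ hμ) huh)
    (S := fun n => Set.Iio (c n)) (fun n => measurableSet_Iio)
    (hcu.mono fun n hn x hx => (lt_trans hx hn).le) (Iio_mem_nhds hv1)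
    (hcv.mono fun n hn x hx => lt_trans hx hn) hr
  have n2 := hy.eventually_isNear h0 h1 hν (isClosed_Ici (a := v)) (γ := g₃) (fun μ hμ hne => by
      rcases le_or_gt g₂ μ with h | h
      · exact hb.lt_right h hne
      · exact lt_of_le_of_lt (hb.strictAntiOn_Icc.antitoneOn ⟨hv1.le, hv2.le⟩
          ⟨hv1.le.trans hμ, h.le⟩ hμ) hvh)
    (S := fun n => Set.Ici (c n)) (fun n => measurableSet_Ici)
    (hcv.mono fun n hn x hx => hn.le.trans hx) (Ioi_mem_nhds hu3)
    (hcu.mono fun n hn x hx => (lt_trans hn hx).le) hr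
  filter_upwards [n1, n2, eventually_clusters_eq hν y c] with n h1 h2 h3 k
  rw [h3]
  fin_cases k
  · exact h1
  · exact h2

/-- The exact posterior concentrates at the global mode. -/
theorem IsTypical.eventually_isNear_exactPosterior {a p γ : ℝ} (h0 : 0 ≤ p) (h1 : p ≤ 1)
    (hmax : ∀ μ, μ ≠ γ → limitLogPosterior a p μ < limitLogPosterior a p γ) {y : ℕ → ℝ}
    (hy : IsTypical a p y) {ν : Measure ℝ} (hν : IsPrior ν) {r : ℝ} (hr : 0 < r) :
    ∀ᶠ n in atTop, IsNear γ r (exactPosterior ν y n) := by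
  simp only [exactPosterior_eq]
  exact hy.eventually_isNear h0 h1 hν isClosed_univ (fun μ _ => hmax μ)
    (fun _ => MeasurableSet.univ) (Eventually.of_forall fun _ => subset_rfl) univ_mem
    (Eventually.of_forall fun _ => subset_rfl) hr

/-! ### Predictive densities of concentrated inferences -/

namespace IsNear

variable {γ r : ℝ} {κ : Measure ℝ}

lemma integrable (h : IsNear γ r κ) : Integrable (shiftBound γ) κ := by
  refine ⟨(measurable_shiftBound γ).aestronglyMeasurable, ?_⟩
  rw [hasFiniteIntegral_iff_ofReal (ae_of_all _ (shiftBound_nonneg γ))]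
  exact h.lintegral_le.trans_lt ENNReal.ofReal_lt_top

lemma integral_le (h : IsNear γ r κ) (hr : 0 ≤ r) : ∫ μ, shiftBound γ μ ∂κ ≤ r := by
  rw [integral_eq_lintegral_of_nonneg_ae (ae_of_all _ (shiftBound_nonneg γ))
    (measurable_shiftBound γ).aestronglyMeasurable]
  exact ENNReal.toReal_le_of_le_ofReal hr h.lintegral_le

/-- Serves both the density, for prediction, and its reciprocal, for leave-one-out. -/
lemma abs_integral_sub_le (h : IsNear γ r κ) (hr : 0 ≤ r) {f : ℝ → ℝ} {c : ℝ} (hc : 0 < c)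
    (hf : Measurable f) (hfc : ∀ μ, |f μ / c - 1| ≤ shiftBound γ μ) :
    Integrable f κ ∧ |∫ μ, f μ ∂κ - c| ≤ r * c := by
  have := h.isProbabilityMeasure
  have hb : ∀ μ, |f μ - c| ≤ shiftBound γ μ * c := by
    intro μ
    have e : f μ - c = (f μ / c - 1) * c := by field_simp
    rw [e, abs_mul, abs_of_pos hc]
    exact mul_le_mul_of_nonneg_right (hfc μ) hc.le
  have hi : Integrable (fun μ => f μ - c) κ :=
    (h.integrable.mul_const c).mono' (hf.sub_const c).aestronglyMeasurable (ae_of_all _ hb)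
  have hif : Integrable f κ :=
    (hi.add (integrable_const c)).congr (ae_of_all _ fun μ => by simp)
  refine ⟨hif, ?_⟩
  have e : ∫ μ, f μ ∂κ - c = ∫ μ, (f μ - c) ∂κ := by
    rw [integral_sub hif (integrable_const c)]; simp
  rw [e]
  calc |∫ μ, (f μ - c) ∂κ| ≤ ∫ μ, |f μ - c| ∂κ := abs_integral_le_integral_abs
    _ ≤ ∫ μ, shiftBound γ μ * c ∂κ :=
        integral_mono_ae hi.abs (h.integrable.mul_const c) (ae_of_all _ hb)
    _ ≤ r * c := by
        rw [integral_mul_const]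
        exact mul_le_mul_of_nonneg_right (h.integral_le hr) hc.le

end IsNear

/-- `x` and `z` agree up to a factor `exp s`. -/
def IsClose (s x z : ℝ) : Prop := Real.exp (-s) * z ≤ x ∧ x ≤ Real.exp s * z

lemma IsClose.pos {s x z : ℝ} (h : IsClose s x z) (hz : 0 < z) : 0 < x :=
  lt_of_lt_of_le (by positivity) h.1

lemma IsClose.abs_log_sub_le {s x z : ℝ} (h : IsClose s x z) (hz : 0 < z) :
    |Real.log x - Real.log z| ≤ s := by
  have h1 := Real.log_le_log (by positivity) h.1
  have h2 := Real.log_le_log (h.pos hz) h.2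
  rw [Real.log_mul (Real.exp_pos _).ne' hz.ne', Real.log_exp] at h1 h2
  rw [abs_le]
  constructor <;> linarith

lemma isClose_of_abs_log_sub_le {s x z : ℝ} (hx : 0 < x) (hz : 0 < z)
    (h : |Real.log x - Real.log z| ≤ s) : IsClose s x z := by
  rw [abs_le] at h
  constructor
  · rw [← Real.log_le_log_iff (by positivity) hx, Real.log_mul (Real.exp_pos _).ne' hz.ne',
      Real.log_exp]
    linarith
  · rw [← Real.log_le_log_iff hx (by positivity), Real.log_mul (Real.exp_pos _).ne' hz.ne',
      Real.log_exp]
    linarith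

lemma isClose_refl {s x : ℝ} (hs : 0 ≤ s) (hx : 0 ≤ x) : IsClose s x x := by
  constructor
  · have : Real.exp (-s) ≤ 1 := Real.exp_le_one_iff.2 (by linarith)
    nlinarith
  · have : 1 ≤ Real.exp s := Real.one_le_exp hs
    nlinarith

lemma isClose_of_abs_sub_le {r x z : ℝ} (hr : 0 ≤ r) (hr' : r ≤ 1 / 2) (hz : 0 < z)
    (h : |x - z| ≤ r * z) : IsClose (2 * r) x z := by
  rw [abs_le] at h
  have h1 : 1 + 2 * r ≤ Real.exp (2 * r) := by linarith [Real.add_one_le_exp (2 * r)]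
  constructor
  · have : Real.exp (-(2 * r)) ≤ 1 - r := by
      rw [Real.exp_neg]
      refine inv_le_of_inv_le₀ (by linarith) (le_trans ?_ h1)
      rw [inv_le_iff_one_le_mul₀ (by linarith)]
      nlinarith
    nlinarith
  · nlinarith

lemma IsClose.inv {s x z : ℝ} (h : IsClose s x z⁻¹) (hz : 0 < z) : IsClose s x⁻¹ z := by
  have hx := h.pos (inv_pos.2 hz)
  refine isClose_of_abs_log_sub_le (inv_pos.2 hx) hz ?_
  have := h.abs_log_sub_le (inv_pos.2 hz)
  rw [Real.log_inv] at this ⊢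
  rw [abs_le] at *
  constructor <;> linarith

/-- Multiplicative errors pass through nonnegative combinations unchanged, so the bounds for the
mixtures are uniform in the weights. -/
lemma IsClose.sum {ι : Type*} {A : Finset ι} {s : ℝ} {w x z : ι → ℝ} (hw : ∀ k ∈ A, 0 ≤ w k)
    (h : ∀ k ∈ A, IsClose s (x k) (z k)) :
    IsClose s (∑ k ∈ A, w k * x k) (∑ k ∈ A, w k * z k) := by
  constructor
  · rw [Finset.mul_sum]
    refine Finset.sum_le_sum fun k hk => ?_
    rw [mul_left_comm]
    exact mul_le_mul_of_nonneg_left (h k hk).1 (hw k hk)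
  · rw [Finset.mul_sum]
    refine Finset.sum_le_sum fun k hk => ?_
    rw [mul_left_comm (Real.exp s)]
    exact mul_le_mul_of_nonneg_left (h k hk).2 (hw k hk)

lemma IsNear.isClose_predDensity {γ r : ℝ} {κ : Measure ℝ} (h : IsNear γ r κ) (hr : 0 ≤ r)
    (hr' : r ≤ 1 / 2) (t : ℝ) : IsClose (2 * r) (predDensity κ t) (cauchyPDFReal γ 1 t) :=
  isClose_of_abs_sub_le hr hr' (cauchyPDFReal_one_pos γ t)
    (h.abs_integral_sub_le hr (cauchyPDFReal_one_pos γ t) (measurable_cauchyPDFReal_left t)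
      fun μ => abs_ratio_sub_one_le μ γ t).2

/-- The density that is integrated cancels the one divided out, so only the normalizing constant is
left: a harmonic mean. -/
lemma predDensity_leaveOut (κ : Measure ℝ) (t : ℝ)
    (hi : Integrable (fun μ => (cauchyPDFReal μ 1 t)⁻¹) κ) [IsProbabilityMeasure κ] :
    predDensity (leaveOut κ t) t = (∫ μ, (cauchyPDFReal μ 1 t)⁻¹ ∂κ)⁻¹ := by
  have hm : Measurable fun μ => ENNReal.ofReal (cauchyPDFReal μ 1 t)⁻¹ :=
    (measurable_cauchyPDFReal_left t).inv.ennreal_ofReal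
  have hpos : ∀ μ, 0 ≤ (cauchyPDFReal μ 1 t)⁻¹ := fun μ =>
    (inv_pos.2 (cauchyPDFReal_one_pos μ t)).le
  unfold predDensity leaveOut normalize
  rw [integral_smul_measure, integral_withDensity_eq_integral_toReal_smul hm (by simp),
    withDensity_apply _ MeasurableSet.univ, Measure.restrict_univ, ENNReal.toReal_inv,
    ← integral_eq_lintegral_of_nonneg_ae (ae_of_all _ hpos) hi.aestronglyMeasurable]
  have e : ∀ μ, (ENNReal.ofReal (cauchyPDFReal μ 1 t)⁻¹).toReal • cauchyPDFReal μ 1 t = 1 := by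
    intro μ
    rw [ENNReal.toReal_ofReal (hpos μ), smul_eq_mul,
      inv_mul_cancel₀ (cauchyPDFReal_one_pos μ t).ne']
  simp only [e]
  simp

lemma IsNear.isClose_leaveOut {γ r : ℝ} {κ : Measure ℝ} (h : IsNear γ r κ) (hr : 0 ≤ r)
    (hr' : r ≤ 1 / 2) (t : ℝ) :
    IsClose (2 * r) (predDensity (leaveOut κ t) t) (cauchyPDFReal γ 1 t) := by
  have hp := cauchyPDFReal_one_pos γ t
  have := h.isProbabilityMeasure
  obtain ⟨h1, h2⟩ := h.abs_integral_sub_le (f := fun μ => (cauchyPDFReal μ 1 t)⁻¹) hr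
    (inv_pos.2 hp) (measurable_cauchyPDFReal_left t).inv fun μ => by
      rw [shiftBound_comm, inv_div_inv]
      exact abs_ratio_sub_one_le γ μ t
  rw [predDensity_leaveOut κ t h1]
  exact (isClose_of_abs_sub_le hr hr' (inv_pos.2 hp) h2).inv hp

lemma predDensity_stacked {K : ℕ} {q : Fin K → Measure ℝ} (hq : ∀ k, IsProbabilityMeasure (q k))
    {w : Fin K → ℝ} (hw : ∀ k, 0 ≤ w k) (t : ℝ) :
    predDensity (stacked q w) t = ∑ k, w k * predDensity (q k) t := by
  have hi : ∀ k, Integrable (fun μ => cauchyPDFReal μ 1 t) (q k) := fun k =>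
    (integrable_const (1 : ℝ)).mono' (measurable_cauchyPDFReal_left t).aestronglyMeasurable
      (ae_of_all _ fun μ => by
        rw [Real.norm_of_nonneg (cauchyPDFReal_one_pos μ t).le]; exact cauchyPDFReal_one_le μ t)
  unfold predDensity stacked
  rw [integral_finsetSum_measure fun k _ => (hi k).smul_measure ENNReal.ofReal_ne_top]
  refine Finset.sum_congr rfl fun k _ => ?_
  rw [integral_smul_measure, ENNReal.toReal_ofReal (hw k), smul_eq_mul]

/-! ### Mixtures of two Cauchy densities -/

/-- The density of the mixture of `Cauchy(g₁, 1)` and `Cauchy(g₂, 1)` with weights `1 - t`, `t`. -/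
noncomputable def mixDensity (g₁ g₂ t y : ℝ) : ℝ :=
  (1 - t) * cauchyPDFReal g₁ 1 y + t * cauchyPDFReal g₂ 1 y

lemma isClose_cauchyPDFReal (g₁ g₂ y : ℝ) :
    IsClose |g₁ - g₂| (cauchyPDFReal g₂ 1 y) (cauchyPDFReal g₁ 1 y) :=
  isClose_of_abs_log_sub_le (cauchyPDFReal_one_pos _ _) (cauchyPDFReal_one_pos _ _)
    (by rw [abs_sub_comm g₁]; exact abs_log_cauchyPDFReal_sub_le g₂ g₁ y)

variable {g₁ g₂ t : ℝ}

/-- Comparison with a single component, at a cost independent of `y` and `t`, transfers positivity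
and log-integrability to every mixture, endpoints included. -/
lemma isClose_mixDensity (ht : t ∈ Set.Icc (0 : ℝ) 1) (y : ℝ) :
    IsClose |g₁ - g₂| (mixDensity g₁ g₂ t y) (cauchyPDFReal g₁ 1 y) := by
  have h := IsClose.sum (A := Finset.univ) (w := ![1 - t, t])
    (x := ![cauchyPDFReal g₁ 1 y, cauchyPDFReal g₂ 1 y])
    (z := ![cauchyPDFReal g₁ 1 y, cauchyPDFReal g₁ 1 y]) (s := |g₁ - g₂|)
    (fun k _ => by fin_cases k <;> simp [ht.1, ht.2])
    (fun k _ => by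
      fin_cases k
      · exact isClose_refl (abs_nonneg _) (cauchyPDFReal_one_pos _ _).le
      · exact isClose_cauchyPDFReal g₁ g₂ y)
  simp only [Fin.sum_univ_two, Matrix.cons_val_zero, Matrix.cons_val_one] at h
  rw [← add_mul, sub_add_cancel, one_mul] at h
  exact h

lemma mixDensity_pos (ht : t ∈ Set.Icc (0 : ℝ) 1) (y : ℝ) : 0 < mixDensity g₁ g₂ t y :=
  (isClose_mixDensity ht y).pos (cauchyPDFReal_one_pos _ _)

lemma measurable_mixDensity (g₁ g₂ t : ℝ) : Measurable (mixDensity g₁ g₂ t) := by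
  unfold mixDensity; fun_prop

lemma integrable_log_mixDensity {a p : ℝ} (h0 : 0 ≤ p) (h1 : p ≤ 1)
    (ht : t ∈ Set.Icc (0 : ℝ) 1) :
    Integrable (fun y => Real.log (mixDensity g₁ g₂ t y)) (trueMeasure a p) := by
  have := isProbabilityMeasure_trueMeasure h0 h1 a
  have hi : Integrable (fun y => Real.log (mixDensity g₁ g₂ t y)
      - Real.log (cauchyPDFReal g₁ 1 y)) (trueMeasure a p) :=
    (integrable_const |g₁ - g₂|).mono'
      ((measurable_mixDensity _ _ _).log.sub (by fun_prop)).aestronglyMeasurable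
      (ae_of_all _ fun y =>
        (isClose_mixDensity ht y).abs_log_sub_le (cauchyPDFReal_one_pos _ _))
  exact (hi.add (integrable_log_cauchyPDFReal_trueMeasure a p g₁)).congr
    (ae_of_all _ fun y => by simp)

lemma concaveOn_log_mixDensity (g₁ g₂ y : ℝ) :
    ConcaveOn ℝ (Set.Icc (0 : ℝ) 1) fun t => Real.log (mixDensity g₁ g₂ t y) := by
  refine ⟨convex_Icc 0 1, fun s hs t ht α β hα hβ hαβ => ?_⟩
  have h := strictConcaveOn_log_Ioi.concaveOn.2 (Set.mem_Ioi.2 (mixDensity_pos (g₁ := g₁)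
    (g₂ := g₂) hs y)) (Set.mem_Ioi.2 (mixDensity_pos
    (g₁ := g₁) (g₂ := g₂) ht y)) hα hβ hαβ
  have e : mixDensity g₁ g₂ (α • s + β • t) y
      = α • mixDensity g₁ g₂ s y + β • mixDensity g₁ g₂ t y := by
    unfold mixDensity
    simp only [smul_eq_mul]
    linear_combination (-(cauchyPDFReal g₁ 1 y)) * hαβ
  simp only [e]
  exact h

lemma abs_log_mixDensity_sub_le {s : ℝ} (hs : s ∈ Set.Icc (0 : ℝ) 1)
    (ht : t ∈ Set.Icc (0 : ℝ) 1) (y : ℝ) :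
    |Real.log (mixDensity g₁ g₂ s y) - Real.log (mixDensity g₁ g₂ t y)|
      ≤ Real.exp (2 * |g₁ - g₂|) * |s - t| := by
  have key : ∀ s ∈ Set.Icc (0 : ℝ) 1, ∀ t ∈ Set.Icc (0 : ℝ) 1,
      Real.log (mixDensity g₁ g₂ s y) - Real.log (mixDensity g₁ g₂ t y)
        ≤ Real.exp (2 * |g₁ - g₂|) * |s - t| := by
    intro s hs t ht
    have ps := mixDensity_pos (g₁ := g₁) (g₂ := g₂) hs y
    have pt := mixDensity_pos (g₁ := g₁) (g₂ := g₂) ht y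
    have p1 := cauchyPDFReal_one_pos g₁ y
    have p2 := cauchyPDFReal_one_pos g₂ y
    rw [← Real.log_div ps.ne' pt.ne']
    refine (Real.log_le_sub_one_of_pos (div_pos ps pt)).trans ?_
    rw [div_sub_one pt.ne', div_le_iff₀ pt]
    have e : mixDensity g₁ g₂ s y - mixDensity g₁ g₂ t y
        = (s - t) * (cauchyPDFReal g₂ 1 y - cauchyPDFReal g₁ 1 y) := by unfold mixDensity; ring
    have hE : 1 ≤ Real.exp |g₁ - g₂| := Real.one_le_exp (abs_nonneg _)
    have hd : |cauchyPDFReal g₂ 1 y - cauchyPDFReal g₁ 1 y|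
        ≤ Real.exp |g₁ - g₂| * cauchyPDFReal g₁ 1 y := by
      rw [abs_le]
      constructor
      · nlinarith
      · linarith [(isClose_cauchyPDFReal g₁ g₂ y).2]
    have hm := (isClose_mixDensity (g₁ := g₁) (g₂ := g₂) ht y).1
    calc _ ≤ |s - t| * |cauchyPDFReal g₂ 1 y - cauchyPDFReal g₁ 1 y| := by
          rw [e, ← abs_mul]; exact le_abs_self _
      _ ≤ |s - t| * (Real.exp |g₁ - g₂| * cauchyPDFReal g₁ 1 y) := by gcongr
      _ = Real.exp (2 * |g₁ - g₂|) * |s - t|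
          * (Real.exp (-|g₁ - g₂|) * cauchyPDFReal g₁ 1 y) := by
          rw [two_mul, Real.exp_add, Real.exp_neg]; field_simp
      _ ≤ _ := by gcongr
  rw [abs_le]
  constructor
  · have := key t ht s hs
    rw [abs_sub_comm t] at this
    linarith
  · exact key s hs t ht

/-! ### Convergence of the stacking weights -/

/-- The average log density of the mixture. -/
noncomputable def avgLogMix (g₁ g₂ : ℝ) (y : ℕ → ℝ) (n : ℕ) (t : ℝ) : ℝ :=
  (∑ i ∈ Finset.range n, Real.log (mixDensity g₁ g₂ t (y i))) / n

lemma concaveOn_avgLogMix (g₁ g₂ : ℝ) (y : ℕ → ℝ) (n : ℕ) :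
    ConcaveOn ℝ (Set.Icc (0 : ℝ) 1) (avgLogMix g₁ g₂ y n) := by
  have h : ∀ A : Finset ℕ, ConcaveOn ℝ (Set.Icc (0 : ℝ) 1)
      fun t => ∑ i ∈ A, Real.log (mixDensity g₁ g₂ t (y i)) := by
    intro A
    induction A using Finset.induction_on with
    | empty => simpa using concaveOn_const 0 (convex_Icc (0 : ℝ) 1)
    | insert i A hi ih =>
      simp only [Finset.sum_insert hi]
      exact (concaveOn_log_mixDensity g₁ g₂ (y i)).add ih
  have := (h (Finset.range n)).smul (c := (n : ℝ)⁻¹) (by positivity)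
  refine this.congr fun t _ => ?_
  simp [avgLogMix, div_eq_inv_mul]

/-- A concave function that has dropped below its value at `x` cannot recover further out. One test
point on each side of the limit therefore replaces uniform convergence in the weight. -/
lemma le_sub_of_concaveOn {f : ℝ → ℝ} {S : Set ℝ} (hf : ConcaveOn ℝ S f)
    {x q z g : ℝ} (hx : x ∈ S) (hz : z ∈ S) (hq : q ∈ openSegment ℝ x z) (hg : 0 ≤ g)
    (h : f q ≤ f x - g) : f z ≤ f x - g := by
  obtain ⟨α, β, hα, hβ, hαβ, rfl⟩ := hq
  have h1 := hf.2 hx hz hα.le hβ.le hαβ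
  simp only [smul_eq_mul] at h1 h
  obtain rfl : α = 1 - β := by linarith
  by_contra hc
  rw [not_le] at hc
  nlinarith [mul_lt_mul_of_pos_left hc hβ]

section Stacking

variable {ρ : (Fin 2 → ℝ) → ℝ} {q : Fin 2 → Measure ℝ} {y : ℕ → ℝ} {n : ℕ}

lemma mem_stdSimplex_two {w : Fin 2 → ℝ} (hw : w ∈ stdSimplex ℝ (Fin 2)) :
    w 0 = 1 - w 1 ∧ w 1 ∈ Set.Icc (0 : ℝ) 1 := by
  have h := hw.2
  rw [Fin.sum_univ_two] at h
  have h0 := hw.1 0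
  exact ⟨by linarith, hw.1 1, by linarith⟩

lemma pair_mem_stdSimplex {t : ℝ} (ht : t ∈ Set.Icc (0 : ℝ) 1) :
    ![1 - t, t] ∈ stdSimplex ℝ (Fin 2) := by
  refine ⟨fun k => ?_, by simp⟩
  fin_cases k <;> simp [ht.1, ht.2]

lemma sum_mul_pdf_eq {w : Fin 2 → ℝ} (hw : w ∈ stdSimplex ℝ (Fin 2)) (x : ℝ) :
    ∑ k, w k * cauchyPDFReal (![g₁, g₂] k) 1 x = mixDensity g₁ g₂ (w 1) x := by
  rw [Fin.sum_univ_two, (mem_stdSimplex_two hw).1]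
  rfl

lemma isClose_stacked {r : ℝ} (hr : 0 ≤ r) (hr' : r ≤ 1 / 2)
    (hq : ∀ k, IsNear (![g₁, g₂] k) r (q k)) {w : Fin 2 → ℝ} (hw : w ∈ stdSimplex ℝ (Fin 2))
    (x : ℝ) : IsClose (2 * r) (predDensity (stacked q w) x) (mixDensity g₁ g₂ (w 1) x) := by
  rw [predDensity_stacked (fun k => (hq k).isProbabilityMeasure) hw.1, ← sum_mul_pdf_eq hw]
  exact IsClose.sum (fun k _ => hw.1 k) fun k _ => (hq k).isClose_predDensity hr hr' x

lemma isClose_leaveOut_mix {r : ℝ} (hr : 0 ≤ r) (hr' : r ≤ 1 / 2)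
    (hq : ∀ k, IsNear (![g₁, g₂] k) r (q k)) {w : Fin 2 → ℝ} (hw : w ∈ stdSimplex ℝ (Fin 2))
    (x : ℝ) : IsClose (2 * r) (∑ k, w k * predDensity (leaveOut (q k) x) x)
      (mixDensity g₁ g₂ (w 1) x) := by
  rw [← sum_mul_pdf_eq hw]
  exact IsClose.sum (fun k _ => hw.1 k) fun k _ => (hq k).isClose_leaveOut hr hr' x

lemma abs_stackingObjective_sub_le {r : ℝ} (hr : 0 ≤ r) (hr' : r ≤ 1 / 2)
    (hq : ∀ k, IsNear (![g₁, g₂] k) r (q k)) {w : Fin 2 → ℝ} (hw : w ∈ stdSimplex ℝ (Fin 2)) :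
    |stackingObjective ρ q y n w - (n * avgLogMix g₁ g₂ y n (w 1) + Real.log (ρ w))|
      ≤ n * (2 * r) := by
  have e : (n : ℝ) * avgLogMix g₁ g₂ y n (w 1)
      = ∑ i ∈ Finset.range n, Real.log (mixDensity g₁ g₂ (w 1) (y i)) := by
    rcases n.eq_zero_or_pos with rfl | hn
    · simp
    · rw [avgLogMix, mul_div_cancel₀ _ (by positivity)]
  rw [e, stackingObjective, add_sub_add_right_eq_sub, ← Finset.sum_sub_distrib]
  refine (Finset.abs_sum_le_sum_abs _ _).trans ((Finset.sum_le_sum fun i _ =>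
    (isClose_leaveOut_mix hr hr' hq hw (y i)).abs_log_sub_le
      (mixDensity_pos (mem_stdSimplex_two hw).2 _)).trans ?_)
  simp

lemma exists_isStackingWeights (hρ : IsWeightPrior ρ)
    (hq : ∀ k, IsNear (![g₁, g₂] k) (1 / 2) (q k)) : ∃ w, IsStackingWeights ρ q y n w := by
  set F : (Fin 2 → ℝ) → ℕ → ℝ :=
    fun w i => ∑ k, w k * predDensity (leaveOut (q k) (y i)) (y i) with hF
  have hFpos : ∀ w ∈ stdSimplex ℝ (Fin 2), ∀ i, 0 < F w i := fun w hw i =>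
    (isClose_leaveOut_mix (by norm_num) le_rfl hq hw (y i)).pos
      (mixDensity_pos (mem_stdSimplex_two hw).2 _)
  -- The exponentiated objective stays continuous where `ρ` vanishes; its maximum is positive
  -- because `ρ` is at the barycentre.
  have hcont : ContinuousOn (fun w => ρ w * ∏ i ∈ Finset.range n, F w i)
      (stdSimplex ℝ (Fin 2)) :=
    hρ.1.mul (Continuous.continuousOn (by simp only [hF]; fun_prop))
  have hc : ![1 - (1 / 2 : ℝ), 1 / 2] ∈ stdSimplex ℝ (Fin 2) :=
    pair_mem_stdSimplex ⟨by norm_num, by norm_num⟩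
  obtain ⟨w, hw, hmax⟩ := (isCompact_stdSimplex ℝ (Fin 2)).exists_isMaxOn ⟨_, hc⟩ hcont
  have hprod : ∀ w ∈ stdSimplex ℝ (Fin 2), 0 < ∏ i ∈ Finset.range n, F w i := fun w hw =>
    Finset.prod_pos fun i _ => hFpos w hw i
  have hcρ : 0 < ρ ![1 - (1 / 2 : ℝ), 1 / 2] :=
    (hρ.2 _ hc).2 fun k => by fin_cases k <;> norm_num
  have hpos : 0 < ρ w * ∏ i ∈ Finset.range n, F w i :=
    (mul_pos hcρ (hprod _ hc)).trans_le (hmax hc)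
  have hobj : ∀ w ∈ stdSimplex ℝ (Fin 2), 0 < ρ w →
      stackingObjective ρ q y n w = Real.log (ρ w * ∏ i ∈ Finset.range n, F w i) := by
    intro w hw hρw
    rw [Real.log_mul hρw.ne' (hprod w hw).ne',
      Real.log_prod fun i _ => (hFpos w hw i).ne', add_comm]
    rfl
  have hρw : 0 < ρ w := pos_of_mul_pos_left hpos (hprod w hw).le
  refine ⟨w, hw, hρw, fun w' hw' hρw' => ?_⟩
  rw [hobj w hw hρw, hobj w' hw' hρw']
  exact Real.log_le_log (mul_pos hρw' (hprod w' hw')) (hmax hw')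

end Stacking

/-- Optimality forces the mixture average at the stacking weight to be almost that at `s`. At
rational points on both sides of `s` the average is lower by a fixed gap, so by concavity the weight
lies between them. -/
theorem tendsto_stackingWeights {ρ : (Fin 2 → ℝ) → ℝ} (hρ : IsWeightPrior ρ)
    {q : ℕ → Fin 2 → Measure ℝ} {y : ℕ → ℝ}
    (hq : ∀ r : ℝ, 0 < r → ∀ᶠ n in atTop, ∀ k, IsNear (![g₁, g₂] k) r (q n k))
    {G : ℝ → ℝ} {s : ℝ} (hs : s ∈ Set.Ioo (0 : ℝ) 1)
    (hG : ∀ t ∈ Set.Icc (0 : ℝ) 1, t ≠ s → G t < G s)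
    (hs_lim : Tendsto (fun n => avgLogMix g₁ g₂ y n s) atTop (𝓝 (G s)))
    (hlim : ∀ x : ℚ, (x : ℝ) ∈ Set.Icc (0 : ℝ) 1 →
      Tendsto (fun n => avgLogMix g₁ g₂ y n x) atTop (𝓝 (G x)))
    {w : ℕ → Fin 2 → ℝ} (hw : ∀ᶠ n in atTop, IsStackingWeights ρ (q n) y n (w n)) :
    Tendsto w atTop (𝓝 ![1 - s, s]) := by
  have hsI : s ∈ Set.Icc (0 : ℝ) 1 := ⟨hs.1.le, hs.2.le⟩
  have hmem := pair_mem_stdSimplex hsI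
  have hρs : 0 < ρ ![1 - s, s] := (hρ.2 _ hmem).2 fun k => by
    fin_cases k <;> simp [hs.1, hs.2]
  -- Only an upper bound on `log ρ` along the weights is needed, and a lower one at the limit; `ρ`
  -- may vanish on the boundary.
  obtain ⟨v, hv, hvmax⟩ := (isCompact_stdSimplex ℝ (Fin 2)).exists_isMaxOn ⟨_, hmem⟩ hρ.1
  have main : Tendsto (fun n => w n 1) atTop (𝓝 s) := by
    rw [Metric.tendsto_atTop']
    simp only [← gt_iff_lt]
    suffices H : ∀ η : ℝ, 0 < η → ∀ᶠ n in atTop, dist (w n 1) s < η by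
      intro η hη
      obtain ⟨N, hN⟩ := eventually_atTop.1 (H η hη)
      exact ⟨N, fun n hn => hN n (le_of_lt hn)⟩
    intro η hη
    obtain ⟨x₁, hx₁, hx₁'⟩ : ∃ x : ℚ, max 0 (s - η) < (x : ℝ) ∧ (x : ℝ) < s :=
      exists_rat_btwn (max_lt hs.1 (by linarith))
    obtain ⟨x₂, hx₂, hx₂'⟩ : ∃ x : ℚ, s < (x : ℝ) ∧ (x : ℝ) < min 1 (s + η) :=
      exists_rat_btwn (lt_min hs.2 (by linarith))
    rw [max_lt_iff] at hx₁
    rw [lt_min_iff] at hx₂'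
    have hI₁ : (x₁ : ℝ) ∈ Set.Icc (0 : ℝ) 1 := ⟨hx₁.1.le, by linarith [hs.2]⟩
    have hI₂ : (x₂ : ℝ) ∈ Set.Icc (0 : ℝ) 1 := ⟨by linarith [hs.1], hx₂'.1.le⟩
    have g₁pos := hG x₁ hI₁ hx₁'.ne
    have g₂pos := hG x₂ hI₂ hx₂.ne'
    -- One `g` for each of the two leave-one-out approximations and one for the weight prior, whose
    -- effect is of order `1/n`.
    obtain ⟨g, hg, hgl₁, hgl₂⟩ : ∃ g : ℝ, 0 < g ∧ 3 * g < G s - G x₁ ∧ 3 * g < G s - G x₂ := by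
      refine ⟨min (G s - G x₁) (G s - G x₂) / 4, ?_, ?_, ?_⟩
      · have := lt_min (sub_pos.2 g₁pos) (sub_pos.2 g₂pos); linarith
      · have := min_le_left (G s - G x₁) (G s - G x₂); linarith
      · have := min_le_right (G s - G x₁) (G s - G x₂); linarith
    have ev₁ := (hs_lim.sub (hlim x₁ hI₁)).eventually (lt_mem_nhds hgl₁)
    have ev₂ := (hs_lim.sub (hlim x₂ hI₂)).eventually (lt_mem_nhds hgl₂)
    have ev₃ : ∀ᶠ n : ℕ in atTop, Real.log (ρ v) - Real.log (ρ ![1 - s, s]) < n * g :=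
      (tendsto_natCast_atTop_atTop.atTop_mul_const hg).eventually_gt_atTop _
    filter_upwards [ev₁, ev₂, ev₃, hq (min (1 / 2) (g / 2)) (by positivity), hw,
      eventually_gt_atTop 0] with n e₁ e₂ e₃ hqn hwn hn
    have hn' : (0 : ℝ) < n := by positivity
    obtain ⟨hwI0, hwI⟩ := mem_stdSimplex_two hwn.1
    have hr0 : 0 ≤ min (1 / 2) (g / 2) := by positivity
    have hrg : n * (2 * min (1 / 2) (g / 2)) ≤ n * g := by
      have := min_le_right (1 / 2) (g / 2); gcongr; linarith
    have b1 := (abs_le.1 (abs_stackingObjective_sub_le (ρ := ρ) (y := y) (n := n) hr0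
      (min_le_left _ _) hqn hwn.1)).2
    have b2 := (abs_le.1 (abs_stackingObjective_sub_le (ρ := ρ) (y := y) (n := n) hr0
      (min_le_left _ _) hqn hmem)).1
    have b3 := hwn.2.2 _ hmem hρs
    have b4 : Real.log (ρ (w n)) ≤ Real.log (ρ v) :=
      Real.log_le_log hwn.2.1 (hvmax hwn.1)
    simp only [Matrix.cons_val_one] at b2
    have b5 : avgLogMix g₁ g₂ y n s - 3 * g < avgLogMix g₁ g₂ y n (w n 1) := by
      have : n * (avgLogMix g₁ g₂ y n s - 3 * g) < n * avgLogMix g₁ g₂ y n (w n 1) := by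
        simp only [Matrix.cons_val_fin_one] at b2
        nlinarith
      exact lt_of_mul_lt_mul_left this hn'.le
    have hconc := concaveOn_avgLogMix g₁ g₂ y n
    rw [Real.dist_eq, abs_lt]
    constructor
    · by_contra hc
      have hlt : w n 1 < x₁ := by linarith
      have hseg : (x₁ : ℝ) ∈ openSegment ℝ s (w n 1) := by
        rw [openSegment_symm, openSegment_eq_Ioo (hlt.trans hx₁')]
        exact ⟨hlt, hx₁'⟩
      have := le_sub_of_concaveOn hconc hsI hwI hseg (g := 3 * g)
        (by positivity) (by linarith)
      linarith
    · by_contra hc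
      have hlt : x₂ < w n 1 := by linarith
      have hseg : (x₂ : ℝ) ∈ openSegment ℝ s (w n 1) := by
        rw [openSegment_eq_Ioo (hx₂.trans hlt)]
        exact ⟨hx₂, hlt⟩
      have := le_sub_of_concaveOn hconc hsI hwI hseg (g := 3 * g)
        (by positivity) (by linarith)
      linarith
  rw [tendsto_pi_nhds]
  intro k
  fin_cases k
  · have h2 : Tendsto (fun n => 1 - w n 1) atTop (𝓝 (1 - s)) := main.const_sub 1
    refine h2.congr' ?_
    filter_upwards [hw] with n hwn
    exact (mem_stdSimplex_two hwn.1).1.symm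
  · exact main

/-! ### The limiting score of a mixture -/

/-- The expected log density of the mixture. -/
noncomputable def limitScore (a p g₁ g₂ t : ℝ) : ℝ :=
  ∫ y, Real.log (mixDensity g₁ g₂ t y) ∂(trueMeasure a p)

lemma mixDensity_one_sub (g₁ g₂ t y : ℝ) : mixDensity g₂ g₁ (1 - t) y = mixDensity g₁ g₂ t y := by
  unfold mixDensity; ring

lemma limitScore_one_sub (a p g₁ g₂ t : ℝ) :
    limitScore a p g₂ g₁ (1 - t) = limitScore a p g₁ g₂ t := by
  simp only [limitScore, mixDensity_one_sub]

lemma limitScore_one (a p g₁ g₂ : ℝ) : limitScore a p g₁ g₂ 1 = limitLogPosterior a p g₂ := by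
  simp [limitScore, limitLogPosterior, mixDensity]

section

variable {a p g₁ g₂ : ℝ}

lemma abs_limitScore_sub_le (h0 : 0 ≤ p) (h1 : p ≤ 1) {s t : ℝ}
    (hs : s ∈ Set.Icc (0 : ℝ) 1) (ht : t ∈ Set.Icc (0 : ℝ) 1) :
    |limitScore a p g₁ g₂ s - limitScore a p g₁ g₂ t| ≤ Real.exp (2 * |g₁ - g₂|) * |s - t| := by
  have := isProbabilityMeasure_trueMeasure h0 h1 a
  unfold limitScore
  rw [← integral_sub (integrable_log_mixDensity h0 h1 hs) (integrable_log_mixDensity h0 h1 ht)]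
  have h := norm_integral_le_of_norm_le_const (μ := trueMeasure a p)
    (C := Real.exp (2 * |g₁ - g₂|) * |s - t|)
    (f := fun y => Real.log (mixDensity g₁ g₂ s y) - Real.log (mixDensity g₁ g₂ t y))
    (ae_of_all _ fun y => abs_log_mixDensity_sub_le hs ht y)
  simpa using h

lemma continuousOn_limitScore (h0 : 0 ≤ p) (h1 : p ≤ 1) : ContinuousOn (limitScore a p g₁ g₂) (Set.Icc 0 1) := by
  have : LipschitzOnWith (Real.toNNReal (Real.exp (2 * |g₁ - g₂|))) (limitScore a p g₁ g₂)
      (Set.Icc 0 1) := by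
    refine LipschitzOnWith.of_dist_le_mul fun s hs t ht => ?_
    rw [Real.coe_toNNReal _ (Real.exp_pos _).le, Real.dist_eq, Real.dist_eq]
    exact abs_limitScore_sub_le h0 h1 hs ht
  exact this.continuousOn

lemma trueMeasure_absolutelyContinuous (h0 : 0 ≤ p) (h1 : p ≤ 1) : trueMeasure a p ≪ volume := by
  rw [trueMeasure_eq_withDensity h0 h1]
  exact withDensity_absolutelyContinuous _ _

lemma cauchyPDFReal_eq_iff (hne : g₁ ≠ g₂) (y : ℝ) :
    cauchyPDFReal g₁ 1 y = cauchyPDFReal g₂ 1 y ↔ y = (g₁ + g₂) / 2 := by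
  rw [cauchyPDFReal_one, cauchyPDFReal_one, mul_right_inj' (by positivity), inv_inj]
  constructor
  · intro h
    have : (g₁ - g₂) * (2 * y - (g₁ + g₂)) = 0 := by linarith
    rcases mul_eq_zero.1 this with h | h
    · exact absurd (sub_eq_zero.1 h) hne
    · linarith
  · rintro rfl; ring

/-- Strict concavity of the logarithm applies at almost every `y`: the two component densities agree
only at the midpoint of their locations. -/
lemma limitScore_midpoint_lt (h0 : 0 ≤ p) (h1 : p ≤ 1)
    (hne : g₁ ≠ g₂) {s t : ℝ} (hs : s ∈ Set.Icc (0 : ℝ) 1)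
    (ht : t ∈ Set.Icc (0 : ℝ) 1) (hst : s ≠ t) :
    (limitScore a p g₁ g₂ s + limitScore a p g₁ g₂ t) / 2
      < limitScore a p g₁ g₂ ((s + t) / 2) := by
  have := isProbabilityMeasure_trueMeasure h0 h1 a
  have hm : (s + t) / 2 ∈ Set.Icc (0 : ℝ) 1 :=
    ⟨by linarith [hs.1, ht.1], by linarith [hs.2, ht.2]⟩
  have is := integrable_log_mixDensity (g₁ := g₁) (g₂ := g₂) (a := a) h0 h1 hs
  have it := integrable_log_mixDensity (g₁ := g₁) (g₂ := g₂) (a := a) h0 h1 ht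
  have im := integrable_log_mixDensity (g₁ := g₁) (g₂ := g₂) (a := a) h0 h1 hm
  set φ : ℝ → ℝ := fun y => Real.log (mixDensity g₁ g₂ ((s + t) / 2) y)
    - (Real.log (mixDensity g₁ g₂ s y) + Real.log (mixDensity g₁ g₂ t y)) / 2 with hφ
  have iφ : Integrable φ (trueMeasure a p) := im.sub ((is.add it).div_const 2)
  have emid : ∀ y, mixDensity g₁ g₂ ((s + t) / 2) y
      = (1 / 2 : ℝ) * mixDensity g₁ g₂ s y + (1 / 2 : ℝ) * mixDensity g₁ g₂ t y := by
    intro y; unfold mixDensity; ring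
  have hpos : ∀ y, y ≠ (g₁ + g₂) / 2 → 0 < φ y := by
    intro y hy
    have hd : mixDensity g₁ g₂ s y ≠ mixDensity g₁ g₂ t y := by
      intro h
      have : (s - t) * (cauchyPDFReal g₂ 1 y - cauchyPDFReal g₁ 1 y) = 0 := by
        unfold mixDensity at h; linarith
      rcases mul_eq_zero.1 this with h | h
      · exact hst (sub_eq_zero.1 h)
      · exact hy ((cauchyPDFReal_eq_iff hne y).1 (sub_eq_zero.1 h).symm)
    have := strictConcaveOn_log_Ioi.2 (Set.mem_Ioi.2 (mixDensity_pos (g₁ := g₁)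
      (g₂ := g₂) hs y)) (Set.mem_Ioi.2 (mixDensity_pos (g₁ := g₁) (g₂ := g₂) ht y)) hd
      (show (0 : ℝ) < 1 / 2 by norm_num) (show (0 : ℝ) < 1 / 2 by norm_num) (by norm_num)
    simp only [smul_eq_mul] at this
    rw [← emid] at this
    simp only [hφ]
    linarith
  have hae : ∀ᵐ y ∂(trueMeasure a p), 0 < φ y := by
    have : ∀ᵐ y ∂(trueMeasure a p), y ≠ (g₁ + g₂) / 2 :=
      (trueMeasure_absolutelyContinuous h0 h1).ae_le (Measure.ae_ne volume _)
    exact this.mono fun y hy => hpos y hy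
  have hint : 0 < ∫ y, φ y ∂(trueMeasure a p) := by
    rw [integral_pos_iff_support_of_nonneg_ae (hae.mono fun y hy => hy.le) iφ, pos_iff_ne_zero]
    intro hz
    have : ∀ᵐ y ∂(trueMeasure a p), False := by
      filter_upwards [hae, compl_mem_ae_iff.2 hz] with y h1 h2
      exact h2 h1.ne'
    exact this.exists.elim fun _ h => h
  have e : ∫ y, φ y ∂(trueMeasure a p) = limitScore a p g₁ g₂ ((s + t) / 2)
      - (limitScore a p g₁ g₂ s + limitScore a p g₁ g₂ t) / 2 := by
    have ist : Integrable (fun y => Real.log (mixDensity g₁ g₂ s y)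
        + Real.log (mixDensity g₁ g₂ t y)) (trueMeasure a p) := is.add it
    simp only [hφ, limitScore]
    rw [integral_sub im (ist.div_const 2), integral_div, integral_add is it]
  linarith

/-- Moving some weight to a second critical point improves the score. -/
lemma exists_limitScore_zero_lt (h0 : 0 ≤ p) (h1 : p ≤ 1) (hne : g₁ ≠ g₂)
    (hcrit : HasDerivAt (limitLogPosterior a p) 0 g₂) :
    ∃ s ∈ Set.Icc (0 : ℝ) 1, limitScore a p g₁ g₂ 0 < limitScore a p g₁ g₂ s := by
  have := isProbabilityMeasure_trueMeasure h0 h1 a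
  have hzero : ∫ y, 2 * ((y - g₂) / (1 + (y - g₂) ^ 2)) ∂(trueMeasure a p) = 0 :=
    (hasDerivAt_limitLogPosterior_integral h0 h1 a g₂).unique hcrit
  have hinv : Integrable (fun y => (1 + (y - g₂) ^ 2)⁻¹) (trueMeasure a p) := by
    refine (integrable_const (1 : ℝ)).mono' (Measurable.aestronglyMeasurable (by fun_prop))
      (ae_of_all _ fun y => ?_)
    rw [Real.norm_of_nonneg (by positivity)]
    exact inv_le_one_of_one_le₀ (by nlinarith [sq_nonneg (y - g₂)])
  have hinvpos : 0 < ∫ y, (1 + (y - g₂) ^ 2)⁻¹ ∂(trueMeasure a p) := by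
    rw [integral_pos_iff_support_of_nonneg (fun y => by positivity) hinv]
    have : Function.support (fun y => (1 + (y - g₂) ^ 2)⁻¹) = Set.univ := by
      ext y
      simpa using (by positivity : 1 + (y - g₂) ^ 2 ≠ 0)
    rw [this, measure_univ]
    exact one_pos
  set R : ℝ → ℝ := fun y => cauchyPDFReal g₂ 1 y / cauchyPDFReal g₁ 1 y - 1 with hR
  -- Expanding around `g₂`, the location receiving weight, isolates the score there, whose mean is
  -- zero; the remainder is positive.
  have eR : ∀ y, R y = (g₂ - g₁) * (2 * ((y - g₂) / (1 + (y - g₂) ^ 2)))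
      + (g₂ - g₁) ^ 2 * (1 + (y - g₂) ^ 2)⁻¹ := by
    intro y
    simp only [hR, cauchyPDFReal_one]
    have := Real.pi_pos
    field_simp
    ring
  have i1 := (integrable_score (trueMeasure a p) g₂).const_mul 2
  have iR : Integrable R (trueMeasure a p) := by
    refine ((i1.const_mul (g₂ - g₁)).add (hinv.const_mul ((g₂ - g₁) ^ 2))).congr
      (ae_of_all _ fun y => (eR y).symm)
  have hc : ∫ y, R y ∂(trueMeasure a p)
      = (g₂ - g₁) ^ 2 * ∫ y, (1 + (y - g₂) ^ 2)⁻¹ ∂(trueMeasure a p) := by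
    simp only [eR]
    rw [integral_add (i1.const_mul _) (hinv.const_mul _), integral_const_mul, hzero,
      integral_const_mul]
    ring
  have hcpos : 0 < ∫ y, R y ∂(trueMeasure a p) := by
    rw [hc]
    have : g₂ - g₁ ≠ 0 := sub_ne_zero.2 hne.symm
    positivity
  set c := ∫ y, R y ∂(trueMeasure a p) with hcdef
  set B := shiftBound g₁ g₂ with hB
  have hB0 : 0 ≤ B := shiftBound_nonneg _ _
  have hRB : ∀ y, |R y| ≤ B := fun y => abs_ratio_sub_one_le g₂ g₁ y
  -- The first bound on `s` validates `log (1 + x) ≥ x - 2x²` at `x = s * R y`; the second lets the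
  -- linear gain `s * c` beat the quadratic loss `2(sB)²`.
  obtain ⟨s, hs0, hs1, hsB, hsc⟩ : ∃ s : ℝ, 0 < s ∧ s ≤ 1 ∧ s * B ≤ 1 / 2
      ∧ s * (2 * B ^ 2) < c := by
    refine ⟨min 1 (min (1 / (2 * (B + 1))) (c / (2 * B ^ 2 + 1))), by positivity,
      min_le_left _ _, ?_, ?_⟩
    · have h2 : min 1 (min (1 / (2 * (B + 1))) (c / (2 * B ^ 2 + 1))) ≤ 1 / (2 * (B + 1)) :=
        (min_le_right _ _).trans (min_le_left _ _)
      calc _ ≤ 1 / (2 * (B + 1)) * B := by gcongr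
        _ ≤ 1 / 2 := by
          rw [div_mul_eq_mul_div, div_le_div_iff₀ (by positivity) (by norm_num)]; linarith
    · have h2 : min 1 (min (1 / (2 * (B + 1))) (c / (2 * B ^ 2 + 1))) ≤ c / (2 * B ^ 2 + 1) :=
        (min_le_right _ _).trans (min_le_right _ _)
      calc _ ≤ c / (2 * B ^ 2 + 1) * (2 * B ^ 2) := by gcongr
        _ < c := by rw [div_mul_eq_mul_div, div_lt_iff₀ (by positivity)]; linarith
  have hsI : s ∈ Set.Icc (0 : ℝ) 1 := ⟨hs0.le, hs1⟩
  have hzI : (0 : ℝ) ∈ Set.Icc (0 : ℝ) 1 := ⟨le_rfl, zero_le_one⟩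
  refine ⟨s, hsI, ?_⟩
  have hpt : ∀ y, s * R y - 2 * (s * B) ^ 2 ≤ Real.log (mixDensity g₁ g₂ s y)
      - Real.log (mixDensity g₁ g₂ 0 y) := by
    intro y
    have p1 := cauchyPDFReal_one_pos g₁ y
    rw [← Real.log_div (mixDensity_pos hsI y).ne' (mixDensity_pos hzI y).ne']
    have e : mixDensity g₁ g₂ s y / mixDensity g₁ g₂ 0 y = 1 + s * R y := by
      simp only [hR, mixDensity, sub_zero, one_mul, zero_mul, add_zero]
      field_simp
      ring
    rw [e]
    have hx : |s * R y| ≤ s * B := by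
      rw [abs_mul, abs_of_pos hs0]; exact mul_le_mul_of_nonneg_left (hRB y) hs0.le
    have hx2 : (s * R y) ^ 2 ≤ (s * B) ^ 2 := sq_le_sq' (abs_le.1 hx).1 (abs_le.1 hx).2
    have hx3 : -(1 / 2) ≤ s * R y := by linarith [(abs_le.1 hx).1]
    generalize s * R y = x at *
    have hl := Real.one_sub_inv_le_log_of_pos (show 0 < 1 + x by linarith)
    have : x - 2 * x ^ 2 ≤ 1 - (1 + x)⁻¹ := by
      have h3 : 0 < 1 + x := by linarith
      rw [← sub_nonneg]
      have e2 : 1 - (1 + x)⁻¹ - (x - 2 * x ^ 2) = x ^ 2 * (1 + 2 * x) / (1 + x) := by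
        field_simp; ring
      rw [e2]
      exact div_nonneg (mul_nonneg (sq_nonneg _) (by linarith)) h3.le
    linarith
  have is := integrable_log_mixDensity (g₁ := g₁) (g₂ := g₂) (a := a) h0 h1 hsI
  have iz := integrable_log_mixDensity (g₁ := g₁) (g₂ := g₂) (a := a) h0 h1 hzI
  have hmono := integral_mono ((iR.const_mul s).sub (integrable_const (2 * (s * B) ^ 2)))
    (is.sub iz) hpt
  simp only [Pi.sub_apply] at hmono
  rw [integral_sub (iR.const_mul s) (integrable_const _), integral_sub is iz,
    integral_const_mul, integral_const] at hmono
  simp only [probReal_univ, smul_eq_mul, one_mul] at hmono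
  change s * c - 2 * (s * B) ^ 2 ≤ limitScore a p g₁ g₂ s - limitScore a p g₁ g₂ 0 at hmono
  nlinarith

/-- The limiting stacking problem of two critical points has a unique, interior solution. -/
theorem exists_unique_max_limitScore (h0 : 0 ≤ p) (h1 : p ≤ 1)
    (hne : g₁ ≠ g₂)
    (hc₁ : HasDerivAt (limitLogPosterior a p) 0 g₁)
    (hc₂ : HasDerivAt (limitLogPosterior a p) 0 g₂) :
    ∃ s ∈ Set.Ioo (0 : ℝ) 1, ∀ t ∈ Set.Icc (0 : ℝ) 1, t ≠ s →
      limitScore a p g₁ g₂ t < limitScore a p g₁ g₂ s := by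
  obtain ⟨s, hs, hmax⟩ := isCompact_Icc.exists_isMaxOn
    (Set.nonempty_Icc.2 (zero_le_one' ℝ)) (continuousOn_limitScore (a := a) (g₁ := g₁)
      (g₂ := g₂) h0 h1)
  have hs0 : s ≠ 0 := by
    rintro rfl
    obtain ⟨t, ht, hlt⟩ := exists_limitScore_zero_lt h0 h1 hne hc₂
    exact (hmax ht).not_gt hlt
  have hs1 : s ≠ 1 := by
    rintro rfl
    obtain ⟨t, ht, hlt⟩ := exists_limitScore_zero_lt h0 h1 hne.symm hc₁
    have e0 : limitScore a p g₂ g₁ 0 = limitScore a p g₁ g₂ 1 := by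
      rw [← limitScore_one_sub]; simp
    have e1 : limitScore a p g₂ g₁ t = limitScore a p g₁ g₂ (1 - t) := by
      rw [← limitScore_one_sub]
    rw [e0, e1] at hlt
    exact (hmax ⟨sub_nonneg.2 ht.2, by linarith [ht.1]⟩).not_gt hlt
  refine ⟨s, ⟨lt_of_le_of_ne hs.1 hs0.symm, lt_of_le_of_ne hs.2 hs1⟩, fun t ht hts => ?_⟩
  refine lt_of_le_of_ne (hmax ht) fun he => ?_
  have h2 := limitScore_midpoint_lt (a := a) h0 h1 hne ht hs hts
  have hm : (t + s) / 2 ∈ Set.Icc (0 : ℝ) 1 :=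
    ⟨by linarith [hs.1, ht.1], by linarith [hs.2, ht.2]⟩
  have h3 : limitScore a p g₁ g₂ ((t + s) / 2) ≤ limitScore a p g₁ g₂ s := hmax hm
  linarith

/-! ### Expected log predictive densities and divergences -/

lemma integrable_log_of_isClose (h0 : 0 ≤ p) (h1 : p ≤ 1) {s t : ℝ}
    (ht : t ∈ Set.Icc (0 : ℝ) 1) {m : ℝ → ℝ}
    (hm : Measurable m) (hcl : ∀ y, IsClose s (m y) (mixDensity g₁ g₂ t y)) :
    Integrable (fun y => Real.log (m y)) (trueMeasure a p) ∧
      |∫ y, Real.log (m y) ∂(trueMeasure a p) - limitScore a p g₁ g₂ t| ≤ s := by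
  have := isProbabilityMeasure_trueMeasure h0 h1 a
  have hb : ∀ y, |Real.log (m y) - Real.log (mixDensity g₁ g₂ t y)| ≤ s := fun y =>
    (hcl y).abs_log_sub_le (mixDensity_pos ht y)
  have hi := integrable_log_mixDensity (g₁ := g₁) (g₂ := g₂) (a := a) h0 h1 ht
  have hd : Integrable (fun y => Real.log (m y) - Real.log (mixDensity g₁ g₂ t y))
      (trueMeasure a p) :=
    (integrable_const s).mono' (hm.log.sub (measurable_mixDensity _ _ _).log).aestronglyMeasurable
      (ae_of_all _ hb)
  have hlm : Integrable (fun y => Real.log (m y)) (trueMeasure a p) :=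
    (hd.add hi).congr (ae_of_all _ fun y => by simp)
  refine ⟨hlm, ?_⟩
  rw [limitScore, ← integral_sub hlm hi]
  have h := norm_integral_le_of_norm_le_const (μ := trueMeasure a p) (C := s)
    (f := fun y => Real.log (m y) - Real.log (mixDensity g₁ g₂ t y)) (ae_of_all _ hb)
  simpa using h

lemma measurable_predDensity (κ : Measure ℝ) [SFinite κ] : Measurable (predDensity κ) := by
  have hm : Measurable (Function.uncurry fun t μ : ℝ => cauchyPDFReal μ 1 t) := by
    simp only [cauchyPDFReal_one, Function.uncurry_def]
    fun_prop
  exact hm.stronglyMeasurable.integral_prod_right.measurable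

lemma measurable_predDensity_stacked {K : ℕ} {q : Fin K → Measure ℝ}
    (hq : ∀ k, IsProbabilityMeasure (q k)) {w : Fin K → ℝ} (hw : ∀ k, 0 ≤ w k) :
    Measurable (predDensity (stacked q w)) := by
  have e : predDensity (stacked q w) = fun t => ∑ k, w k * predDensity (q k) t :=
    funext (predDensity_stacked hq hw)
  rw [e]
  refine Finset.measurable_sum _ fun k _ => ?_
  have := hq k
  exact (measurable_predDensity (q k)).const_mul _

lemma integral_trueMeasure_eq (h0 : 0 ≤ p) (h1 : p ≤ 1) (φ : ℝ → ℝ) :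
    ∫ y, φ y ∂(trueMeasure a p) = ∫ y, trueDensity a p y * φ y := by
  rw [trueMeasure_eq_withDensity h0 h1,
    integral_withDensity_eq_integral_toReal_smul (measurable_trueDensity a p).ennreal_ofReal
      (by simp)]
  simp [ENNReal.toReal_ofReal (trueDensity_pos h0 h1 _ _).le]

lemma integrable_trueMeasure_iff (h0 : 0 ≤ p) (h1 : p ≤ 1) (φ : ℝ → ℝ) :
    Integrable φ (trueMeasure a p) ↔ Integrable fun y => trueDensity a p y * φ y := by
  rw [trueMeasure_eq_withDensity h0 h1, integrable_withDensity_iff_integrable_smul'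
    (measurable_trueDensity a p).ennreal_ofReal (by simp)]
  simp [ENNReal.toReal_ofReal (trueDensity_pos h0 h1 _ _).le]

lemma trueDensity_eq (a p y : ℝ) : trueDensity a p y = mixDensity (-a) a p y := by
  unfold trueDensity mixDensity; ring

/-- The divergence of measures carries a correction for the total mass. It is kept here, because the
upper bound `predMeasure_stacked_real_le` on the predictive mass is enough later. -/
lemma klDiv_predMeasure (h0 : 0 ≤ p) (h1 : p ≤ 1) {κ : Measure ℝ} (hm : Measurable (predDensity κ))
    (hpos : ∀ y, 0 < predDensity κ y)
    (hi : Integrable (fun y => Real.log (predDensity κ y)) (trueMeasure a p)) :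
    InformationTheory.klDiv (trueMeasure a p) (predMeasure κ)
      = ENNReal.ofReal (limitScore a p (-a) a p - elpd a p κ
        + (predMeasure κ).real Set.univ - 1) := by
  have := isProbabilityMeasure_trueMeasure h0 h1 a
  have hfm := measurable_trueDensity a p
  have : SigmaFinite (predMeasure κ) := by unfold predMeasure; infer_instance
  have hrm : Measurable fun y => ENNReal.ofReal (trueDensity a p y / predDensity κ y) :=
    (hfm.div hm).ennreal_ofReal
  have e : trueMeasure a p = (predMeasure κ).withDensity
      fun y => ENNReal.ofReal (trueDensity a p y / predDensity κ y) := by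
    rw [trueMeasure_eq_withDensity h0 h1, predMeasure,
      ← withDensity_mul _ hm.ennreal_ofReal hrm]
    congr 1
    ext y
    rw [Pi.mul_apply, ← ENNReal.ofReal_mul (hpos y).le, mul_div_cancel₀ _ (hpos y).ne']
  have hac : trueMeasure a p ≪ predMeasure κ := by
    rw [e]; exact withDensity_absolutelyContinuous _ _
  have hrn : (trueMeasure a p).rnDeriv (predMeasure κ)
      =ᵐ[predMeasure κ] fun y => ENNReal.ofReal (trueDensity a p y / predDensity κ y) := by
    conv_lhs => rw [e]
    exact Measure.rnDeriv_withDensity _ hrm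
  have hllr : llr (trueMeasure a p) (predMeasure κ) =ᵐ[trueMeasure a p]
      fun y => Real.log (mixDensity (-a) a p y) - Real.log (predDensity κ y) := by
    filter_upwards [hac.ae_le hrn] with y hy
    have hf := trueDensity_pos h0 h1 a y
    rw [llr, hy, ENNReal.toReal_ofReal (div_pos hf (hpos y)).le,
      Real.log_div hf.ne' (hpos y).ne', trueDensity_eq]
  have hil := integrable_log_mixDensity (g₁ := -a) (g₂ := a) (a := a) h0 h1 ⟨h0, h1⟩
  rw [InformationTheory.klDiv_of_ac_of_integrable hac ((hil.sub hi).congr hllr.symm),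
    integral_congr_ae hllr, integral_sub hil hi,
    probReal_univ (μ := trueMeasure a p)]
  rfl

lemma integral_Ioi_cauchyPDFReal (m : ℝ) :
    ∫ y in Set.Ioi 0, cauchyPDFReal m 1 y = 1 / 2 + Real.arctan m / Real.pi := by
  have h := integral_Ioi_of_hasDerivAt_of_tendsto' (a := (0 : ℝ))
    (f := fun y => Real.pi⁻¹ * Real.arctan (y - m)) (f' := cauchyPDFReal m 1)
    (m := Real.pi⁻¹ * (Real.pi / 2)) (fun y _ => by
      have := (((hasDerivAt_id y).sub_const m).arctan).const_mul Real.pi⁻¹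
      refine this.congr_deriv ?_
      rw [cauchyPDFReal_one]
      simp)
    (integrable_cauchyPDFReal m).integrableOn
    (((tendsto_nhds_of_tendsto_nhdsWithin Real.tendsto_arctan_atTop).comp
          (tendsto_atTop_add_const_right _ _ tendsto_id)).const_mul _)
  rw [h, zero_sub, Real.arctan_neg]
  have := Real.pi_pos
  field_simp
  ring

lemma integral_mixDensity (g₁ g₂ t : ℝ) : ∫ y, mixDensity g₁ g₂ t y = 1 := by
  unfold mixDensity
  rw [integral_add ((integrable_cauchyPDFReal _).const_mul _)
    ((integrable_cauchyPDFReal _).const_mul _), integral_const_mul, integral_const_mul,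
    integral_cauchyPDFReal_eq_one _ one_ne_zero, integral_cauchyPDFReal_eq_one _ one_ne_zero]
  ring

lemma integrable_mixDensity (g₁ g₂ t : ℝ) : Integrable (mixDensity g₁ g₂ t) :=
  ((integrable_cauchyPDFReal _).const_mul _).add ((integrable_cauchyPDFReal _).const_mul _)

lemma setIntegral_mixDensity (g₁ g₂ t : ℝ) : ∫ y in Set.Ioi 0, mixDensity g₁ g₂ t y
    = (1 - t) * (1 / 2 + Real.arctan g₁ / Real.pi) + t * (1 / 2 + Real.arctan g₂ / Real.pi) := by
  unfold mixDensity
  rw [integral_add ((integrable_cauchyPDFReal _).integrableOn.const_mul _)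
    ((integrable_cauchyPDFReal _).integrableOn.const_mul _), integral_const_mul,
    integral_const_mul, integral_Ioi_cauchyPDFReal, integral_Ioi_cauchyPDFReal]

/-- A Pinsker type inequality. -/
lemma sq_le_limitScore_sub (h0 : 0 ≤ p) (h1 : p ≤ 1) {t : ℝ} (ht : t ∈ Set.Icc (0 : ℝ) 1) :
    ((∫ y in Set.Ioi 0, mixDensity (-a) a p y) - ∫ y in Set.Ioi 0, mixDensity g₁ g₂ t y) ^ 2 / 4
      ≤ limitScore a p (-a) a p - limitScore a p g₁ g₂ t := by
  have hp : p ∈ Set.Icc (0 : ℝ) 1 := ⟨h0, h1⟩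
  set f := mixDensity (-a) a p with hf
  set q := mixDensity g₁ g₂ t with hq
  have hfi : Integrable f := integrable_mixDensity _ _ _
  have hqi : Integrable q := integrable_mixDensity _ _ _
  have hA : MeasurableSet (Set.Ioi (0 : ℝ)) := measurableSet_Ioi
  have hsub : ∀ g₁ g₂ t : ℝ, t ∈ Set.Icc (0 : ℝ) 1 →
      0 ≤ ∫ y in Set.Ioi 0, mixDensity g₁ g₂ t y ∧
        ∫ y in Set.Ioi 0, mixDensity g₁ g₂ t y ≤ 1 := by
    intro g₁ g₂ t ht
    refine ⟨setIntegral_nonneg hA fun y _ => (mixDensity_pos ht y).le, ?_⟩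
    rw [← integral_mixDensity g₁ g₂ t]
    exact setIntegral_le_integral (integrable_mixDensity _ _ _)
      (ae_of_all _ fun y => (mixDensity_pos ht y).le)
  obtain ⟨hF0, hF1⟩ := hsub (-a) a p hp
  obtain ⟨hQ0, hQ1⟩ := hsub g₁ g₂ t ht
  set F := ∫ y in Set.Ioi 0, f y with hF
  set Q := ∫ y in Set.Ioi 0, q y with hQ
  -- Gibbs' variational inequality with the test function `τ` times the indicator of the half-line.
  -- With `exp τ - 1 ≤ τ + τ²` and `Q ≤ 1`, the lower bound is `τ(F - Q) - τ²`, which is largest for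
  -- this `τ`.
  set τ := (F - Q) / 2 with hτ
  have hτ1 : |τ| ≤ 1 := by rw [abs_le]; constructor <;> linarith
  have il : Integrable (fun y => Real.log (f y) - Real.log (q y)) (trueMeasure a p) :=
    (integrable_log_mixDensity h0 h1 hp).sub (integrable_log_mixDensity h0 h1 ht)
  have il' := (integrable_trueMeasure_iff h0 h1 _).1 il
  have hfq : Integrable fun y => f y - q y := hfi.sub hqi
  have hRl : Integrable fun y => τ * (Set.Ioi (0 : ℝ)).indicator f y + (f y - q y) :=
    ((hfi.indicator hA).const_mul τ).add hfq
  have hR : Integrable fun y => (τ * (Set.Ioi (0 : ℝ)).indicator f y + (f y - q y))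
      - (Real.exp τ - 1) * (Set.Ioi (0 : ℝ)).indicator q y :=
    hRl.sub ((hqi.indicator hA).const_mul _)
  have hpt : ∀ y, (τ * (Set.Ioi (0 : ℝ)).indicator f y + (f y - q y))
      - (Real.exp τ - 1) * (Set.Ioi (0 : ℝ)).indicator q y
      ≤ trueDensity a p y * (Real.log (f y) - Real.log (q y)) := by
    intro y
    rw [trueDensity_eq]
    have pf : 0 < f y := mixDensity_pos hp y
    have pq : 0 < q y := mixDensity_pos ht y
    have key : ∀ g : ℝ, f y * g + f y - q y * Real.exp g
        ≤ f y * (Real.log (f y) - Real.log (q y)) := by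
      intro g
      have hl := Real.log_le_sub_one_of_pos (show 0 < q y * Real.exp g / f y by positivity)
      rw [Real.log_div (by positivity) pf.ne', Real.log_mul pq.ne' (Real.exp_pos g).ne',
        Real.log_exp] at hl
      have h2 := mul_le_mul_of_nonneg_left hl pf.le
      have h3 : f y * (q y * Real.exp g / f y - 1) = q y * Real.exp g - f y := by
        field_simp
      linarith
    by_cases hy : y ∈ Set.Ioi (0 : ℝ)
    · rw [Set.indicator_of_mem hy, Set.indicator_of_mem hy]
      have := key τ
      linarith
    · rw [Set.indicator_of_notMem hy, Set.indicator_of_notMem hy]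
      have := key 0
      simp only [Real.exp_zero] at this
      linarith
  have hmono := integral_mono hR il' hpt
  rw [integral_sub hRl ((hqi.indicator hA).const_mul _),
    integral_add ((hfi.indicator hA).const_mul τ) hfq, integral_const_mul, integral_const_mul,
    integral_indicator hA, integral_indicator hA, integral_sub hfi hqi, integral_mixDensity,
    integral_mixDensity, ← integral_trueMeasure_eq h0 h1,
    integral_sub (integrable_log_mixDensity h0 h1 hp)
    (integrable_log_mixDensity h0 h1 ht)] at hmono
  change τ * F + (1 - 1) - (Real.exp τ - 1) * Q
    ≤ limitScore a p (-a) a p - limitScore a p g₁ g₂ t at hmono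
  have hexp := (abs_le.1 (Real.abs_exp_sub_one_sub_id_le hτ1)).2
  have h5 : (Real.exp τ - 1) * Q ≤ τ * Q + τ ^ 2 := by nlinarith [sq_nonneg τ]
  have h6 : (F - Q) ^ 2 / 4 = τ * F - (τ * Q + τ ^ 2) := by rw [hτ]; ring
  linarith

end

/-! ### Well separated components -/

lemma scoreCubic_eq (a p μ : ℝ) : scoreCubic a p μ
    = p * (μ - a) * (4 + (μ + a) ^ 2) + (1 - p) * (μ + a) * (4 + (μ - a) ^ 2) := by
  unfold scoreCubic; ring

/-- If the components are well separated, then there are two modes, close to the components. -/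
lemma xiPoly_pos_and_roots_near {a p d : ℝ} (hp : 1 / 2 ≤ p) (hp1 : p < 1) (hd : 0 < d)
    (hd1 : d ≤ 1) (ha : 2 < a) (had : 5 / ((1 - p) * d) < a) :
    0 < xiPoly a p ∧ ∀ g₁ g₂ g₃ : ℝ, g₁ < g₂ → g₂ < g₃ →
      (∀ μ, scoreCubic a p μ = (μ - g₁) * (μ - g₂) * (μ - g₃)) →
      |-a - g₁| ≤ d ∧ |a - g₃| ≤ d := by
  have hq : 0 < 1 - p := by linarith
  have ha0 : 0 < a := by linarith
  have hk : 5 < (1 - p) * d * a := by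
    rw [div_lt_iff₀ (by positivity)] at had; linarith
  constructor
  -- With `u = p(1 - p)` one has `a * u > 5/2`, so the term `a⁶u²` alone beats `4(a² + 1)²`.
  · have h1 : 5 < (1 - p) * a := by nlinarith
    have h2 : 5 / 2 < a * (p * (1 - p)) := by nlinarith
    rw [xiPoly_eq]
    generalize p * (1 - p) = u at h2
    have hu : 0 < u := by
      by_contra hc
      nlinarith
    have h3 : 25 / 4 ≤ a ^ 2 * u ^ 2 := by nlinarith
    have h4 : 25 / 4 * a ^ 4 ≤ a ^ 4 * (a ^ 2 * u ^ 2) := by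
      rw [mul_comm]; exact mul_le_mul_of_nonneg_left h3 (by positivity)
    have h5 : 4 * (a ^ 2 + 1) ^ 2 ≤ 25 / 4 * a ^ 4 := by
      have h6 : a ^ 2 + 1 ≤ 5 / 4 * a ^ 2 := by nlinarith
      have := pow_le_pow_left₀ (by positivity) h6 2
      linarith
    have h7 : 0 < a ^ 4 * 4 * u ^ 2 + (12 * a ^ 4 + 44 * a ^ 2) * u := by positivity
    linarith
  · intro g₁ g₂ g₃ h12 h23 hroots
    -- The signs of the cubic at `-a`, `-a + d`, `a - d`, `a` alternate, starting with negative,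
    -- which traps the outer roots. The constant comes from `2a - d ≥ 3a/2`.
    have hsq : 9 / 4 * a ^ 2 ≤ 4 + (2 * a - d) ^ 2 := by nlinarith
    have n1 : scoreCubic a p (a - d) < 0 := by
      rw [scoreCubic_eq, show a - d + a = 2 * a - d by ring, show a - d - a = -d by ring]
      have e1 : (1 - p) * (2 * a - d) * (4 + (-d) ^ 2) ≤ (1 - p) * (2 * a) * 5 := by
        gcongr
        · linarith
        · nlinarith
      have e2 : p * d * (9 / 4 * a ^ 2) ≤ p * d * (4 + (2 * a - d) ^ 2) := by gcongr
      have e3 : (1 - p) * (2 * a) * 5 < p * d * (9 / 4 * a ^ 2) := by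
        have : 5 < d * a := by nlinarith [mul_pos hd ha0]
        have h8 : (1 - p) * (2 * a) * 5 ≤ 5 * a := by nlinarith
        have h9 : 9 / 8 * (d * a) * a ≤ p * d * (9 / 4 * a ^ 2) := by
          have := mul_le_mul_of_nonneg_right hp (show 0 ≤ 9 / 4 * d * a ^ 2 by positivity)
          nlinarith
        nlinarith
      nlinarith
    have n2 : 0 < scoreCubic a p (-a + d) := by
      rw [scoreCubic_eq, show -a + d - a = -(2 * a - d) by ring, show -a + d + a = d by ring]
      have e1 : p * (2 * a - d) * (4 + d ^ 2) ≤ 1 * (2 * a) * 5 := by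
        gcongr
        · linarith
        · linarith
        · nlinarith
      have e2 : (1 - p) * d * (9 / 4 * a ^ 2) ≤ (1 - p) * d * (4 + (2 * a - d) ^ 2) := by gcongr
      have e3 : 2 * a * 5 < (1 - p) * d * (9 / 4 * a ^ 2) := by
        nlinarith
      rw [neg_sq]
      linarith
    have n3 : 0 < scoreCubic a p a := by
      rw [scoreCubic_eq]
      have : 0 < (1 - p) * (a + a) * (4 + (a - a) ^ 2) := by positivity
      linarith
    have n4 : scoreCubic a p (-a) < 0 := by
      rw [scoreCubic_eq]
      have : 0 < p * (a + a) * (4 + (-a + a) ^ 2) := by positivity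
      linarith
    have pos_of : ∀ x, 0 < scoreCubic a p x → g₁ < x ∧ (x < g₂ ∨ g₃ < x) := by
      intro x hx
      rw [hroots] at hx
      constructor
      · by_contra hc
        have := mul_nonneg (mul_nonneg (show 0 ≤ g₁ - x by linarith)
          (show 0 ≤ g₂ - x by linarith)) (show 0 ≤ g₃ - x by linarith)
        linarith
      · by_contra! hc
        have hx1 : 0 ≤ x - g₁ := by linarith [hc.1]
        have := mul_nonneg (mul_nonneg hx1 (show 0 ≤ x - g₂ by linarith))
          (show 0 ≤ g₃ - x by linarith)
        linarith
    have neg_of : ∀ x, scoreCubic a p x < 0 → x < g₃ ∧ (x < g₁ ∨ g₂ < x) := by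
      intro x hx
      rw [hroots] at hx
      constructor
      · by_contra hc
        have := mul_nonneg (mul_nonneg (show 0 ≤ x - g₁ by linarith)
          (show 0 ≤ x - g₂ by linarith)) (show 0 ≤ x - g₃ by linarith)
        linarith
      · by_contra! hc
        have := mul_nonneg (mul_nonneg (show 0 ≤ x - g₁ by linarith)
          (show 0 ≤ g₂ - x by linarith)) (show 0 ≤ g₃ - x by linarith)
        linarith
    obtain ⟨a1, a2⟩ := neg_of _ n1
    obtain ⟨b1, b2⟩ := pos_of _ n2
    obtain ⟨-, c2⟩ := pos_of _ n3
    obtain ⟨-, d2⟩ := neg_of _ n4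
    have a3 : g₂ < a - d := by rcases a2 with h | h <;> linarith
    have b3 : -a + d < g₂ := by rcases b2 with h | h <;> linarith
    have c3 : g₃ < a := by rcases c2 with h | h <;> linarith
    have d3 : -a < g₁ := by rcases d2 with h | h <;> linarith
    constructor <;> rw [abs_le] <;> constructor <;> linarith

/-! ### Stacking of the two clusters -/

/-- The average log densities of the mixtures converge at the weight `s` and at rational weights. -/
def IsTypicalMix (a p g₁ g₂ s : ℝ) (y : ℕ → ℝ) : Prop :=
  Tendsto (fun n => avgLogMix g₁ g₂ y n s) atTop (𝓝 (limitScore a p g₁ g₂ s)) ∧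
    ∀ x : ℚ, (x : ℝ) ∈ Set.Icc (0 : ℝ) 1 →
      Tendsto (fun n => avgLogMix g₁ g₂ y n x) atTop (𝓝 (limitScore a p g₁ g₂ x))

section

variable {a p g₁ g₂ g₃ s : ℝ}

lemma ae_isTypicalMix (h0 : 0 ≤ p) (h1 : p ≤ 1) (hs : s ∈ Set.Icc (0 : ℝ) 1) :
    ∀ᵐ y ∂(dataLaw a p), IsTypicalMix a p g₁ g₂ s y := by
  have h : ∀ t ∈ Set.Icc (0 : ℝ) 1, ∀ᵐ y ∂(dataLaw a p),
      Tendsto (fun n => avgLogMix g₁ g₂ y n t) atTop (𝓝 (limitScore a p g₁ g₂ t)) :=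
    fun t ht => ae_tendsto_average h0 h1 (measurable_mixDensity g₁ g₂ t).log
      (integrable_log_mixDensity h0 h1 ht)
  have h2 : ∀ᵐ y ∂(dataLaw a p), ∀ x : ℚ, (x : ℝ) ∈ Set.Icc (0 : ℝ) 1 →
      Tendsto (fun n => avgLogMix g₁ g₂ y n x) atTop (𝓝 (limitScore a p g₁ g₂ x)) := by
    rw [ae_all_iff]
    intro x
    by_cases hx : (x : ℝ) ∈ Set.Icc (0 : ℝ) 1
    · exact (h x hx).mono fun y hy _ => hy
    · exact ae_of_all _ fun y h => absurd h hx
  filter_upwards [h s hs, h2] with y hy1 hy2 using ⟨hy1, hy2⟩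

lemma stacking_converges (h0 : 0 ≤ p) (h1 : p ≤ 1)
    (hb : IsBimodal (limitLogPosterior a p) g₁ g₂ g₃) (hs : s ∈ Set.Ioo (0 : ℝ) 1)
    (hmax : ∀ t ∈ Set.Icc (0 : ℝ) 1, t ≠ s → limitScore a p g₁ g₃ t < limitScore a p g₁ g₃ s)
    {ν : Measure ℝ} (hν : IsPrior ν) {ρ : (Fin 2 → ℝ) → ℝ} (hρ : IsWeightPrior ρ) {y : ℕ → ℝ}
    (hy : IsTypical a p y) (hy' : IsTypicalMix a p g₁ g₃ s y) {c : ℕ → ℝ}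
    (hc : Tendsto c atTop (𝓝 (antimode a p))) :
    (∀ᶠ n in atTop, ∃ w, IsStackingWeights ρ (clusters ν y n (c n)) y n w) ∧
      ∀ w : ℕ → Fin 2 → ℝ,
        (∀ᶠ n in atTop, IsStackingWeights ρ (clusters ν y n (c n)) y n (w n)) →
        Tendsto w atTop (𝓝 ![1 - s, s]) := by
  rw [antimode_eq hb] at hc
  have hq : ∀ r : ℝ, 0 < r → ∀ᶠ n in atTop,
      ∀ k, IsNear (![g₁, g₃] k) r (clusters ν y n (c n) k) := fun r hr =>
    hy.eventually_isNear_clusters h0 h1 hb hν hc hr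
  exact ⟨(hq (1 / 2) (by norm_num)).mono fun n hn => exists_isStackingWeights hρ hn,
    fun w hw => tendsto_stackingWeights hρ hq hs hmax hy'.1 hy'.2 hw⟩

lemma exists_isBimodal (ha : 2 < a) (hp : 1 / 2 ≤ p) (hp1 : p < 1) (hxi : 0 < xiPoly a p) :
    ∃ g₁ g₂ g₃ s : ℝ, g₁ < g₂ ∧ g₂ < g₃ ∧
      (∀ μ, scoreCubic a p μ = (μ - g₁) * (μ - g₂) * (μ - g₃)) ∧
      IsBimodal (limitLogPosterior a p) g₁ g₂ g₃ ∧ s ∈ Set.Ioo (0 : ℝ) 1 ∧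
      ∀ t ∈ Set.Icc (0 : ℝ) 1, t ≠ s → limitScore a p g₁ g₃ t < limitScore a p g₁ g₃ s := by
  obtain ⟨g₁, g₂, g₃, h12, h23, hroots⟩ := exists_roots_scoreCubic ha hp hp1 hxi
  have h0 : 0 ≤ p := by linarith
  have hb := isBimodal_limitLogPosterior h0 hp1.le h12 h23 hroots
  obtain ⟨s, hs, hmax⟩ := exists_unique_max_limitScore h0 hp1.le (h12.trans h23).ne
    hb.hasDerivAt_left hb.hasDerivAt_right
  exact ⟨g₁, g₂, g₃, s, h12, h23, hroots, hb, hs, hmax⟩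

lemma elpd_stacked_near (h0 : 0 ≤ p) (h1 : p ≤ 1) {r : ℝ} (hr : 0 ≤ r) (hr' : r ≤ 1 / 2)
    {q : Fin 2 → Measure ℝ} (hq : ∀ k, IsNear (![g₁, g₂] k) r (q k)) {w : Fin 2 → ℝ}
    (hw : w ∈ stdSimplex ℝ (Fin 2)) :
    Integrable (fun t => Real.log (predDensity (stacked q w) t)) (trueMeasure a p) ∧
      |elpd a p (stacked q w) - limitScore a p g₁ g₂ (w 1)| ≤ 2 * r :=
  integrable_log_of_isClose h0 h1 (mem_stdSimplex_two hw).2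
    (measurable_predDensity_stacked (fun k => (hq k).isProbabilityMeasure) hw.1)
    (isClose_stacked hr hr' hq hw)

lemma elpd_near (h0 : 0 ≤ p) (h1 : p ≤ 1) {γ r : ℝ} (hr : 0 ≤ r) (hr' : r ≤ 1 / 2)
    {κ : Measure ℝ} (hκ : IsNear γ r κ) :
    Integrable (fun t => Real.log (predDensity κ t)) (trueMeasure a p) ∧
      |elpd a p κ - limitLogPosterior a p γ| ≤ 2 * r := by
  have := hκ.isProbabilityMeasure
  rw [← limitScore_one a p γ γ]
  refine integrable_log_of_isClose h0 h1 ⟨zero_le_one, le_rfl⟩ (measurable_predDensity κ)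
    fun y => ?_
  have e : mixDensity γ γ 1 y = cauchyPDFReal γ 1 y := by simp [mixDensity]
  rw [e]
  exact hκ.isClose_predDensity hr hr' y

lemma tendsto_limitScore (h0 : 0 ≤ p) (h1 : p ≤ 1) (hs : s ∈ Set.Ioo (0 : ℝ) 1)
    {w : ℕ → Fin 2 → ℝ} (hw : Tendsto w atTop (𝓝 ![1 - s, s])) :
    Tendsto (fun n => limitScore a p g₁ g₂ (w n 1)) atTop (𝓝 (limitScore a p g₁ g₂ s)) := by
  have h : Tendsto (fun n => w n 1) atTop (𝓝 s) := (tendsto_pi_nhds.1 hw) 1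
  exact ((continuousOn_limitScore h0 h1).continuousAt (Icc_mem_nhds hs.1 hs.2)).tendsto.comp h

lemma predMeasure_stacked_real_le {r : ℝ} (hr : 0 ≤ r) (hr' : r ≤ 1 / 2)
    {q : Fin 2 → Measure ℝ} (hq : ∀ k, IsNear (![g₁, g₂] k) r (q k)) {w : Fin 2 → ℝ}
    (hw : w ∈ stdSimplex ℝ (Fin 2)) :
    (predMeasure (stacked q w)).real Set.univ ≤ Real.exp (2 * r) := by
  have hm := (mem_stdSimplex_two hw).2
  rw [measureReal_def, predMeasure, withDensity_apply _ MeasurableSet.univ, Measure.restrict_univ]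
  refine ENNReal.toReal_le_of_le_ofReal (Real.exp_pos _).le ?_
  calc ∫⁻ y, ENNReal.ofReal (predDensity (stacked q w) y)
      ≤ ∫⁻ y, ENNReal.ofReal (Real.exp (2 * r) * mixDensity g₁ g₂ (w 1) y) :=
        lintegral_mono fun y => ENNReal.ofReal_le_ofReal (isClose_stacked hr hr' hq hw y).2
    _ = ENNReal.ofReal (∫ y, Real.exp (2 * r) * mixDensity g₁ g₂ (w 1) y) :=
        (ofReal_integral_eq_lintegral_ofReal ((integrable_mixDensity _ _ _).const_mul _)
          (ae_of_all _ fun y => mul_nonneg (Real.exp_pos _).le (mixDensity_pos hm y).le)).symm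
    _ = _ := by rw [integral_const_mul, integral_mixDensity, mul_one]

/-- Moving each component by at most `d` changes the log density of the mixture by at most `d`. -/
lemma limitScore_sub_le (h0 : 0 ≤ p) (h1 : p ≤ 1) {d : ℝ} (hd₁ : |-a - g₁| ≤ d)
    (hd₂ : |a - g₂| ≤ d) : limitScore a p (-a) a p - limitScore a p g₁ g₂ p ≤ d := by
  have hp : p ∈ Set.Icc (0 : ℝ) 1 := ⟨h0, h1⟩
  have hcl : ∀ y, IsClose d (mixDensity (-a) a p y) (mixDensity g₁ g₂ p y) := by
    intro y
    have h := IsClose.sum (A := Finset.univ) (w := ![1 - p, p]) (s := d)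
      (x := ![cauchyPDFReal (-a) 1 y, cauchyPDFReal a 1 y])
      (z := ![cauchyPDFReal g₁ 1 y, cauchyPDFReal g₂ 1 y])
      (fun k _ => by fin_cases k <;> simp [h0, h1])
      (fun k _ => by
        fin_cases k
        · exact isClose_of_abs_log_sub_le (cauchyPDFReal_one_pos _ _) (cauchyPDFReal_one_pos _ _)
            ((abs_log_cauchyPDFReal_sub_le _ _ _).trans hd₁)
        · exact isClose_of_abs_log_sub_le (cauchyPDFReal_one_pos _ _) (cauchyPDFReal_one_pos _ _)
            ((abs_log_cauchyPDFReal_sub_le _ _ _).trans hd₂))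
    rw [Fin.sum_univ_two, Fin.sum_univ_two] at h
    exact h
  exact (abs_le.1 (integrable_log_of_isClose (a := a) h0 h1 hp
    (measurable_mixDensity _ _ _) hcl).2).2

/-- The limiting weights are close to the weights of the components if these are separated. -/
lemma abs_weight_sub_le (h0 : 0 ≤ p) (h1 : p ≤ 1) (hs : s ∈ Set.Icc (0 : ℝ) 1) {ε M : ℝ}
    (hM : Real.pi * (1 / 2 - ε) ≤ Real.arctan M) (hε : 0 ≤ ε) (haM : M ≤ a) (hg₁ : g₁ ≤ -M)
    (hg₂ : M ≤ g₂)
    (hs' : limitScore a p (-a) a p - limitScore a p g₁ g₂ s ≤ ε ^ 2) : |s - p| ≤ 4 * ε := by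
  have hpi := Real.pi_pos
  have hbound : ∀ x, |Real.arctan x / Real.pi| ≤ 1 / 2 := by
    intro x
    rw [abs_div, abs_of_pos hpi, div_le_iff₀ hpi, abs_le]
    have e1 := Real.neg_pi_div_two_lt_arctan x
    have e2 := Real.arctan_lt_pi_div_two x
    constructor <;> linarith
  have hM' : 1 / 2 - ε ≤ Real.arctan M / Real.pi := by rw [le_div_iff₀ hpi]; linarith
  have hright : ∀ x, M ≤ x → 1 - ε ≤ 1 / 2 + Real.arctan x / Real.pi := by
    intro x hx
    have : Real.arctan M / Real.pi ≤ Real.arctan x / Real.pi := by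
      gcongr
    linarith
  have hleft : ∀ x, x ≤ -M → 1 / 2 + Real.arctan x / Real.pi ≤ ε := by
    intro x hx
    have : Real.arctan x / Real.pi ≤ Real.arctan (-M) / Real.pi := by
      gcongr
    rw [Real.arctan_neg, neg_div] at this
    linarith
  -- For separated components, the mass of the positive half-line reads off the weight up to `ε`.
  -- Two such errors and `2 * ε` from the Pinsker type bound make `4 * ε`.
  have hmix : ∀ x z t : ℝ, x ≤ -M → M ≤ z → t ∈ Set.Icc (0 : ℝ) 1 →
      |(∫ y in Set.Ioi 0, mixDensity x z t y) - t| ≤ ε := by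
    intro x z t hx hz ht
    rw [setIntegral_mixDensity]
    have b1 := hleft x hx
    have b2 := hright z hz
    have b3 := (abs_le.1 (hbound x)).1
    have b4 := (abs_le.1 (hbound z)).2
    generalize Real.arctan x / Real.pi = u at *
    generalize Real.arctan z / Real.pi = v at *
    have c1 := mul_nonneg (sub_nonneg.2 ht.2) (show 0 ≤ 1 / 2 + u by linarith)
    have c2 := mul_nonneg (sub_nonneg.2 ht.2) (show 0 ≤ ε - (1 / 2 + u) by linarith)
    have c3 := mul_nonneg ht.1 (show 0 ≤ 1 / 2 - v by linarith)
    have c4 := mul_nonneg ht.1 (show 0 ≤ v - (1 / 2 - ε) by linarith)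
    have c5 := mul_nonneg (sub_nonneg.2 ht.2) hε
    have c6 := mul_nonneg ht.1 hε
    rw [abs_le]
    constructor <;> linarith
  have m1 := hmix (-a) a p (by linarith) haM ⟨h0, h1⟩
  have m2 := hmix g₁ g₂ s hg₁ hg₂ hs
  have h2 := (sq_le_limitScore_sub (a := a) (g₁ := g₁) (g₂ := g₂) h0 h1 hs).trans hs'
  generalize (∫ y in Set.Ioi 0, mixDensity (-a) a p y) = F at *
  generalize (∫ y in Set.Ioi 0, mixDensity g₁ g₂ s y) = Q at *
  have h3 : |F - Q| ≤ 2 * ε := abs_le_of_sq_le_sq (by nlinarith) (by linarith)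
  rw [abs_le] at *
  constructor <;> linarith

end

/-- The reflection `y ↦ -y` preserves the true density at `p = 1/2` and swaps the two components. -/
lemma limitScore_symm {a : ℝ} (g t : ℝ) :
    limitScore a (1 / 2) (-g) g (1 - t) = limitScore a (1 / 2) (-g) g t := by
  have h0 : (0 : ℝ) ≤ 1 / 2 := by norm_num
  have h1 : (1 / 2 : ℝ) ≤ 1 := by norm_num
  unfold limitScore
  rw [integral_trueMeasure_eq h0 h1, integral_trueMeasure_eq h0 h1, ← integral_neg_eq_self]
  refine integral_congr_ae (ae_of_all _ fun y => ?_)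
  have e : ∀ m : ℝ, cauchyPDFReal m 1 (-y) = cauchyPDFReal (-m) 1 y := by
    intro m
    rw [cauchyPDFReal_one, cauchyPDFReal_one]
    ring
  have e1 : trueDensity a (1 / 2) (-y) = trueDensity a (1 / 2) y := by
    unfold trueDensity
    rw [e, e, neg_neg]
    ring
  have e2 : mixDensity (-g) g (1 - t) (-y) = mixDensity (-g) g t y := by
    unfold mixDensity
    rw [e, e, neg_neg]
    ring
  simp only [e1, e2]

lemma isBimodal_symm {a : ℝ} (ha : 2 < a) :
    IsBimodal (limitLogPosterior a (1 / 2)) (-√(a ^ 2 - 4)) 0 √(a ^ 2 - 4) := by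
  have hpos : 0 < a ^ 2 - 4 := by nlinarith
  have hsq := Real.sqrt_pos.2 hpos
  refine isBimodal_limitLogPosterior (by norm_num) (by norm_num) (by linarith) hsq fun μ => ?_
  have h2 := Real.sq_sqrt hpos.le
  unfold scoreCubic
  linear_combination μ * h2

end CauchyStacking

open CauchyStacking
/-- The cut point `c n`, which may depend on the data, is any sequence that converges to the
antimode, so that the two clusters are, in the limit, the attraction regions of the two modes. In
weight vectors, index `0` belongs to the left mode and index `1` to the right mode. -/
theorem corollary5 :
    -- nonzero weights for both modes, and a strictly larger elpd
    (∀ a p : ℝ, 2 < a → 1 / 2 < p → p < xi a →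
      (modes a p = {gammaMinus a p, gammaPlus a p} ∧ antimodes a p = {antimode a p} ∧
        gammaMinus a p < antimode a p ∧ antimode a p < gammaPlus a p) ∧
      ∃ wlim : Fin 2 → ℝ, wlim ∈ stdSimplex ℝ (Fin 2) ∧ 0 < wlim 0 ∧ 0 < wlim 1 ∧
      ∃ δ : ℝ, 0 < δ ∧
      ∀ ν : Measure ℝ, IsPrior ν → ∀ ρ : (Fin 2 → ℝ) → ℝ, IsWeightPrior ρ →
      ∀ᵐ y ∂(dataLaw a p), ∀ c : ℕ → ℝ, Tendsto c atTop (𝓝 (antimode a p)) →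
        (∀ᶠ n in atTop, ∃ w, IsStackingWeights ρ (clusters ν y n (c n)) y n w) ∧
        ∀ w : ℕ → Fin 2 → ℝ,
          (∀ᶠ n in atTop, IsStackingWeights ρ (clusters ν y n (c n)) y n (w n)) →
          Tendsto w atTop (𝓝 wlim) ∧
          ∀ᶠ n in atTop,
            Integrable (fun t => Real.log (predDensity (exactPosterior ν y n) t)) (trueMeasure a p) ∧
            Integrable
              (fun t => Real.log (predDensity (stacked (clusters ν y n (c n)) (w n)) t))
              (trueMeasure a p) ∧
            elpd a p (exactPosterior ν y n) + δ ≤ elpd a p (stacked (clusters ν y n (c n)) (w n)))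
    ∧
    -- large `a`
    (∀ p : ℝ, 1 / 2 ≤ p → p < 1 → ∀ ε : ℝ, 0 < ε → ∃ A : ℝ, ∀ a : ℝ, A < a →
      2 < a ∧ p < xi a ∧
      ∀ ν : Measure ℝ, IsPrior ν → ∀ ρ : (Fin 2 → ℝ) → ℝ, IsWeightPrior ρ →
      ∀ᵐ y ∂(dataLaw a p), ∀ c : ℕ → ℝ, Tendsto c atTop (𝓝 (antimode a p)) →
        (∀ᶠ n in atTop, ∃ w, IsStackingWeights ρ (clusters ν y n (c n)) y n w) ∧
        ∀ w : ℕ → Fin 2 → ℝ,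
          (∀ᶠ n in atTop, IsStackingWeights ρ (clusters ν y n (c n)) y n (w n)) →
          ∀ᶠ n in atTop, |w n 0 - (1 - p)| < ε ∧ |w n 1 - p| < ε ∧
            InformationTheory.klDiv (trueMeasure a p)
              (predMeasure (stacked (clusters ν y n (c n)) (w n))) < ENNReal.ofReal ε)
    ∧
    -- the symmetric case
    (∀ a : ℝ, 2 < a →
      (modes a (1 / 2) = {gammaMinus a (1 / 2), gammaPlus a (1 / 2)} ∧
        gammaMinus a (1 / 2) = -√(a ^ 2 - 4) ∧ gammaPlus a (1 / 2) = √(a ^ 2 - 4) ∧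
        antimodes a (1 / 2) = {antimode a (1 / 2)} ∧ antimode a (1 / 2) = 0) ∧
      ∀ ν : Measure ℝ, IsPrior ν → ∀ ρ : (Fin 2 → ℝ) → ℝ, IsWeightPrior ρ →
      ∀ᵐ y ∂(dataLaw a (1 / 2)), ∀ c : ℕ → ℝ, Tendsto c atTop (𝓝 (antimode a (1 / 2))) →
        (∀ᶠ n in atTop, ∃ w, IsStackingWeights ρ (clusters ν y n (c n)) y n w) ∧
        ∀ w : ℕ → Fin 2 → ℝ,
          (∀ᶠ n in atTop, IsStackingWeights ρ (clusters ν y n (c n)) y n (w n)) →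
          Tendsto w atTop (𝓝 fun _ => 1 / 2)) := by
  refine ⟨fun a p ha hp hxi => ?_, fun p hp hp1 ε hε => ?_, fun a ha => ?_⟩
  · have h0 : 0 ≤ p := by linarith
    have ha0 : 0 < a := by linarith
    obtain ⟨hp1, hxi'⟩ := xiPoly_pos_of_lt_xi ha0 hp.le hxi
    obtain ⟨g₁, g₂, g₃, s, h12, h23, hroots, hb, hs, hmax⟩ :=
      exists_isBimodal ha hp.le hp1 hxi'
    refine ⟨?_, ?_⟩
    · rw [gammaMinus_eq hb, gammaPlus_eq hb, antimode_eq hb, modes_eq hb, antimodes_eq hb]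
      exact ⟨rfl, rfl, h12, h23⟩
    have hsI : s ∈ Set.Icc (0 : ℝ) 1 := ⟨hs.1.le, hs.2.le⟩
    have hgap : limitLogPosterior a p g₃ < limitScore a p g₁ g₃ s := by
      rw [← limitScore_one a p g₁ g₃]
      exact hmax 1 ⟨zero_le_one, le_rfl⟩ hs.2.ne'
    set D := limitScore a p g₁ g₃ s - limitLogPosterior a p g₃ with hD
    have hDpos : 0 < D := by linarith
    have hglob : ∀ μ, μ ≠ g₃ → limitLogPosterior a p μ < limitLogPosterior a p g₃ := by
      intro μ hμ
      rcases le_or_gt g₂ μ with h | h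
      · exact hb.lt_right h hμ
      · have hlr := limitLogPosterior_left_lt_right ha0 hp hp1 h12 h23 hroots
        rcases eq_or_ne μ g₁ with rfl | hne
        · exact hlr
        · exact (hb.lt_left h.le hne).trans hlr
    refine ⟨![1 - s, s], pair_mem_stdSimplex hsI, by simpa using hs.2, by simpa using hs.1,
      D / 4, by positivity, fun ν hν ρ hρ => ?_⟩
    filter_upwards [ae_isTypical h0 hp1.le a, ae_isTypicalMix (g₁ := g₁) (g₂ := g₃) h0 hp1.le hsI]
      with y hy hy' c hc
    obtain ⟨hex, hconv⟩ := stacking_converges h0 hp1.le hb hs hmax hν hρ hy hy' hc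
    refine ⟨hex, fun w hw => ⟨hconv w hw, ?_⟩⟩
    have hc' := hc
    rw [antimode_eq hb] at hc'
    -- Of the gap `D`, each elpd approximation costs at most `D / 8` and the convergence of the
    -- weights `D / 4`, so more than the claimed `D / 4` survives.
    have hr : 0 < min (1 / 2) (D / 16) := by positivity
    filter_upwards [hy.eventually_isNear_clusters h0 hp1.le hb hν hc' hr,
      hy.eventually_isNear_exactPosterior h0 hp1.le hglob hν hr, hw,
      (tendsto_limitScore (a := a) (g₁ := g₁) (g₂ := g₃) h0 hp1.le hs (hconv w hw)).eventually
        (lt_mem_nhds (show limitScore a p g₁ g₃ s - D / 4 < limitScore a p g₁ g₃ s by linarith))]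
      with n n1 n2 n3 n4
    obtain ⟨i1, b1⟩ := elpd_stacked_near (a := a) h0 hp1.le hr.le (min_le_left _ _) n1 n3.1
    obtain ⟨i2, b2⟩ := elpd_near (a := a) h0 hp1.le hr.le (min_le_left _ _) n2
    refine ⟨i2, i1, ?_⟩
    have b3 := (abs_le.1 b1).1
    have b4 := (abs_le.1 b2).2
    have b5 := min_le_right (1 / 2) (D / 16)
    linarith
  · have h0 : 0 ≤ p := by linarith
    have hpI : p ∈ Set.Icc (0 : ℝ) 1 := ⟨h0, hp1.le⟩
    obtain ⟨M, hM⟩ : ∃ M, Real.pi * (1 / 2 - ε / 8) ≤ Real.arctan M := by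
      have h := (tendsto_nhds_of_tendsto_nhdsWithin Real.tendsto_arctan_atTop).eventually
        (lt_mem_nhds (show Real.pi * (1 / 2 - ε / 8) < Real.pi / 2 by
          nlinarith [Real.pi_pos, mul_pos Real.pi_pos hε]))
      obtain ⟨M, hM⟩ := h.exists
      exact ⟨M, hM.le⟩
    -- Distance from the modes to `±a`: 1 keeps them beyond `±M` when `a > M + 1`, `ε / 4` is the
    -- share of the divergence, and `(ε / 8) ^ 2` feeds the weight bound.
    set d := min 1 (min (ε / 4) ((ε / 8) ^ 2)) with hd
    have hdpos : 0 < d := by positivity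
    have hd1 : d ≤ 1 := min_le_left _ _
    have hd2 : d ≤ ε / 4 := (min_le_right _ _).trans (min_le_left _ _)
    have hd3 : d ≤ (ε / 8) ^ 2 := (min_le_right _ _).trans (min_le_right _ _)
    refine ⟨max 2 (max (5 / ((1 - p) * d)) (M + 1)), fun a ha => ?_⟩
    obtain ⟨ha2, ha'⟩ := max_lt_iff.1 ha
    obtain ⟨had, haM⟩ := max_lt_iff.1 ha'
    obtain ⟨hxi, hnear⟩ := xiPoly_pos_and_roots_near hp hp1 hdpos hd1 ha2 had
    obtain ⟨g₁, g₂, g₃, s, h12, h23, hroots, hb, hs, hmax⟩ := exists_isBimodal ha2 hp hp1 hxi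
    obtain ⟨hg1, hg3⟩ := hnear g₁ g₂ g₃ h12 h23 hroots
    have hsI : s ∈ Set.Icc (0 : ℝ) 1 := ⟨hs.1.le, hs.2.le⟩
    refine ⟨ha2, lt_xi_of_xiPoly_pos hp hp1 hxi, fun ν hν ρ hρ => ?_⟩
    have hK : limitScore a p (-a) a p - limitScore a p g₁ g₃ s ≤ d := by
      have h2 := limitScore_sub_le h0 hp1.le hg1 hg3
      rcases eq_or_ne p s with he | hne
      · rwa [← he]
      · linarith [hmax p hpI hne]
    have hsp : |s - p| ≤ 4 * (ε / 8) :=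
      abs_weight_sub_le h0 hp1.le hsI hM (by positivity) (by linarith)
        (by linarith [(abs_le.1 hg1).1, hd1]) (by linarith [(abs_le.1 hg3).2, hd1])
        (hK.trans hd3)
    filter_upwards [ae_isTypical h0 hp1.le a, ae_isTypicalMix (g₁ := g₁) (g₂ := g₃) h0 hp1.le hsI]
      with y hy hy' c hc
    obtain ⟨hex, hconv⟩ := stacking_converges h0 hp1.le hb hs hmax hν hρ hy hy' hc
    refine ⟨hex, fun w hw => ?_⟩
    have hc' := hc
    rw [antimode_eq hb] at hc'
    -- The divergence adds up to less than `ε`: `ε / 4` from the optimal mixture, `ε / 4` from the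
    -- weights, `ε / 16` from the elpd, and `ε / 8` from the excess mass.
    have hr : 0 < min (1 / 2) (ε / 32) := by positivity
    have hw1 : Tendsto (fun n => w n 1) atTop (𝓝 s) := (tendsto_pi_nhds.1 (hconv w hw)) 1
    filter_upwards [hy.eventually_isNear_clusters h0 hp1.le hb hν hc' hr, hw,
      (tendsto_limitScore (a := a) (g₁ := g₁) (g₂ := g₃) h0 hp1.le hs (hconv w hw)).eventually
        (lt_mem_nhds (show limitScore a p g₁ g₃ s - ε / 4 < limitScore a p g₁ g₃ s by linarith)),
      hw1.eventually (Metric.ball_mem_nhds s (show 0 < ε / 2 by positivity))]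
      with n n1 n2 n3 n4
    have hw1p : |w n 1 - p| < ε := by
      have e : |w n 1 - s| < ε / 2 := by rwa [← Real.dist_eq]
      have := abs_add_le (w n 1 - s) (s - p)
      rw [sub_add_sub_cancel] at this
      linarith
    refine ⟨?_, hw1p, ?_⟩
    · rw [(mem_stdSimplex_two n2.1).1, sub_sub_sub_cancel_left, abs_sub_comm]
      exact hw1p
    obtain ⟨i1, b1⟩ := elpd_stacked_near (a := a) h0 hp1.le hr.le (min_le_left _ _) n1 n2.1
    rw [klDiv_predMeasure h0 hp1.le
      (measurable_predDensity_stacked (fun k => (n1 k).isProbabilityMeasure) n2.1.1)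
      (fun y => (isClose_stacked hr.le (min_le_left _ _) n1 n2.1 y).pos
        (mixDensity_pos (mem_stdSimplex_two n2.1).2 y)) i1]
    rw [ENNReal.ofReal_lt_ofReal_iff hε]
    have b2 := predMeasure_stacked_real_le hr.le (min_le_left _ _) n1 n2.1
    have b3 := min_le_right (1 / 2) (ε / 32)
    have b4 := min_le_left (1 / 2) (ε / 32)
    have b5 := (abs_le.1 b1).1
    have b6 : Real.exp (2 * min (1 / 2) (ε / 32)) ≤ 1 + 4 * min (1 / 2) (ε / 32) := by
      have h := (abs_le.1 (Real.abs_exp_sub_one_sub_id_le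
        (show |2 * min (1 / 2) (ε / 32)| ≤ 1 by rw [abs_of_pos (by positivity)]; linarith))).2
      nlinarith
    linarith
  · have hb := isBimodal_symm ha
    have h0 : (0 : ℝ) ≤ 1 / 2 := by norm_num
    have h1 : (1 / 2 : ℝ) ≤ 1 := by norm_num
    refine ⟨?_, fun ν hν ρ hρ => ?_⟩
    · rw [gammaMinus_eq hb, gammaPlus_eq hb, antimode_eq hb, modes_eq hb, antimodes_eq hb]
      exact ⟨rfl, rfl, rfl, rfl, rfl⟩
    obtain ⟨s, hs, hmax⟩ := exists_unique_max_limitScore h0 h1 (hb.lt₁.trans hb.lt₂).ne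
      hb.hasDerivAt_left hb.hasDerivAt_right
    have hsI : s ∈ Set.Icc (0 : ℝ) 1 := ⟨hs.1.le, hs.2.le⟩
    -- By symmetry `1 - s` is a maximizer too, and the maximizer is unique.
    have hs2 : s = 1 / 2 := by
      by_contra hne
      have := hmax (1 - s) ⟨by linarith [hs.2], by linarith [hs.1]⟩
        (fun h => hne (by linarith))
      rw [limitScore_symm] at this
      exact lt_irrefl _ this
    filter_upwards [ae_isTypical h0 h1 a, ae_isTypicalMix (g₁ := -√(a ^ 2 - 4))
      (g₂ := √(a ^ 2 - 4)) h0 h1 hsI] with y hy hy' c hc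
    obtain ⟨hex, hconv⟩ := stacking_converges h0 h1 hb hs hmax hν hρ hy hy' hc
    refine ⟨hex, fun w hw => ?_⟩
    have e : (![1 - s, s] : Fin 2 → ℝ) = fun _ => 1 / 2 := by
      ext k
      fin_cases k <;> simp [hs2]
      norm_num
    rw [← e]
    exact hconv w hw
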